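/- Let $(r,\theta,\phi)$ be spherical coordinates in $\mathbb R^3$, $\theta\in[0,\pi]$ being the angle to the positive $x_3$-axis, with unit vectors $\vec e_r,\vec e_\theta,\vec e_\phi$, and let $N$ ($\theta=0$) and $S$ ($\theta=\pi$) be the poles of the unit sphere $\mathbb S^2$. For $\nu\ge 0$, a *solution with viscosity $\nu$* is a pair $(u,p)$ that is $C^\infty$ on $\mathbb R^3$ minus the $x_3$-axis and satisfies there $-\nu\Delta u+u\cdot\nabla u+\nabla p=0$, $\operatorname{div}u=0$, with $u$ $(-1)$-homogeneous, $p$ $(-2)$-homogeneous, and $u$ axisymmetric without swirl, that is, $u=u_r(r,\theta)\vec e_r+u_\theta(r,\theta)\vec e_\theta$. For $\nu=0$ the equations are the stationary Euler equations. For $\nu\ge0$ let $\bar c_3(c_1,c_2;\nu)=-\frac12\left(\sqrt{\nu^2+c_1}+\sqrt{\nu^2+c_2}\right)\left(\sqrt{\nu^2+c_1}+\sqrt{\nu^2+c_2}+2\nu\right)$ and $J_\nu=\{c\in\mathbb R^3: c_1\ge-\nu^2,\ c_2\ge-\nu^2,\ c_3\ge\bar c_3(c_1,c_2;\nu)\}$,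 with interior $\mathring J_\nu$. Put $P_c(x)=c_1(1-x)+c_2(1+x)+c_3(1-x^2)$, and for $c\in\mathring J_0$ $$v_c^{\pm}=\pm\frac{P_c'(\cos\theta)}{r\sqrt{2P_c(\cos\theta)}}\,\vec e_r\pm\frac{\sqrt{2P_c(\cos\theta)}}{r\sin\theta}\,\vec e_\theta,\qquad q_c=-\frac1{2r^2}\left(P_c''(\cos\theta)+\frac{2P_c(\cos\theta)}{\sin^2\theta}\right).$$ For $c\in\mathring J_0$, $(v_c^{+},q_c)$ and $(v_c^-,q_c)$ are solutions with viscosity $0$, and $v_c^+\neq v_c^-$ at every point of $\mathbb S^2\setminus\{S,N\}$. Norms in $C^m(A)$, $A\subset\mathbb S^2$, are those of restrictions to the sphere, and $B_\epsilon$ denotes open balls of radius $\epsilon$. **Theorem 1.3.** (i) For each of the two signs there are solutions $(u_\nu^\pm(c),p_\nu^\pm(c))$ with viscosity $\nu$, defined for $0<\nu\le1$ and $c\in\mathring J_\nu$, such that for every integer $m\ge0$ and every $\epsilon>0$ the map $(c,\nu)\mapsto(u_\nu^\pm(c),p_\nu^\pm(c))$ is continuous into $C^m(\mathbb S^2\setminus(B_\epsilon(S)\cup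 B_\epsilon(N)))$; and for every compact $K\subset\mathring J_0$, every $\epsilon>0$ and every integer $m\ge0$ there is a constant $C$, depending only on $\epsilon,K,m$, with $$\left\|(u_\nu^\pm(c),p_\nu^\pm(c))-(v_c^\pm,q_c)\right\|_{C^m(\mathbb S^2\setminus(B_\epsilon(S)\cup B_\epsilon(N)))}\le C\nu\qquad\text{for all }c\in K,\ 0<\nu\le1.$$ (ii) There are solutions $(u_\nu(c,\theta_0),p_\nu(c,\theta_0))$ with viscosity $\nu$, defined for $0<\nu\le1$, $c\in\mathring J_\nu$ and $0<\theta_0<\pi$, such that for every integer $m\ge0$ and every $\epsilon>0$ the map $(c,\nu,\theta_0)\mapsto(u_\nu(c,\theta_0),p_\nu(c,\theta_0))$ is continuous into $C^m(\mathbb S^2\setminus(B_\epsilon(S)\cup B_\epsilon(N)))$; and for every compact $K\subset\mathring J_0$, every $\epsilon>0$ and every integer $m\ge0$ there is a constant $C$, depending only on $\epsilon,K,m$, with $$\left\|(u_\nu(c,\theta_0),p_\nu(c,\theta_0))-(v_c^-,q_c)\right\|_{C^m(\mathbb S^2\cap\{\theta_0+\epsilon<\theta<\pi-\epsilon\})}+\left\|(u_\nu(c,\theta_0),p_\nu(c,\theta_0))-(v_c^+,q_c)\right\|_{C^m(\mathbb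 S^2\cap\{\epsilon<\theta<\theta_0-\epsilon\})}\le C\nu$$ for all $c\in K$, $0<\nu\le1$ and $0<\theta_0<\pi$. In particular, as $\nu\to0$ the limit jumps across the circle $\theta=\theta_0$. -/

import Mathlib

open Set Filter Topology
open scoped ContDiff

noncomputable section

/-- Three-dimensional Euclidean space; the coordinates `x₁, x₂, x₃` are `x 0, x 1, x 2`. -/
abbrev E3 : Type := EuclideanSpace ℝ (Fin 3)

/-! ### Spherical coordinates -/

/-- The unit vector `e_r` at the polar angle `θ` and the meridian angle `φ`. -/
def eR (θ φ : ℝ) : E3 :=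
  !₂[Real.sin θ * Real.cos φ, Real.sin θ * Real.sin φ, Real.cos θ]

/-- The unit vector `e_θ` at the polar angle `θ` and the meridian angle `φ`. -/
def eTheta (θ φ : ℝ) : E3 :=
  !₂[Real.cos θ * Real.cos φ, Real.cos θ * Real.sin φ, -Real.sin θ]

/-- The point with spherical coordinates `(r, θ, φ)`. -/
def sphPoint (r θ φ : ℝ) : E3 := r • eR θ φ

/-- The polar angle `θ ∈ [0, π]`, measured from the positive `x₃`-axis. -/
def polarAngle (x : E3) : ℝ := Real.arccos (x 2 / ‖x‖)

/-- The meridian angle `φ ∈ (-π, π]` about the `x₃`-axis. -/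
def meridianAngle (x : E3) : ℝ := Complex.arg ⟨x 0, x 1⟩

/-- `ℝ³` without the `x₃`-axis, i.e. the open cone generated by the unit sphere minus its poles. -/
def offAxis : Set E3 := {x | x 0 ≠ 0 ∨ x 1 ≠ 0}

/-- `u = u_r e_r + u_θ e_θ` away from the axis, with `u_r`, `u_θ` depending only on `r` and `θ`
(and without a component along `e_φ`). -/
def AxisymmetricNoSwirl (u : E3 → E3) : Prop :=
  ∃ ur uθ : ℝ → ℝ → ℝ, ∀ r θ φ : ℝ, 0 < r → 0 < θ → θ < Real.pi →
    u (sphPoint r θ φ) = ur r θ • eR θ φ + uθ r θ • eTheta θ φ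

/-! ### The equations -/

/-- The divergence of a vector field. -/
def divergence (u : E3 → E3) (x : E3) : ℝ :=
  ∑ i : Fin 3, (fderiv ℝ u x (EuclideanSpace.single i 1)) i

/-- `(u, p)` is a `(-1)`-homogeneous axisymmetric no-swirl solution, smooth on the sphere minus the
poles, of the stationary Navier–Stokes equations with viscosity `ν` (the Euler equations when
`ν = 0`). Here `fderiv ℝ u x (u x)` is `u · ∇u` at `x`. -/
structure IsHomSolution (ν : ℝ) (u : E3 → E3) (p : E3 → ℝ) : Prop where
  smooth_velocity : ContDiffOn ℝ ∞ u offAxis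
  smooth_pressure : ContDiffOn ℝ ∞ p offAxis
  hom_velocity : ∀ x ∈ offAxis, ∀ t : ℝ, 0 < t → u (t • x) = t⁻¹ • u x
  hom_pressure : ∀ x ∈ offAxis, ∀ t : ℝ, 0 < t → p (t • x) = (t ^ 2)⁻¹ * p x
  axisymmetric_noSwirl : AxisymmetricNoSwirl u
  momentum : ∀ x ∈ offAxis,
    -(ν • Laplacian.laplacian u x) + fderiv ℝ u x (u x) + gradient p x = 0
  incompressible : ∀ x ∈ offAxis, divergence u x = 0

/-! ### The parameters and the Euler solutions -/

/-- The function `c̄₃(c₁, c₂; ν)`. -/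
def c3bar (c₁ c₂ ν : ℝ) : ℝ :=
  -(1 / 2) * (Real.sqrt (ν ^ 2 + c₁) + Real.sqrt (ν ^ 2 + c₂)) *
    (Real.sqrt (ν ^ 2 + c₁) + Real.sqrt (ν ^ 2 + c₂) + 2 * ν)

/-- The parameter set `J_ν ⊆ ℝ³`; the parameter is `c = (c₁, c₂, c₃) = (c 0, c 1, c 2)`. -/
def paramJ (ν : ℝ) : Set (Fin 3 → ℝ) :=
  {c | -ν ^ 2 ≤ c 0 ∧ -ν ^ 2 ≤ c 1 ∧ c3bar (c 0) (c 1) ν ≤ c 2}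

/-- `P_c(x) = c₁ (1 - x) + c₂ (1 + x) + c₃ (1 - x²)`. -/
def polyP (c : Fin 3 → ℝ) (x : ℝ) : ℝ :=
  c 0 * (1 - x) + c 1 * (1 + x) + c 2 * (1 - x ^ 2)

/-- The velocity `v_c^±`; the sign is `s = ±1`. -/
def eulerV (s : ℝ) (c : Fin 3 → ℝ) (x : E3) : E3 :=
  (s * (deriv (polyP c) (Real.cos (polarAngle x)) /
      (‖x‖ * Real.sqrt (2 * polyP c (Real.cos (polarAngle x)))))) •
      eR (polarAngle x) (meridianAngle x)
    + (s * (Real.sqrt (2 * polyP c (Real.cos (polarAngle x))) /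
      (‖x‖ * Real.sin (polarAngle x)))) •
      eTheta (polarAngle x) (meridianAngle x)

/-- The pressure `q_c`. -/
def eulerQ (c : Fin 3 → ℝ) (x : E3) : ℝ :=
  -(1 / (2 * ‖x‖ ^ 2)) *
    (deriv (deriv (polyP c)) (Real.cos (polarAngle x)) +
      2 * polyP c (Real.cos (polarAngle x)) / Real.sin (polarAngle x) ^ 2)

/-! ### `C^m` norms on subsets of the sphere -/

/-- The `C^m` norm, on a subset `A` of the unit sphere, of the restriction of `f` to the sphere: the
derivatives along the sphere are those of the extension of `f` that is constant on rays. -/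
def sphereCmNorm {F : Type*} [NormedAddCommGroup F] [NormedSpace ℝ F]
    (m : ℕ) (A : Set E3) (f : E3 → F) : ENNReal :=
  ⨆ x ∈ A, ∑ k ∈ Finset.range (m + 1),
    ‖iteratedFDeriv ℝ k (fun y : E3 => f (‖y‖⁻¹ • y)) x‖ₑ

/-- `a ↦ f a` is a continuous map from `D` to `C^m(A)`, for functions `f a` that are smooth near
`A` (as the solutions are). -/
def ContinuousIntoCm {Λ F : Type*} [TopologicalSpace Λ] [NormedAddCommGroup F] [NormedSpace ℝ F]
    (m : ℕ) (A : Set E3) (D : Set Λ) (f : Λ → E3 → F) : Prop :=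
  ∀ a ∈ D, sphereCmNorm m A (f a) < ⊤ ∧
    Tendsto (fun b => sphereCmNorm m A (fun x => f b x - f a x)) (𝓝[D] a) (𝓝 0)

/-- The north pole. -/
def northPole : E3 := !₂[0, 0, 1]

/-- The south pole. -/
def southPole : E3 := !₂[0, 0, -1]

/-- `𝕊² \ (B_ε(S) ∪ B_ε(N))`. -/
def sphereAwayFromPoles (ε : ℝ) : Set E3 :=
  Metric.sphere 0 1 \ (Metric.ball southPole ε ∪ Metric.ball northPole ε)

/-- `𝕊² ∩ {a < θ < b}`. -/
def sphereBand (a b : ℝ) : Set E3 :=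
  {x | x ∈ Metric.sphere (0 : E3) 1 ∧ a < polarAngle x ∧ polarAngle x < b}

/-- `{(c, ν) : 0 < ν ≤ 1, c ∈ interior of J_ν}`. -/
def paramSet : Set ((Fin 3 → ℝ) × ℝ) :=
  {a | 0 < a.2 ∧ a.2 ≤ 1 ∧ a.1 ∈ interior (paramJ a.2)}

/-- `{((c, ν), θ₀) : 0 < ν ≤ 1, c ∈ interior of J_ν, 0 < θ₀ < π}`. -/
def paramSetAngle : Set (((Fin 3 → ℝ) × ℝ) × ℝ) := paramSet ×ˢ Ioo 0 Real.pi

end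

/-! Write t = cos θ and u_θ = g(t) sin θ / r. Incompressibility forces r u_r = ((1 - t²) g)', and
with the pressure of `pressureProfile` the defect in the momentum equation is a multiple of the
position vector. It vanishes once ((1 - t²)² (ν g' + g²/2))'' = -2c₃. Hence every smooth solution on
(-1, 1) of the Riccati equation ν g' + g²/2 = P_c / (1 - t²)² gives a flow
(`Riccati.isHomSolution`). For ν = 0 the solutions ± G, with G = √(2P_c) / (1 - t²), give the Euler
flows.

For ν > 0 put g = 2ν φ'/φ, which makes the equation linear, with regular singular points at ±1.
Taking φ = (1 + x)^ρ₁ (1 - x)^ρ₂ F((1 + x)/2), with ρ₁, ρ₂ the larger exponents, leaves a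
hypergeometric equation for F. The condition c₃ ≥ c̄₃ says exactly that the Taylor coefficients of F
are nonnegative, so φ has no zero and g = `gPlus` exists on all of (-1, 1). Exchanging the poles
gives `gMinus`. These two solutions form the two families of (i).

Convergence at rate ν is a stability argument. The equation 2ν g' = G² - g² attracts towards G as x
increases, so barriers with a weight vanishing at the left end bound (g - G)/ν without any initial
data (`riccati_le`, `le_riccati`; the second needs the positivity of `le_gPlus`). Derivatives of the
error solve linear equations ν y' = -A y + h with damping A = `gPlus`, bounded below, and
`stiff_linear_le` bounds them uniformly in ν (`tower_gPlusError`).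

For (ii), positive combinations of the two functions φ give solutions that are averages of `gPlus`
and `gMinus`, with a weight equal to 1/2 at cos θ₀. The quotient of the two functions φ decays like
exp(-A₀ d/ν) over a distance d, because `gPlus - gMinus` is bounded below. So away from θ₀ the
weight is within any power of ν of 0 or 1, and it solves a logistic equation, which carries this
over to all derivatives (`tower_of_logistic`).

Continuity in the parameters and bounds uniform in ν are closed under the same algebraic operations.
`Tower` treats both at once; `exists_sphereCmNorm_flowField_le` converts estimates on profiles into
C^m estimates on the sphere. -/

noncomputable section

/-! ### Families of functions with controlled derivatives -/

/-- A class of families `a ↦ (x ↦ f a x)` of functions on `(-1, 1)`, with parameters in `S`, that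
contains the constants, is stable under sums and products, and only sees the values on
`S × (-1, 1)`. -/
structure FamilyClass {Λ : Type*} (S : Set Λ) where
  carrier : Set (Λ → ℝ → ℝ)
  const_mem : ∀ r : ℝ, (fun _ _ => r) ∈ carrier
  add_mem : ∀ {f g : Λ → ℝ → ℝ}, f ∈ carrier → g ∈ carrier → (fun a x => f a x + g a x) ∈ carrier
  mul_mem : ∀ {f g : Λ → ℝ → ℝ}, f ∈ carrier → g ∈ carrier → (fun a x => f a x * g a x) ∈ carrier
  congr_mem : ∀ {f g : Λ → ℝ → ℝ}, f ∈ carrier →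
    (∀ a ∈ S, ∀ x ∈ Ioo (-1 : ℝ) 1, f a x = g a x) → g ∈ carrier

/-- The family `f` has `k` derivatives in `x` on `(-1, 1)`, all of them, and `f` itself, in the
class `𝒜`. -/
def Tower {Λ : Type*} {S : Set Λ} (𝒜 : FamilyClass S) : ℕ → (Λ → ℝ → ℝ) → Prop
  | 0, f => f ∈ 𝒜.carrier
  | k + 1, f => f ∈ 𝒜.carrier ∧ ∃ f' : Λ → ℝ → ℝ,
      (∀ a ∈ S, ∀ x ∈ Ioo (-1 : ℝ) 1, HasDerivAt (f a) (f' a x) x) ∧ Tower 𝒜 k f'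

namespace Tower

variable {Λ : Type*} {S : Set Λ} {𝒜 : FamilyClass S} {k : ℕ} {f g f' : Λ → ℝ → ℝ}

theorem mem (h : Tower 𝒜 k f) : f ∈ 𝒜.carrier := by
  cases k with
  | zero => exact h
  | succ k => exact h.1

theorem of_succ (h : Tower 𝒜 (k + 1) f) : Tower 𝒜 k f := by
  induction k generalizing f with
  | zero => exact h.1
  | succ k ih =>
    obtain ⟨h0, f', h1, h2⟩ := h
    exact ⟨h0, f', h1, ih h2⟩

theorem eventuallyEq_of_eqOn {f g : ℝ → ℝ} (h : ∀ x ∈ Ioo (-1 : ℝ) 1, f x = g x) {x : ℝ}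
    (hx : x ∈ Ioo (-1 : ℝ) 1) : f =ᶠ[𝓝 x] g :=
  Filter.eventually_of_mem (isOpen_Ioo.mem_nhds hx) h

theorem congr (h : Tower 𝒜 k f) (hfg : ∀ a ∈ S, ∀ x ∈ Ioo (-1 : ℝ) 1, f a x = g a x) :
    Tower 𝒜 k g := by
  cases k with
  | zero => exact 𝒜.congr_mem h hfg
  | succ k =>
    obtain ⟨h0, f', h1, h2⟩ := h
    refine ⟨𝒜.congr_mem h0 hfg, f', fun a ha x hx => ?_, h2⟩
    exact (h1 a ha x hx).congr_of_eventuallyEq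
      (eventuallyEq_of_eqOn (fun y hy => (hfg a ha y hy).symm) hx)

/-- The derivative of a family is determined on `S × (-1, 1)`. -/
theorem derivative (h : Tower 𝒜 (k + 1) f)
    (hf : ∀ a ∈ S, ∀ x ∈ Ioo (-1 : ℝ) 1, HasDerivAt (f a) (f' a x) x) : Tower 𝒜 k f' := by
  obtain ⟨_, f'', h1, h2⟩ := h
  exact h2.congr fun a ha x hx => (h1 a ha x hx).unique (hf a ha x hx)

theorem hasDerivAt_deriv (h : Tower 𝒜 (k + 1) f) {a : Λ} (ha : a ∈ S) {x : ℝ}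
    (hx : x ∈ Ioo (-1 : ℝ) 1) : HasDerivAt (f a) (deriv (f a) x) x := by
  obtain ⟨_, f'', h1, _⟩ := h
  exact (h1 a ha x hx).differentiableAt.hasDerivAt

theorem tower_deriv (h : Tower 𝒜 (k + 1) f) : Tower 𝒜 k (fun a => deriv (f a)) :=
  h.derivative fun _ ha _ hx => h.hasDerivAt_deriv ha hx

theorem add (hf : Tower 𝒜 k f) (hg : Tower 𝒜 k g) : Tower 𝒜 k (fun a x => f a x + g a x) := by
  induction k generalizing f g with
  | zero => exact 𝒜.add_mem hf hg
  | succ k ih =>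
    obtain ⟨f0, f', f1, f2⟩ := hf
    obtain ⟨g0, g', g1, g2⟩ := hg
    exact ⟨𝒜.add_mem f0 g0, _, fun a ha x hx => (f1 a ha x hx).add (g1 a ha x hx), ih f2 g2⟩

theorem mul (hf : Tower 𝒜 k f) (hg : Tower 𝒜 k g) : Tower 𝒜 k (fun a x => f a x * g a x) := by
  induction k generalizing f g with
  | zero => exact 𝒜.mul_mem hf hg
  | succ k ih =>
    have hf' := hf.of_succ
    have hg' := hg.of_succ
    obtain ⟨f0, f', f1, f2⟩ := hf
    obtain ⟨g0, g', g1, g2⟩ := hg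
    exact ⟨𝒜.mul_mem f0 g0, _, fun a ha x hx => (f1 a ha x hx).mul (g1 a ha x hx),
      (ih f2 hg').add (ih hf' g2)⟩

/-- A family of constant functions. -/
theorem of_param {φ : Λ → ℝ} (hφ : (fun a _ => φ a) ∈ 𝒜.carrier) :
    ∀ k, Tower 𝒜 k (fun a _ => φ a)
  | 0 => hφ
  | k + 1 => ⟨hφ, fun _ _ => 0, fun _ _ _ _ => hasDerivAt_const _ _, of_param (𝒜.const_mem 0) k⟩

theorem const (r : ℝ) (k : ℕ) : Tower 𝒜 k (fun _ _ => r) := of_param (𝒜.const_mem r) k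

theorem var (h : (fun _ x => x) ∈ 𝒜.carrier) : ∀ k, Tower 𝒜 k (fun _ x => x)
  | 0 => h
  | k + 1 => ⟨h, fun _ _ => 1, fun _ _ _ _ => hasDerivAt_id _, const 1 k⟩

theorem neg (hf : Tower 𝒜 k f) : Tower 𝒜 k (fun a x => -f a x) :=
  ((const (-1) k).mul hf).congr fun _ _ _ _ => by ring

theorem sub (hf : Tower 𝒜 k f) (hg : Tower 𝒜 k g) : Tower 𝒜 k (fun a x => f a x - g a x) :=
  (hf.add hg.neg).congr fun _ _ _ _ => by ring

theorem const_mul (r : ℝ) (hf : Tower 𝒜 k f) : Tower 𝒜 k (fun a x => r * f a x) :=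
  (const r k).mul hf

theorem sq (hf : Tower 𝒜 k f) : Tower 𝒜 k (fun a x => f a x ^ 2) :=
  (hf.mul hf).congr fun _ _ _ _ => by ring

/-- Since (1/f)' = -f' (1/f)², only the undifferentiated reciprocal has to be known to lie in the
class; the derivatives then follow by induction. -/
theorem inv (hf : Tower 𝒜 k f) (h0 : ∀ a ∈ S, ∀ x ∈ Ioo (-1 : ℝ) 1, f a x ≠ 0)
    (hi : (fun a x => (f a x)⁻¹) ∈ 𝒜.carrier) : Tower 𝒜 k (fun a x => (f a x)⁻¹) := by
  induction k generalizing f with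
  | zero => exact hi
  | succ k ih =>
    have hf' := ih hf.of_succ h0 hi
    obtain ⟨f0, f', f1, f2⟩ := hf
    refine ⟨hi, _, fun a ha x hx => (f1 a ha x hx).inv (h0 a ha x hx), ?_⟩
    exact ((f2.mul (hf'.mul hf')).neg).congr fun a ha x hx => by
      have := h0 a ha x hx
      field_simp

/-- Bootstrapping: a family whose derivative is as regular as the family itself. -/
theorem bootstrap (hf : f ∈ 𝒜.carrier)
    (hd : ∀ a ∈ S, ∀ x ∈ Ioo (-1 : ℝ) 1, HasDerivAt (f a) (f' a x) x)
    (step : ∀ k, Tower 𝒜 k f → Tower 𝒜 k f') : ∀ k, Tower 𝒜 k f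
  | 0 => hf
  | k + 1 => ⟨hf, f', hd, step k (bootstrap hf hd step k)⟩

/-- The square root of a positive family. -/
theorem sqrt (hf : ∀ k, Tower 𝒜 k f) (h0 : ∀ a ∈ S, ∀ x ∈ Ioo (-1 : ℝ) 1, 0 < f a x)
    (hs : (fun a x => Real.sqrt (f a x)) ∈ 𝒜.carrier)
    (hi : (fun a x => (Real.sqrt (f a x))⁻¹) ∈ 𝒜.carrier) (k : ℕ) :
    Tower 𝒜 k (fun a x => Real.sqrt (f a x)) := by
  have hd : ∀ a ∈ S, ∀ x ∈ Ioo (-1 : ℝ) 1, HasDerivAt (fun x => Real.sqrt (f a x))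
      (1 / 2 * (deriv (f a) x * (Real.sqrt (f a x))⁻¹)) x := fun a ha x hx => by
    convert ((hf 1).hasDerivAt_deriv ha hx).sqrt (h0 a ha x hx).ne' using 1
    field_simp
  refine bootstrap (f := fun a x => Real.sqrt (f a x)) hs hd (fun k hk => ?_) k
  exact ((hf (k + 1)).tower_deriv.mul
    (hk.inv (fun a ha x hx => (Real.sqrt_pos.2 (h0 a ha x hx)).ne') hi)).const_mul _

/-- Transport of towers along a map of parameters and `x ↦ σ x`, `σ = ± 1`. -/
theorem pullback {Λ' : Type*} {S' : Set Λ'} {ℬ : FamilyClass S'} {φ : Λ' → Λ} {σ : ℝ}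
    (hσ : σ = 1 ∨ σ = -1) (hφ : ∀ a ∈ S', φ a ∈ S)
    (hmem : ∀ f ∈ 𝒜.carrier, (fun a x => f (φ a) (σ * x)) ∈ ℬ.carrier)
    (hf : Tower 𝒜 k f) : Tower ℬ k (fun a x => f (φ a) (σ * x)) := by
  induction k generalizing f with
  | zero => exact hmem f hf
  | succ k ih =>
    obtain ⟨f0, f', f1, f2⟩ := hf
    refine ⟨hmem f f0, fun a x => σ * f' (φ a) (σ * x), fun a ha x hx => ?_, (ih f2).const_mul σ⟩
    have hx' : σ * x ∈ Ioo (-1 : ℝ) 1 := by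
      rcases hσ with rfl | rfl
      · simpa using hx
      · exact ⟨by linarith [hx.2], by linarith [hx.1]⟩
    have := (f1 (φ a) (hφ a ha) (σ * x) hx').comp x ((hasDerivAt_id x).const_mul σ)
    simpa [Function.comp_def, mul_comm] using this

/-- One level is lost because membership in the class need not imply continuity (it may only mean
boundedness); continuity of the last derivative comes from the existence of the next one. -/
theorem contDiffOn (hf : Tower 𝒜 (k + 1) f) {a : Λ} (ha : a ∈ S) :
    ContDiffOn ℝ k (f a) (Ioo (-1) 1) := by
  induction k generalizing f with
  | zero =>
    obtain ⟨f0, f', f1, f2⟩ := hf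
    exact contDiffOn_zero.2 fun x hx => (f1 a ha x hx).continuousAt.continuousWithinAt
  | succ k ih =>
    obtain ⟨f0, f', f1, f2⟩ := hf
    have := ih f2
    rw [show ((k + 1 : ℕ) : WithTop ℕ∞) = (k : WithTop ℕ∞) + 1 by norm_cast]
    rw [contDiffOn_succ_iff_deriv_of_isOpen isOpen_Ioo]
    refine ⟨fun x hx => (f1 a ha x hx).differentiableAt.differentiableWithinAt, by simp, ?_⟩
    exact this.congr fun x hx => (f1 a ha x hx).deriv

theorem contDiffOn_infty (hf : ∀ k, Tower 𝒜 k f) {a : Λ} (ha : a ∈ S) :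
    ContDiffOn ℝ ∞ (f a) (Ioo (-1) 1) :=
  _root_.contDiffOn_infty.2 fun k => (hf (k + 1)).contDiffOn ha

/-- The iterated derivatives of a tower are in the class. -/
theorem iteratedDerivWithin_mem (hf : Tower 𝒜 k f) {j : ℕ} (hj : j ≤ k) :
    (fun a x => iteratedDerivWithin j (f a) (Ioo (-1) 1) x) ∈ 𝒜.carrier := by
  induction k generalizing f j with
  | zero =>
    obtain rfl : j = 0 := by omega
    simpa using hf.mem
  | succ k ih =>
    cases j with
    | zero => simpa using hf.1
    | succ j =>
      obtain ⟨f0, f', f1, f2⟩ := hf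
      refine 𝒜.congr_mem (ih f2 (Nat.le_of_succ_le_succ hj)) fun a ha x hx => ?_
      rw [iteratedDerivWithin_succ']
      refine iteratedDerivWithin_congr (fun y hy => ?_) hx
      rw [derivWithin_of_isOpen isOpen_Ioo hy, (f1 a ha y hy).deriv]

end Tower

/-- Families that are jointly continuous on `S × (-1, 1)`. -/
def contClass {Λ : Type*} [TopologicalSpace Λ] (S : Set Λ) : FamilyClass S where
  carrier := {f | ContinuousOn (fun p : Λ × ℝ => f p.1 p.2) (S ×ˢ Ioo (-1) 1)}
  const_mem _ := continuousOn_const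
  add_mem hf hg := ContinuousOn.add hf hg
  mul_mem hf hg := ContinuousOn.mul hf hg
  congr_mem hf h := ContinuousOn.congr hf fun p hp => (h p.1 hp.1 p.2 hp.2).symm

/-- Families that are bounded on each region `R δ ⊆ S × (-1, 1)`, `δ > 0`. -/
def bddClass {Λ : Type*} (S : Set Λ) (R : ℝ → Set (Λ × ℝ))
    (hR : ∀ δ, 0 < δ → R δ ⊆ S ×ˢ Ioo (-1) 1) : FamilyClass S where
  carrier := {f | ∀ δ, 0 < δ → ∃ C, ∀ p ∈ R δ, |f p.1 p.2| ≤ C}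
  const_mem r _ _ := ⟨|r|, fun _ _ => le_rfl⟩
  add_mem hf hg δ hδ := by
    obtain ⟨C, hC⟩ := hf δ hδ
    obtain ⟨D, hD⟩ := hg δ hδ
    exact ⟨C + D, fun p hp => (abs_add_le _ _).trans (add_le_add (hC p hp) (hD p hp))⟩
  mul_mem hf hg δ hδ := by
    obtain ⟨C, hC⟩ := hf δ hδ
    obtain ⟨D, hD⟩ := hg δ hδ
    refine ⟨C * D, fun p hp => ?_⟩
    rw [abs_mul]
    exact mul_le_mul (hC p hp) (hD p hp) (abs_nonneg _) ((abs_nonneg _).trans (hC p hp))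
  congr_mem hf h δ hδ := by
    obtain ⟨C, hC⟩ := hf δ hδ
    refine ⟨C, fun p hp => ?_⟩
    rw [← h p.1 (hR δ hδ hp).1 p.2 (hR δ hδ hp).2]
    exact hC p hp

/-! ### Calculus of partial derivatives on ℝ³ -/

/-- The linear form on `ℝ³` with coefficients `v`. -/
def ofPartials (v : Fin 3 → ℝ) : E3 →L[ℝ] ℝ := ∑ j, v j • (EuclideanSpace.proj j : E3 →L[ℝ] ℝ)

theorem ofPartials_apply (v : Fin 3 → ℝ) (y : E3) : ofPartials v y = ∑ j, v j * y j := by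
  simp [ofPartials]

/-- `f` is differentiable at `X` with partial derivatives `v`. -/
def HasPartials (f : E3 → ℝ) (v : Fin 3 → ℝ) (X : E3) : Prop := HasFDerivAt f (ofPartials v) X

namespace HasPartials

variable {f g : E3 → ℝ} {v w : Fin 3 → ℝ} {X : E3}

theorem congr_partials (h : HasPartials f v X) (hvw : v = w) : HasPartials f w X := hvw ▸ h

theorem const (r : ℝ) : HasPartials (fun _ => r) (fun _ => 0) X := by
  have : ofPartials (fun _ => 0) = 0 := by simp [ofPartials]
  rw [HasPartials, this]
  exact hasFDerivAt_const r X

theorem coord (i : Fin 3) : HasPartials (fun X => X i) (fun j => if i = j then 1 else 0) X := by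
  have : ofPartials (fun j => if i = j then 1 else 0) = EuclideanSpace.proj i := by
    simp [ofPartials]
  rw [HasPartials, this]
  exact (EuclideanSpace.proj i : E3 →L[ℝ] ℝ).hasFDerivAt

theorem add (hf : HasPartials f v X) (hg : HasPartials g w X) :
    HasPartials (fun X => f X + g X) (fun j => v j + w j) X := by
  have : ofPartials (fun j => v j + w j) = ofPartials v + ofPartials w := by
    simp [ofPartials, add_smul, Finset.sum_add_distrib]
  rw [HasPartials, this]
  exact HasFDerivAt.add hf hg

theorem mul (hf : HasPartials f v X) (hg : HasPartials g w X) :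
    HasPartials (fun X => f X * g X) (fun j => v j * g X + f X * w j) X := by
  have : ofPartials (fun j => v j * g X + f X * w j) =
      f X • ofPartials w + g X • ofPartials v := by
    ext y
    simp [ofPartials_apply, Finset.mul_sum, ← Finset.sum_add_distrib]
    exact Finset.sum_congr rfl fun j _ => by ring
  rw [HasPartials, this]
  exact HasFDerivAt.mul hf hg

theorem comp {h : ℝ → ℝ} {h' : ℝ} (hh : HasDerivAt h h' (f X)) (hf : HasPartials f v X) :
    HasPartials (fun X => h (f X)) (fun j => h' * v j) X := by
  have : ofPartials (fun j => h' * v j) = h' • ofPartials v := by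
    simp [ofPartials, Finset.smul_sum, mul_smul]
  rw [HasPartials, this]
  exact hh.comp_hasFDerivAt X hf

theorem congr_of_eventuallyEq (hf : HasPartials f v X) (h : g =ᶠ[𝓝 X] f) : HasPartials g v X :=
  HasFDerivAt.congr_of_eventuallyEq hf h

theorem fderiv_single (hf : HasPartials f v X) (j : Fin 3) :
    fderiv ℝ f X (EuclideanSpace.single j 1) = v j := by
  rw [HasFDerivAt.fderiv hf, ofPartials_apply]
  simp

/-- The inverse norm is s ↦ s^(-1/2) composed with the smooth function ‖X‖². -/
theorem inv_norm (hX : X ≠ 0) :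
    HasPartials (fun X => ‖X‖⁻¹) (fun j => -(‖X‖⁻¹ ^ 3 * X j)) X := by
  have h1 : HasFDerivAt (fun X : E3 => ‖X‖ ^ 2) (2 • innerSL ℝ X) X :=
    (hasStrictFDerivAt_norm_sq X).hasFDerivAt
  have hpos : 0 < ‖X‖ := norm_pos_iff.2 hX
  have h2 : HasDerivAt (fun s : ℝ => (Real.sqrt s)⁻¹) (-(1 / (2 * ‖X‖)) / ‖X‖ ^ 2) (‖X‖ ^ 2) := by
    have := (Real.hasDerivAt_sqrt (pow_pos hpos 2).ne').inv (Real.sqrt_pos.2 (pow_pos hpos 2)).ne'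
    rwa [Real.sqrt_sq hpos.le] at this
  have h3 := h2.comp_hasFDerivAt X h1
  have h4 : ((fun s : ℝ => (Real.sqrt s)⁻¹) ∘ fun X : E3 => ‖X‖ ^ 2) = fun X => ‖X‖⁻¹ := by
    ext Y
    simp [Real.sqrt_sq (norm_nonneg Y)]
  rw [h4] at h3
  refine HasFDerivAt.congr_fderiv h3 ?_
  ext y
  simp only [ofPartials_apply, smul_apply, innerSL_apply_apply,
    PiLp.inner_apply, smul_eq_mul, nsmul_eq_mul, Fin.sum_univ_three]
  simp
  field_simp
  ring

end HasPartials

/-! ### Homogeneous axisymmetric fields and their derivatives -/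

/-- The third coordinate of the projection to the sphere, i.e. the cosine of the polar angle. -/
def height (X : E3) : ℝ := X 2 * ‖X‖⁻¹

theorem norm_sq_eq (X : E3) : ‖X‖ ^ 2 = X 0 ^ 2 + X 1 ^ 2 + X 2 ^ 2 := by
  rw [EuclideanSpace.norm_sq_eq]
  simp [Fin.sum_univ_three]

theorem ne_zero_of_mem_offAxis {X : E3} (hX : X ∈ offAxis) : X ≠ 0 := by
  rintro rfl
  simp [offAxis] at hX

theorem height_mem {X : E3} (hX : X ∈ offAxis) : height X ∈ Ioo (-1 : ℝ) 1 := by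
  have h0 : 0 < ‖X‖ := norm_pos_iff.2 (ne_zero_of_mem_offAxis hX)
  have h1 : 0 < X 0 ^ 2 + X 1 ^ 2 := by
    rcases hX with h | h
    · positivity
    · positivity
  have h2 := norm_sq_eq X
  rw [mem_Ioo, ← abs_lt, ← sq_lt_one_iff_abs_lt_one, height, mul_pow, inv_pow, ← div_eq_mul_inv,
    div_lt_one (by positivity)]
  linarith

theorem isOpen_offAxis : IsOpen offAxis := by
  have h : ∀ i : Fin 3, IsOpen {x : E3 | x i ≠ 0} := fun i =>
    isOpen_ne_fun (EuclideanSpace.proj i : E3 →L[ℝ] ℝ).continuous continuous_const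
  exact (h 0).union (h 1)

theorem HasPartials.height {X : E3} (hX : X ≠ 0) :
    HasPartials height
      (fun j => (if 2 = j then 1 else 0) * ‖X‖⁻¹ + X 2 * -(‖X‖⁻¹ ^ 3 * X j)) X :=
  (HasPartials.coord 2).mul (HasPartials.inv_norm hX)

/-- The `(-1)`-homogeneous field with components `a` along `e_r` and `b` along `e₃`. -/
def velocityField (a b : ℝ → ℝ) (X : E3) : E3 :=
  (a (height X) * ‖X‖⁻¹ ^ 2) • X + (b (height X) * ‖X‖⁻¹) • EuclideanSpace.single 2 1

/-- The `(-2)`-homogeneous function with profile `q`. -/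
def pressureField (q : ℝ → ℝ) (X : E3) : ℝ := q (height X) * ‖X‖⁻¹ ^ 2

theorem velocityField_apply (a b : ℝ → ℝ) (X : E3) (i : Fin 3) :
    velocityField a b X i = a (height X) * (‖X‖⁻¹ * (‖X‖⁻¹ * X i)) +
      b (height X) * (‖X‖⁻¹ * if 2 = i then 1 else 0) := by
  simp only [velocityField, PiLp.add_apply, PiLp.smul_apply, smul_eq_mul,
    PiLp.single_apply]
  simp only [@eq_comm _ i]
  ring

/-- The partial derivatives of the components of `velocityField a b`, where `a₁`, `b₁` are the
derivatives of `a`, `b`. -/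
def velocityPartial (a b a₁ b₁ : ℝ → ℝ) (i j : Fin 3) (X : E3) : ℝ :=
  a₁ (height X) * ((if 2 = j then 1 else 0) * ‖X‖⁻¹ + X 2 * -(‖X‖⁻¹ ^ 3 * X j)) *
        (‖X‖⁻¹ * (‖X‖⁻¹ * X i)) +
      a (height X) * (-(‖X‖⁻¹ ^ 3 * X j) * (‖X‖⁻¹ * X i) +
        ‖X‖⁻¹ * (-(‖X‖⁻¹ ^ 3 * X j) * X i + ‖X‖⁻¹ * if i = j then 1 else 0)) +
    (b₁ (height X) * ((if 2 = j then 1 else 0) * ‖X‖⁻¹ + X 2 * -(‖X‖⁻¹ ^ 3 * X j)) *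
        (‖X‖⁻¹ * if 2 = i then 1 else 0) +
      b (height X) * (-(‖X‖⁻¹ ^ 3 * X j) * (if 2 = i then 1 else 0) + ‖X‖⁻¹ * 0))

/-- `velocityPartial` is the literal output of the chain and product rules, vanishing terms
included, so that it can be differentiated once more by the same rules. -/
theorem hasPartials_velocityField {a b a₁ b₁ : ℝ → ℝ} {X : E3} (hX : X ≠ 0)
    (ha : HasDerivAt a (a₁ (height X)) (height X)) (hb : HasDerivAt b (b₁ (height X)) (height X))
    (i : Fin 3) :
    HasPartials (fun X => velocityField a b X i) (fun j => velocityPartial a b a₁ b₁ i j X) X := by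
  have hr := HasPartials.inv_norm hX
  have hc := HasPartials.coord (X := X) i
  have ht := HasPartials.height hX
  have h := ((HasPartials.comp ha ht).mul (hr.mul (hr.mul hc))).add
    ((HasPartials.comp hb ht).mul (hr.mul (HasPartials.const (if 2 = i then 1 else 0))))
  refine h.congr_of_eventuallyEq (Filter.Eventually.of_forall fun Y => ?_)
  exact velocityField_apply a b Y i

/-- Only the repeated derivatives in a direction `j` are computed, since these are the ones that
enter the Laplacian. -/
theorem secondPartial_velocityField {a b a₁ b₁ a₂ b₂ : ℝ → ℝ} {X : E3} (hX : X ∈ offAxis)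
    (ha : ∀ t ∈ Ioo (-1 : ℝ) 1, HasDerivAt a (a₁ t) t)
    (hb : ∀ t ∈ Ioo (-1 : ℝ) 1, HasDerivAt b (b₁ t) t)
    (ha' : ∀ t ∈ Ioo (-1 : ℝ) 1, HasDerivAt a₁ (a₂ t) t)
    (hb' : ∀ t ∈ Ioo (-1 : ℝ) 1, HasDerivAt b₁ (b₂ t) t) (i j : Fin 3) :
    fderiv ℝ (velocityPartial a b a₁ b₁ i j) X (EuclideanSpace.single j 1) =
      (a₂ (height X) * ((if 2 = j then 1 else 0) * ‖X‖⁻¹ - X 2 * ‖X‖⁻¹ ^ 3 * X j) ^ 2 +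
        a₁ (height X) * (-2 * (if 2 = j then 1 else 0) * ‖X‖⁻¹ ^ 3 * X j +
          X 2 * (-‖X‖⁻¹ ^ 3 + 3 * ‖X‖⁻¹ ^ 5 * X j ^ 2))) * (‖X‖⁻¹ ^ 2 * X i) +
      2 * a₁ (height X) * ((if 2 = j then 1 else 0) * ‖X‖⁻¹ - X 2 * ‖X‖⁻¹ ^ 3 * X j) *
        (-2 * ‖X‖⁻¹ ^ 4 * X j * X i + ‖X‖⁻¹ ^ 2 * if i = j then 1 else 0) +
      a (height X) * ((-2 * ‖X‖⁻¹ ^ 4 + 8 * ‖X‖⁻¹ ^ 6 * X j ^ 2) * X i -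
        4 * ‖X‖⁻¹ ^ 4 * X j * if i = j then 1 else 0) +
      (b₂ (height X) * ((if 2 = j then 1 else 0) * ‖X‖⁻¹ - X 2 * ‖X‖⁻¹ ^ 3 * X j) ^ 2 * ‖X‖⁻¹ +
        b₁ (height X) * (-2 * (if 2 = j then 1 else 0) * ‖X‖⁻¹ ^ 3 * X j +
          X 2 * (-‖X‖⁻¹ ^ 3 + 3 * ‖X‖⁻¹ ^ 5 * X j ^ 2)) * ‖X‖⁻¹ -
        2 * b₁ (height X) * ((if 2 = j then 1 else 0) * ‖X‖⁻¹ - X 2 * ‖X‖⁻¹ ^ 3 * X j) *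
          (‖X‖⁻¹ ^ 3 * X j) +
        b (height X) * (-‖X‖⁻¹ ^ 3 + 3 * ‖X‖⁻¹ ^ 5 * X j ^ 2)) * (if 2 = i then 1 else 0) := by
  have hX0 := ne_zero_of_mem_offAxis hX
  have hh := height_mem hX
  have hr := HasPartials.inv_norm hX0
  have hi := HasPartials.coord (X := X) i
  have hj := HasPartials.coord (X := X) j
  have h2 := HasPartials.coord (X := X) 2
  have ht := HasPartials.height hX0
  have hc : ∀ r : ℝ, HasPartials (fun _ => r) (fun _ => 0) X := HasPartials.const
  have hn {f : E3 → ℝ} {v} (hf : HasPartials f v X) : HasPartials (fun X => -f X) (fun j => -v j) X := by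
    have := (hc (-1)).mul hf
    simpa using this
  have hr3 : HasPartials (fun X => ‖X‖⁻¹ ^ 3) (fun j => -3 * ‖X‖⁻¹ ^ 5 * X j) X := by
    refine ((hr.mul (hr.mul hr)).congr_of_eventuallyEq
      (Filter.Eventually.of_forall fun Y => ?_)).congr_partials ?_
    · change ‖Y‖⁻¹ ^ 3 = ‖Y‖⁻¹ * (‖Y‖⁻¹ * ‖Y‖⁻¹)
      ring
    · funext j
      ring
  have hs := hn (hr3.mul hj)
  have hT := ((hc (if 2 = j then 1 else 0)).mul hr).add (h2.mul hs)
  have h := ((((HasPartials.comp (ha' _ hh) ht).mul hT).mul (hr.mul (hr.mul hi))).add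
      ((HasPartials.comp (ha _ hh) ht).mul ((hs.mul (hr.mul hi)).add
        (hr.mul ((hs.mul hi).add (hr.mul (hc (if i = j then 1 else 0)))))))).add
    ((((HasPartials.comp (hb' _ hh) ht).mul hT).mul (hr.mul (hc (if 2 = i then 1 else 0)))).add
      ((HasPartials.comp (hb _ hh) ht).mul ((hs.mul (hc (if 2 = i then 1 else 0))).add
        (hr.mul (hc 0)))))
  have h' := h.fderiv_single j
  refine Eq.trans ?_ (h'.trans ?_)
  · rfl
  · simp only [if_true]
    ring

/-- The defect of the momentum equation is parallel to X: the pressure profile is chosen so that the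
part along e₃ cancels. The remaining coefficient is the twice differentiated Riccati equation `hE`.
-/
theorem momentum_algebra {a b a₁ b₁ a₂ b₂ q q₁ : ℝ → ℝ} {ν c g g₁ g₂ g₃ : ℝ} {X : E3}
   (hh : ‖X‖⁻¹ ^ 2 * (X 0 ^ 2 + X 1 ^ 2 + X 2 ^ 2) = 1)
   (ha : a (height X) = (1 - (height X)^2) * g₁ - height X * g)
   (ha1 : a₁ (height X) = (1 - (height X)^2) * g₂ - 3 * height X * g₁ - g)
   (ha2 : a₂ (height X) = (1 - (height X)^2) * g₃ - 5 * height X * g₂ - 4 * g₁)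
   (hb : b (height X) = -g) (hb1 : b₁ (height X) = -g₁) (hb2 : b₂ (height X) = -g₂)
   (hq : q (height X) = c + ν * ((1 - (height X)^2) * g₁ - 2 * height X * g) - 1/2 * (1-(height X)^2) * g^2)
   (hq1 : q₁ (height X) = ν * ((1 - (height X)^2) * g₂ - 4 * height X * g₁ - 2 * g) + height X * g^2 - (1-(height X)^2) * g * g₁)
   (hE : (12 * (height X)^2 - 4) * (ν * g₁ + 1/2 * g^2) - 8 * height X * (1-(height X)^2) * (ν*g₂+g*g₁) + (1-(height X)^2)^2 * (ν * g₃ + g₁^2 + g * g₂) = - 2 * c)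
   (ht : height X = X 2 * ‖X‖⁻¹)
   (i : Fin 3) :
   -(ν * ∑ j, ((a₂ (height X) * ((if 2 = j then 1 else 0) * ‖X‖⁻¹ - X 2 * ‖X‖⁻¹ ^ 3 * X j) ^ 2 +
        a₁ (height X) * (-2 * (if 2 = j then 1 else 0) * ‖X‖⁻¹ ^ 3 * X j +
          X 2 * (-‖X‖⁻¹ ^ 3 + 3 * ‖X‖⁻¹ ^ 5 * X j ^ 2))) * (‖X‖⁻¹ ^ 2 * X i) +
      2 * a₁ (height X) * ((if 2 = j then 1 else 0) * ‖X‖⁻¹ - X 2 * ‖X‖⁻¹ ^ 3 * X j) *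
        (-2 * ‖X‖⁻¹ ^ 4 * X j * X i + ‖X‖⁻¹ ^ 2 * if i = j then 1 else 0) +
      a (height X) * ((-2 * ‖X‖⁻¹ ^ 4 + 8 * ‖X‖⁻¹ ^ 6 * X j ^ 2) * X i -
        4 * ‖X‖⁻¹ ^ 4 * X j * if i = j then 1 else 0) +
      (b₂ (height X) * ((if 2 = j then 1 else 0) * ‖X‖⁻¹ - X 2 * ‖X‖⁻¹ ^ 3 * X j) ^ 2 * ‖X‖⁻¹ +
        b₁ (height X) * (-2 * (if 2 = j then 1 else 0) * ‖X‖⁻¹ ^ 3 * X j +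
          X 2 * (-‖X‖⁻¹ ^ 3 + 3 * ‖X‖⁻¹ ^ 5 * X j ^ 2)) * ‖X‖⁻¹ -
        2 * b₁ (height X) * ((if 2 = j then 1 else 0) * ‖X‖⁻¹ - X 2 * ‖X‖⁻¹ ^ 3 * X j) *
          (‖X‖⁻¹ ^ 3 * X j) +
        b (height X) * (-‖X‖⁻¹ ^ 3 + 3 * ‖X‖⁻¹ ^ 5 * X j ^ 2)) * (if 2 = i then 1 else 0)))
   + ∑ j, velocityPartial a b a₁ b₁ i j X * velocityField a b X j
   + (q₁ (height X) * ((if 2 = i then 1 else 0) * ‖X‖⁻¹ + X 2 * -(‖X‖⁻¹ ^ 3 * X i)) * ‖X‖⁻¹ ^ 2 + q (height X) * (2 * ‖X‖⁻¹ * -(‖X‖⁻¹ ^ 3 * X i))) = 0 := by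
  simp only [velocityField_apply, velocityPartial, Fin.sum_univ_three, ha, ha1, ha2, hb, hb1, hb2, hq, hq1]
  simp only [ht] at hE ⊢
  clear ha ha1 ha2 hb hb1 hb2 hq hq1 ht
  obtain rfl | rfl | rfl : i = 0 ∨ i = 1 ∨ i = 2 := by fin_cases i <;> simp
  all_goals
    simp only [Fin.reduceEq, if_true, if_false]
    generalize ‖X‖⁻¹ = r at *
    generalize X 0 = x at *
    generalize X 1 = y at *
    generalize X 2 = z at *
  -- The coefficient of `hE` is -X_i/‖X‖⁴ in all three components. The coefficient of `hh` collects
  -- the cofactors of the sum of squares; the third component has additional ones, from the part of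
  -- the velocity along e₃.
  · linear_combination (-(r ^ 4 * x)) * hE + (r ^ 4 * x * (-ν * (((1-(z*r)^2)*g₃-5*(z*r)*g₂-4*g₁)*(z*r)^2+7*((1-(z*r)^2)*g₂-3*(z*r)*g₁-g)*(z*r)+8*((1-(z*r)^2)*g₁-(z*r)*g)) - (((1-(z*r)^2)*g₁-(z*r)*g)*(((1-(z*r)^2)*g₂-3*(z*r)*g₁-g)*(z*r)+2*((1-(z*r)^2)*g₁-(z*r)*g))))) * hh
  · linear_combination (-(r ^ 4 * y)) * hE + (r ^ 4 * y * (-ν * (((1-(z*r)^2)*g₃-5*(z*r)*g₂-4*g₁)*(z*r)^2+7*((1-(z*r)^2)*g₂-3*(z*r)*g₁-g)*(z*r)+8*((1-(z*r)^2)*g₁-(z*r)*g)) - (((1-(z*r)^2)*g₁-(z*r)*g)*(((1-(z*r)^2)*g₂-3*(z*r)*g₁-g)*(z*r)+2*((1-(z*r)^2)*g₁-(z*r)*g))))) * hh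
  · linear_combination (-(r ^ 4 * z)) * hE + (r ^ 4 * z * (-ν * (((1-(z*r)^2)*g₃-5*(z*r)*g₂-4*g₁)*(z*r)^2+7*((1-(z*r)^2)*g₂-3*(z*r)*g₁-g)*(z*r)+8*((1-(z*r)^2)*g₁-(z*r)*g)) - (((1-(z*r)^2)*g₁-(z*r)*g)*(((1-(z*r)^2)*g₂-3*(z*r)*g₁-g)*(z*r)+2*((1-(z*r)^2)*g₁-(z*r)*g)))) + r ^ 3 * (-ν * ((-g₂)*(z*r)^2+5*(-g₁)*(z*r)+3*(-g)) - (((1-(z*r)^2)*g₁-(z*r)*g)*((-g₁)*(z*r)+(-g))))) * hh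

theorem divergence_algebra {a b a₁ b₁ : ℝ → ℝ} {g g₁ : ℝ} {X : E3}
    (hh : ‖X‖⁻¹ ^ 2 * (X 0 ^ 2 + X 1 ^ 2 + X 2 ^ 2) = 1)
    (ha : a (height X) = (1 - height X ^ 2) * g₁ - height X * g)
    (hb : b (height X) = -g) (hb1 : b₁ (height X) = -g₁) :
    ∑ i, velocityPartial a b a₁ b₁ i i X = 0 := by
  simp only [velocityPartial, Fin.sum_univ_three, ha, hb, hb1, Fin.reduceEq, if_true, if_false]
  have ht : height X = X 2 * ‖X‖⁻¹ := rfl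
  -- The derivative of the radial profile plays no role: it is multiplied by X · ∇height, which
  -- vanishes by homogeneity.
  generalize a₁ (height X) = α
  simp only [ht]
  generalize ‖X‖⁻¹ = r at *
  linear_combination (r ^ 2 * (-(α * (X 2 * r)) -
    2 * ((1 - (X 2 * r) ^ 2) * g₁ - (X 2 * r) * g))) * hh

theorem contDiffOn_height : ContDiffOn ℝ ∞ height offAxis := by
  intro X hX
  have h0 := ne_zero_of_mem_offAxis hX
  refine ContDiffAt.contDiffWithinAt ?_
  exact ((EuclideanSpace.proj 2 : E3 →L[ℝ] ℝ).contDiff.contDiffAt).mul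
    ((contDiffAt_norm ℝ h0).inv (norm_ne_zero_iff.2 h0))

theorem contDiffOn_inv_norm : ContDiffOn ℝ ∞ (fun X : E3 => ‖X‖⁻¹) offAxis := by
  intro X hX
  have h0 := ne_zero_of_mem_offAxis hX
  exact ((contDiffAt_norm ℝ h0).inv (norm_ne_zero_iff.2 h0)).contDiffWithinAt

theorem contDiffOn_velocityField {a b : ℝ → ℝ} (ha : ContDiffOn ℝ ∞ a (Ioo (-1) 1))
    (hb : ContDiffOn ℝ ∞ b (Ioo (-1) 1)) : ContDiffOn ℝ ∞ (velocityField a b) offAxis := by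
  have hm : MapsTo height offAxis (Ioo (-1) 1) := fun X hX => height_mem hX
  exact (((ha.comp contDiffOn_height hm).mul (contDiffOn_inv_norm.pow 2)).smul contDiffOn_id).add
    (((hb.comp contDiffOn_height hm).mul contDiffOn_inv_norm).smul contDiffOn_const)

theorem contDiffOn_pressureField {q : ℝ → ℝ} (hq : ContDiffOn ℝ ∞ q (Ioo (-1) 1)) :
    ContDiffOn ℝ ∞ (pressureField q) offAxis :=
  (hq.comp contDiffOn_height fun _ hX => height_mem hX).mul (contDiffOn_inv_norm.pow 2)

theorem smul_mem_offAxis {X : E3} (hX : X ∈ offAxis) {t : ℝ} (ht : t ≠ 0) : t • X ∈ offAxis := by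
  rcases hX with h | h
  · exact Or.inl (by simpa using ⟨ht, h⟩)
  · exact Or.inr (by simpa using ⟨ht, h⟩)

theorem height_smul (X : E3) {t : ℝ} (ht : 0 < t) : height (t • X) = height X := by
  simp only [height, norm_smul, PiLp.smul_apply, smul_eq_mul, Real.norm_eq_abs, abs_of_pos ht,
    mul_inv]
  field_simp

theorem velocityField_smul (a b : ℝ → ℝ) (X : E3) {t : ℝ} (ht : 0 < t) :
    velocityField a b (t • X) = t⁻¹ • velocityField a b X := by
  simp only [velocityField, height_smul X ht, norm_smul, Real.norm_eq_abs, abs_of_pos ht, mul_inv,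
    smul_add, smul_smul]
  congr 2
  · field_simp
  · ring

theorem pressureField_smul (q : ℝ → ℝ) (X : E3) {t : ℝ} (ht : 0 < t) :
    pressureField q (t • X) = (t ^ 2)⁻¹ * pressureField q X := by
  simp only [pressureField, height_smul X ht, norm_smul, Real.norm_eq_abs, abs_of_pos ht, mul_inv]
  field_simp

theorem norm_eR (θ φ : ℝ) : ‖eR θ φ‖ = 1 := by
  have h : ‖eR θ φ‖ ^ 2 = 1 := by
    rw [norm_sq_eq]
    simp only [eR, PiLp.toLp_apply, Matrix.cons_val_zero, Matrix.cons_val_one, Matrix.cons_val]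
    linear_combination (Real.sin θ ^ 2) * (Real.sin_sq_add_cos_sq φ) + Real.sin_sq_add_cos_sq θ
  exact (pow_eq_one_iff_of_nonneg (norm_nonneg _) two_ne_zero).1 h

theorem norm_sphPoint {r : ℝ} (hr : 0 < r) (θ φ : ℝ) : ‖sphPoint r θ φ‖ = r := by
  rw [sphPoint, norm_smul, norm_eR, mul_one, Real.norm_eq_abs, abs_of_pos hr]

theorem height_sphPoint {r : ℝ} (hr : 0 < r) (θ φ : ℝ) : height (sphPoint r θ φ) = Real.cos θ := by
  rw [height, norm_sphPoint hr]
  simp only [sphPoint, eR, PiLp.smul_apply, Matrix.cons_val, smul_eq_mul]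
  field_simp

theorem single_two_eq (θ φ : ℝ) :
    (EuclideanSpace.single 2 1 : E3) = Real.cos θ • eR θ φ - Real.sin θ • eTheta θ φ := by
  ext i
  fin_cases i
  · simp [eR, eTheta]
    ring
  · simp [eR, eTheta]
    ring
  · simp [eR, eTheta]
    linear_combination -Real.sin_sq_add_cos_sq θ

/-- Since e₃ = cos θ e_r - sin θ e_θ, no component along e_φ appears, and the profile b = -g yields
u_θ = g sin θ / r. -/
theorem velocityField_sphPoint (a b : ℝ → ℝ) {r : ℝ} (hr : 0 < r) (θ φ : ℝ) :
    velocityField a b (sphPoint r θ φ) =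
      ((a (Real.cos θ) + b (Real.cos θ) * Real.cos θ) / r) • eR θ φ +
        (-(b (Real.cos θ) * Real.sin θ) / r) • eTheta θ φ := by
  rw [velocityField, height_sphPoint hr, norm_sphPoint hr, single_two_eq θ φ, sphPoint]
  simp only [smul_sub, smul_smul]
  rw [show a (Real.cos θ) * r⁻¹ ^ 2 * r = a (Real.cos θ) * r⁻¹ by field_simp,
    show (a (Real.cos θ) + b (Real.cos θ) * Real.cos θ) / r =
      a (Real.cos θ) * r⁻¹ + b (Real.cos θ) * r⁻¹ * Real.cos θ by ring,
    show -(b (Real.cos θ) * Real.sin θ) / r = -(b (Real.cos θ) * r⁻¹ * Real.sin θ) by ring,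
    add_smul, neg_smul]
  abel

/-! ### From the Riccati equation to the flow -/

/-- The profile along `e_r` of the velocity with `u_θ = g sin θ / r`. -/
def radialProfile (g : ℝ → ℝ) (t : ℝ) : ℝ := (1 - t ^ 2) * deriv g t - t * g t

/-- The profile of the pressure with `u_θ = g sin θ / r`. -/
def pressureProfile (ν c₃ : ℝ) (g : ℝ → ℝ) (t : ℝ) : ℝ :=
  c₃ + ν * ((1 - t ^ 2) * deriv g t - 2 * t * g t) - 1 / 2 * (1 - t ^ 2) * g t ^ 2

/-- The Riccati equation satisfied by `u_θ r / sin θ`, as a function of `cos θ`. -/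
def Riccati (ν : ℝ) (c : Fin 3 → ℝ) (g : ℝ → ℝ) : Prop :=
  ∀ t ∈ Ioo (-1 : ℝ) 1, ν * deriv g t + 1 / 2 * g t ^ 2 = polyP c t / (1 - t ^ 2) ^ 2

theorem one_sub_sq_pos {t : ℝ} (ht : t ∈ Ioo (-1 : ℝ) 1) : 0 < 1 - t ^ 2 := by
  nlinarith [ht.1, ht.2]

theorem hasDerivAt_polyP (c : Fin 3 → ℝ) (t : ℝ) :
    HasDerivAt (polyP c) (c 1 - c 0 - 2 * c 2 * t) t := by
  have h := (((hasDerivAt_id t).const_sub 1).const_mul (c 0)).add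
    (((hasDerivAt_id t).const_add 1).const_mul (c 1)) |>.add
    ((((hasDerivAt_id t).pow 2).const_sub 1).const_mul (c 2))
  refine (h.congr_deriv ?_).congr_of_eventuallyEq (Filter.Eventually.of_forall fun s => ?_)
  · simp
    ring
  · simp [polyP]

theorem deriv_polyP (c : Fin 3 → ℝ) : deriv (polyP c) = fun t => c 1 - c 0 - 2 * c 2 * t :=
  funext fun t => (hasDerivAt_polyP c t).deriv

theorem deriv_deriv_polyP (c : Fin 3 → ℝ) (t : ℝ) : deriv (deriv (polyP c)) t = -2 * c 2 := by
  rw [deriv_polyP]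
  exact ((((hasDerivAt_id t).const_mul (2 * c 2)).const_sub (c 1 - c 0)).congr_deriv (by simp)).deriv

theorem hasDerivAt_unique_of_eqOn {f h : ℝ → ℝ} {f' h' t : ℝ} (ht : t ∈ Ioo (-1 : ℝ) 1)
    (hfh : ∀ s ∈ Ioo (-1 : ℝ) 1, f s = h s) (hf : HasDerivAt f f' t) (hh : HasDerivAt h h' t) :
    f' = h' :=
  hf.unique (hh.congr_of_eventuallyEq (Tower.eventuallyEq_of_eqOn hfh ht))

/-- The Riccati equation, differentiated twice. -/
theorem Riccati.second_derivative {ν : ℝ} {c : Fin 3 → ℝ} {g g₁ g₂ g₃ : ℝ → ℝ}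
    (hR : ∀ t ∈ Ioo (-1 : ℝ) 1, ν * g₁ t + 1 / 2 * g t ^ 2 = polyP c t / (1 - t ^ 2) ^ 2)
    (hg : ∀ t ∈ Ioo (-1 : ℝ) 1, HasDerivAt g (g₁ t) t)
    (hg₁ : ∀ t ∈ Ioo (-1 : ℝ) 1, HasDerivAt g₁ (g₂ t) t)
    (hg₂ : ∀ t ∈ Ioo (-1 : ℝ) 1, HasDerivAt g₂ (g₃ t) t) {t : ℝ} (ht : t ∈ Ioo (-1 : ℝ) 1) :
    (12 * t ^ 2 - 4) * (ν * g₁ t + 1 / 2 * g t ^ 2)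
      - 8 * t * (1 - t ^ 2) * (ν * g₂ t + g t * g₁ t)
      + (1 - t ^ 2) ^ 2 * (ν * g₃ t + g₁ t ^ 2 + g t * g₂ t) = -2 * c 2 := by
  have hm : ∀ t : ℝ, HasDerivAt (fun t => 1 - t ^ 2) (-2 * t) t := fun t => by
    simpa using (hasDerivAt_pow 2 t).const_sub 1
  -- Clearing the denominator first makes the right-hand side the polynomial P_c, whose second
  -- derivative is the constant -2c₃.
  have e0 : ∀ t ∈ Ioo (-1 : ℝ) 1,
      (1 - t ^ 2) ^ 2 * (ν * g₁ t + 1 / 2 * g t ^ 2) = polyP c t := fun t ht => by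
    rw [hR t ht, mul_div_cancel₀ _ (pow_pos (one_sub_sq_pos ht) 2).ne']
  have dS : ∀ t ∈ Ioo (-1 : ℝ) 1, HasDerivAt (fun t => ν * g₁ t + 1 / 2 * g t ^ 2)
      (ν * g₂ t + g t * g₁ t) t := fun t ht => by
    refine (((hg₁ t ht).const_mul ν).add (((hg t ht).pow 2).const_mul (1 / 2))).congr_deriv ?_
    simp
    ring
  have e1 : ∀ t ∈ Ioo (-1 : ℝ) 1, -4 * t * (1 - t ^ 2) * (ν * g₁ t + 1 / 2 * g t ^ 2)
      + (1 - t ^ 2) ^ 2 * (ν * g₂ t + g t * g₁ t) = c 1 - c 0 - 2 * c 2 * t := fun t ht => by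
    refine hasDerivAt_unique_of_eqOn ht e0 ((((hm t).pow 2).mul (dS t ht)).congr_deriv ?_)
      (hasDerivAt_polyP c t)
    simp only [Nat.cast_ofNat, Nat.reduceSub, pow_one, Pi.pow_apply]
    ring
  have dS1 : HasDerivAt (fun t => ν * g₂ t + g t * g₁ t)
      (ν * g₃ t + (g₁ t * g₁ t + g t * g₂ t)) t :=
    ((hg₂ t ht).const_mul ν).add ((hg t ht).mul (hg₁ t ht))
  refine hasDerivAt_unique_of_eqOn ht e1 (((((((hasDerivAt_id t).const_mul (-4)).mul (hm t)).mul
    (dS t ht)).add (((hm t).pow 2).mul dS1))).congr_deriv ?_)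
    ((((hasDerivAt_id t).const_mul (2 * c 2)).const_sub (c 1 - c 0)).congr_deriv (by simp))
  simp
  ring

theorem fderiv_apply_coord {u : E3 → E3} {X : E3} (h : DifferentiableAt ℝ u X) (v : E3)
    (i : Fin 3) : (fderiv ℝ u X v) i = fderiv ℝ (fun Y => u Y i) X v := by
  have := ((EuclideanSpace.proj i : E3 →L[ℝ] ℝ).hasFDerivAt.comp X h.hasFDerivAt).fderiv
  change _ = fderiv ℝ ((EuclideanSpace.proj i : E3 →L[ℝ] ℝ) ∘ u) X v
  rw [this]
  rfl

/-- Explicit formulas `D` for the first partials near `X` suffice: the second derivative along a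
basis vector depends only on their germ at `X`. -/
theorem laplacian_eq_sum {f : E3 → ℝ} {D : Fin 3 → E3 → ℝ} {X : E3} (hf : ContDiffAt ℝ 2 f X)
    (hD : ∀ᶠ Y in 𝓝 X, ∀ j, fderiv ℝ f Y (EuclideanSpace.single j 1) = D j Y) :
    Laplacian.laplacian f X = ∑ j, fderiv ℝ (D j) X (EuclideanSpace.single j 1) := by
  rw [InnerProductSpace.laplacian_eq_iteratedFDeriv_orthonormalBasis f
    (EuclideanSpace.basisFun (Fin 3) ℝ)]
  refine Finset.sum_congr rfl fun j _ => ?_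
  rw [iteratedFDeriv_two_apply]
  simp only [EuclideanSpace.basisFun_apply, Matrix.cons_val_zero, Matrix.cons_val_one]
  have h1 : DifferentiableAt ℝ (fderiv ℝ f) X :=
    (hf.fderiv_right (m := 1) (by norm_num)).differentiableAt (by norm_num)
  have h2 : (fun Y => fderiv ℝ f Y (EuclideanSpace.single j 1)) =ᶠ[𝓝 X] D j :=
    hD.mono fun Y hY => hY j
  rw [← h2.fderiv_eq, fderiv_clm_apply h1 (differentiableAt_const _)]
  simp

/-- All the equations are local and `offAxis` is open. This transfers the equations to `eulerV` and
`eulerQ`, which are given by spherical angles and are compared with profile fields only off the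
axis. -/
theorem IsHomSolution.congr {ν : ℝ} {u v : E3 → E3} {p q : E3 → ℝ} (h : IsHomSolution ν u p)
    (huv : EqOn v u offAxis) (hpq : EqOn q p offAxis) : IsHomSolution ν v q := by
  have hu : ∀ x ∈ offAxis, v =ᶠ[𝓝 x] u := fun x hx =>
    Filter.eventually_of_mem (isOpen_offAxis.mem_nhds hx) huv
  have hp : ∀ x ∈ offAxis, q =ᶠ[𝓝 x] p := fun x hx =>
    Filter.eventually_of_mem (isOpen_offAxis.mem_nhds hx) hpq
  refine ⟨h.smooth_velocity.congr huv, h.smooth_pressure.congr hpq, fun x hx t ht => ?_,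
    fun x hx t ht => ?_, ?_, fun x hx => ?_, fun x hx => ?_⟩
  · rw [huv hx, huv (smul_mem_offAxis hx ht.ne'), h.hom_velocity x hx t ht]
  · rw [hpq hx, hpq (smul_mem_offAxis hx ht.ne'), h.hom_pressure x hx t ht]
  · obtain ⟨ur, uθ, hr⟩ := h.axisymmetric_noSwirl
    refine ⟨ur, uθ, fun r θ φ h1 h2 h3 => ?_⟩
    rw [← hr r θ φ h1 h2 h3]
    refine huv ?_
    -- The point is off the axis since sin θ > 0 and cos φ, sin φ do not vanish together.
    have hs := Real.sin_pos_of_pos_of_lt_pi h2 h3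
    have : Real.cos φ ≠ 0 ∨ Real.sin φ ≠ 0 := by
      by_contra hc
      push Not at hc
      have := Real.sin_sq_add_cos_sq φ
      rw [hc.1, hc.2] at this
      norm_num at this
    rcases this with h | h
    · exact Or.inl (by simp [sphPoint, eR, h, h1.ne', hs.ne'])
    · exact Or.inr (by simp [sphPoint, eR, h, h1.ne', hs.ne'])
  · rw [InnerProductSpace.laplacian_congr_nhds (hu x hx) |>.eq_of_nhds, (hu x hx).fderiv_eq, huv hx,
      gradient, (hp x hx).fderiv_eq]
    exact h.momentum x hx
  · rw [divergence, (hu x hx).fderiv_eq]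
    exact h.incompressible x hx

/-- The solution of the (Navier--)Stokes or Euler equations given by a solution of the Riccati
equation. -/
theorem Riccati.isHomSolution {ν : ℝ} {c : Fin 3 → ℝ} {g : ℝ → ℝ} (hR : Riccati ν c g)
    (hg : ContDiffOn ℝ ∞ g (Ioo (-1) 1)) :
    IsHomSolution ν (velocityField (radialProfile g) (fun t => -g t))
      (pressureField (pressureProfile ν (c 2) g)) := by
  have hsub : ∀ {h : ℝ → ℝ}, ContDiffOn ℝ ∞ h (Ioo (-1) 1) →
      ContDiffOn ℝ ∞ (deriv h) (Ioo (-1) 1) ∧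
        ∀ t ∈ Ioo (-1 : ℝ) 1, HasDerivAt h (deriv h t) t := fun {h} hh =>
    ⟨hh.deriv_of_isOpen isOpen_Ioo (by simp), fun t ht =>
      ((hh.differentiableOn (by simp)).differentiableAt (isOpen_Ioo.mem_nhds ht)).hasDerivAt⟩
  obtain ⟨hg1, dg⟩ := hsub hg
  obtain ⟨hg2, dg1⟩ := hsub hg1
  obtain ⟨hg3, dg2⟩ := hsub hg2
  set g₁ := deriv g with hg₁
  set g₂ := deriv g₁
  set g₃ := deriv g₂
  have hid : ContDiffOn ℝ ∞ (fun t : ℝ => t) (Ioo (-1) 1) := contDiffOn_id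
  have hone : ContDiffOn ℝ ∞ (fun t : ℝ => 1 - t ^ 2) (Ioo (-1) 1) :=
    contDiffOn_const.sub (hid.pow 2)
  have ca : ContDiffOn ℝ ∞ (radialProfile g) (Ioo (-1) 1) := (hone.mul hg1).sub (hid.mul hg)
  have cb : ContDiffOn ℝ ∞ (fun t => -g t) (Ioo (-1) 1) := hg.neg
  have cq : ContDiffOn ℝ ∞ (pressureProfile ν (c 2) g) (Ioo (-1) 1) :=
    (contDiffOn_const.add (contDiffOn_const.mul ((hone.mul hg1).sub
      ((contDiffOn_const.mul hid).mul hg)))).sub ((contDiffOn_const.mul hone).mul (hg.pow 2))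
  have su := contDiffOn_velocityField ca cb
  have sp := contDiffOn_pressureField cq
  have hm : ∀ t : ℝ, HasDerivAt (fun t => 1 - t ^ 2) (-2 * t) t := fun t => by
    simpa using (hasDerivAt_pow 2 t).const_sub 1
  have da : ∀ t ∈ Ioo (-1 : ℝ) 1, HasDerivAt (radialProfile g)
      ((1 - t ^ 2) * g₂ t - 3 * t * g₁ t - g t) t := fun t ht => by
    refine (((hm t).mul (dg1 t ht)).sub ((hasDerivAt_id t).mul (dg t ht))).congr_deriv ?_
    simp
    ring
  have da1 : ∀ t ∈ Ioo (-1 : ℝ) 1, HasDerivAt (fun t => (1 - t ^ 2) * g₂ t - 3 * t * g₁ t - g t)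
      ((1 - t ^ 2) * g₃ t - 5 * t * g₂ t - 4 * g₁ t) t := fun t ht => by
    refine ((((hm t).mul (dg2 t ht)).sub (((hasDerivAt_id t).const_mul 3).mul (dg1 t ht))).sub
      (dg t ht)).congr_deriv ?_
    simp
    ring
  have db : ∀ t ∈ Ioo (-1 : ℝ) 1, HasDerivAt (fun t => -g t) (-g₁ t) t := fun t ht => (dg t ht).neg
  have db1 : ∀ t ∈ Ioo (-1 : ℝ) 1, HasDerivAt (fun t => -g₁ t) (-g₂ t) t :=
    fun t ht => (dg1 t ht).neg
  have dq : ∀ t ∈ Ioo (-1 : ℝ) 1, HasDerivAt (pressureProfile ν (c 2) g)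
      (ν * ((1 - t ^ 2) * g₂ t - 4 * t * g₁ t - 2 * g t) + t * g t ^ 2
        - (1 - t ^ 2) * g t * g₁ t) t := fun t ht => by
    refine (((((hm t).mul (dg1 t ht)).sub (((hasDerivAt_id t).const_mul 2).mul
      (dg t ht))).const_mul ν).const_add (c 2) |>.sub
      (((hm t).const_mul (1 / 2)).mul ((dg t ht).pow 2))).congr_deriv ?_
    simp
    ring
  have hunit : ∀ X ∈ offAxis, ‖X‖⁻¹ ^ 2 * (X 0 ^ 2 + X 1 ^ 2 + X 2 ^ 2) = 1 := fun X hX => by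
    have := norm_ne_zero_iff.2 (ne_zero_of_mem_offAxis hX)
    rw [← norm_sq_eq, inv_pow]
    exact inv_mul_cancel₀ (pow_ne_zero 2 this)
  have pu : ∀ X ∈ offAxis, ∀ i, HasPartials
      (fun X => velocityField (radialProfile g) (fun t => -g t) X i)
      (fun j => velocityPartial (radialProfile g) (fun t => -g t)
        (fun t => (1 - t ^ 2) * g₂ t - 3 * t * g₁ t - g t) (fun t => -g₁ t) i j X) X :=
    fun X hX i => hasPartials_velocityField (a₁ := fun t => (1 - t ^ 2) * g₂ t - 3 * t * g₁ t - g t)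
      (b₁ := fun t => -g₁ t) (ne_zero_of_mem_offAxis hX) (da _ (height_mem hX))
      (db _ (height_mem hX)) i
  refine ⟨su, sp, fun x _ t ht => velocityField_smul _ _ x ht,
    fun x _ t ht => pressureField_smul _ x ht, ?_, fun X hX => ?_, fun X hX => ?_⟩
  · exact ⟨fun r θ => (radialProfile g (Real.cos θ) + -g (Real.cos θ) * Real.cos θ) / r,
      fun r θ => -(-g (Real.cos θ) * Real.sin θ) / r,
      fun r θ φ hr _ _ => velocityField_sphPoint _ _ hr θ φ⟩
  · have hsu : ContDiffAt ℝ ∞ (velocityField (radialProfile g) (fun t => -g t)) X :=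
      su.contDiffAt (isOpen_offAxis.mem_nhds hX)
    have hdu := hsu.differentiableAt (by simp)
    have hsu2 : ContDiffAt ℝ 2 (velocityField (radialProfile g) (fun t => -g t)) X :=
      contDiffAt_infty.1 hsu 2
    ext i
    have hlap : Laplacian.laplacian (velocityField (radialProfile g) (fun t => -g t)) X i =
        Laplacian.laplacian (fun Y => velocityField (radialProfile g) (fun t => -g t) Y i) X :=
      (hsu2.laplacian_CLM_comp_left (l := (EuclideanSpace.proj i : E3 →L[ℝ] ℝ))).symm
    have hsui : ContDiffAt ℝ 2 (fun Y => velocityField (radialProfile g) (fun t => -g t) Y i) X :=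
      (EuclideanSpace.proj i : E3 →L[ℝ] ℝ).contDiff.contDiffAt.comp X hsu2
    have hlap' := laplacian_eq_sum hsui (D := fun j => velocityPartial (radialProfile g)
        (fun t => -g t) (fun t => (1 - t ^ 2) * g₂ t - 3 * t * g₁ t - g t) (fun t => -g₁ t) i j)
      (Filter.eventually_of_mem (isOpen_offAxis.mem_nhds hX)
        fun Y hY j => (pu Y hY i).fderiv_single j)
    have hp : HasPartials (pressureField (pressureProfile ν (c 2) g)) _ X :=
      ((HasPartials.comp (dq _ (height_mem hX)) (HasPartials.height (ne_zero_of_mem_offAxis hX))).mul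
        (HasPartials.comp (hasDerivAt_pow 2 ‖X‖⁻¹)
          (HasPartials.inv_norm (ne_zero_of_mem_offAxis hX))))
    have hgrad : gradient (pressureField (pressureProfile ν (c 2) g)) X i =
        fderiv ℝ (pressureField (pressureProfile ν (c 2) g)) X (EuclideanSpace.single i 1) := by
      have := InnerProductSpace.toDual_symm_apply (𝕜 := ℝ)
        (x := (EuclideanSpace.single i 1 : E3))
        (y := fderiv ℝ (pressureField (pressureProfile ν (c 2) g)) X)
      rw [← this, EuclideanSpace.inner_single_right]
      simp [gradient]
    have hconv : (fderiv ℝ (velocityField (radialProfile g) (fun t => -g t)) X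
        (velocityField (radialProfile g) (fun t => -g t) X)) i =
        ∑ j, velocityPartial (radialProfile g) (fun t => -g t)
          (fun t => (1 - t ^ 2) * g₂ t - 3 * t * g₁ t - g t) (fun t => -g₁ t) i j X *
            velocityField (radialProfile g) (fun t => -g t) X j := by
      rw [fderiv_apply_coord hdu, HasFDerivAt.fderiv (pu X hX i), ofPartials_apply]
    simp only [PiLp.add_apply, PiLp.neg_apply, PiLp.smul_apply, smul_eq_mul, PiLp.zero_apply]
    rw [hlap, hlap', hconv, hgrad, hp.fderiv_single i]
    simp only [secondPartial_velocityField hX da db da1 db1]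
    have key := momentum_algebra (X := X) (ν := ν) (c := c 2) (a := radialProfile g)
      (b := fun t => -g t) (a₁ := fun t => (1 - t ^ 2) * g₂ t - 3 * t * g₁ t - g t)
      (b₁ := fun t => -g₁ t) (a₂ := fun t => (1 - t ^ 2) * g₃ t - 5 * t * g₂ t - 4 * g₁ t)
      (b₂ := fun t => -g₂ t) (q := pressureProfile ν (c 2) g)
      (q₁ := fun t => ν * ((1 - t ^ 2) * g₂ t - 4 * t * g₁ t - 2 * g t) + t * g t ^ 2
        - (1 - t ^ 2) * g t * g₁ t) (hunit X hX)
      rfl rfl rfl rfl rfl rfl rfl rfl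
      (Riccati.second_derivative hR dg dg1 dg2 (height_mem hX)) rfl i
    refine Eq.trans ?_ key
    simp
  · have hdu : DifferentiableAt ℝ (velocityField (radialProfile g) (fun t => -g t)) X :=
      (su.contDiffAt (isOpen_offAxis.mem_nhds hX)).differentiableAt (by simp)
    rw [divergence]
    simp_rw [fderiv_apply_coord hdu]
    rw [Finset.sum_congr rfl fun i _ => (pu X hX i).fderiv_single i]
    exact divergence_algebra (hunit X hX) rfl rfl rfl

/-! ### Power series depending on parameters -/

/-- The power series with coefficients `a` converges absolutely on the unit disc. -/
def PowSummable (a : ℕ → ℝ) : Prop := ∀ r : ℝ, 0 ≤ r → r < 1 → Summable fun n => |a n| * r ^ n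

/-- The sum of a power series. -/
def powSum (a : ℕ → ℝ) (z : ℝ) : ℝ := ∑' n, a n * z ^ n

/-- The coefficients of the derived power series. -/
def derivCoeff (a : ℕ → ℝ) (n : ℕ) : ℝ := (n + 1) * a (n + 1)

theorem HasSum.congr_term {f g : ℕ → ℝ} {s : ℝ} (h : HasSum f s) (hfg : ∀ n, g n = f n) :
    HasSum g s := (funext hfg : g = f) ▸ h

namespace PowSummable

variable {a : ℕ → ℝ} {z : ℝ}

theorem hasSum (ha : PowSummable a) (hz : |z| < 1) : HasSum (fun n => a n * z ^ n) (powSum a z) := by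
  refine Summable.hasSum (Summable.of_norm ?_)
  simpa [abs_mul, abs_pow] using ha |z| (abs_nonneg z) hz

/-- The factor n + 1 is absorbed by passing to a slightly larger radius s < 1, because (n +
1)(r/s)^n is bounded. -/
theorem derivCoeff (ha : PowSummable a) : PowSummable (derivCoeff a) := by
  intro r hr0 hr1
  obtain ⟨s, hrs, hs1⟩ := exists_between hr1
  have hs0 : 0 < s := hr0.trans_lt hrs
  have hq : |r / s| < 1 := by
    rw [abs_of_nonneg (by positivity), div_lt_one hs0]
    exact hrs
  have ht := tendsto_pow_const_mul_const_pow_of_abs_lt_one 1 hq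
  have ht2 := ht.add (tendsto_pow_atTop_nhds_zero_of_abs_lt_one hq)
  obtain ⟨C, hC⟩ := ht2.bddAbove_range
  have hC' : ∀ n : ℕ, (n + 1) * (r / s) ^ n ≤ C := fun n => by
    have := hC ⟨n, rfl⟩
    simp only [pow_one] at this
    linarith
  have hsum := ((summable_nat_add_iff 1).2 (ha s hs0.le hs1)).mul_left (C / s)
  refine Summable.of_nonneg_of_le (fun n => by positivity) (fun n => ?_) hsum
  rw [_root_.derivCoeff, abs_mul, abs_of_nonneg (by positivity : (0 : ℝ) ≤ n + 1)]
  have h1 : r ^ n = (r / s) ^ n * s ^ n := by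
    rw [div_pow, div_mul_cancel₀ _ (pow_pos hs0 n).ne']
  calc (n + 1) * |a (n + 1)| * r ^ n
      = ((n + 1) * (r / s) ^ n) * (|a (n + 1)| * s ^ n) := by rw [h1]; ring
    _ ≤ C * (|a (n + 1)| * s ^ n) := by gcongr; exact hC' n
    _ = C / s * (|a (n + 1)| * s ^ (n + 1)) := by rw [pow_succ]; field_simp

theorem mono {b : ℕ → ℝ} (hb : PowSummable b) (h : ∀ n, |a n| ≤ b n) : PowSummable a :=
  fun r h0 h1 => Summable.of_nonneg_of_le (fun n => by positivity)
    (fun n => mul_le_mul_of_nonneg_right ((h n).trans (le_abs_self _)) (pow_nonneg h0 n))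
    (hb r h0 h1)

theorem hasSum_mul_deriv (ha : PowSummable a) (hz : |z| < 1) :
    HasSum (fun n : ℕ => n * a n * z ^ n) (z * powSum (_root_.derivCoeff a) z) := by
  have h := (ha.derivCoeff.hasSum hz).mul_left z
  have h2 := (hasSum_nat_add_iff (f := fun n : ℕ => n * a n * z ^ n) 1).1
    (h.congr_term fun n => by rw [_root_.derivCoeff]; push_cast; ring)
  simpa using h2

theorem hasDerivAt (ha : PowSummable a) (hz : |z| < 1) :
    HasDerivAt (powSum a) (powSum (_root_.derivCoeff a) z) z := by
  obtain ⟨r, hzr, hr1⟩ := exists_between hz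
  have hr0 : 0 ≤ r := (abs_nonneg z).trans hzr.le
  have hs := ha.derivCoeff r hr0 hr1
  have hu : Summable fun n : ℕ => (n : ℝ) * |a n| * r ^ (n - 1) := by
    rw [← summable_nat_add_iff 1]
    refine hs.congr fun n => ?_
    rw [_root_.derivCoeff, abs_mul, abs_of_nonneg (by positivity : (0 : ℝ) ≤ n + 1)]
    simp
  have h := hasDerivAt_tsum_of_isPreconnected (g := fun n z => a n * z ^ n)
    (g' := fun n z => a n * (n * z ^ (n - 1))) (t := Ioo (-r) r) (y₀ := z) (y := z) hu isOpen_Ioo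
    isPreconnected_Ioo (fun n y _ => (hasDerivAt_pow n y).const_mul _) (fun n y hy => ?_)
    (abs_lt.1 hzr) (ha.hasSum hz).summable (abs_lt.1 hzr)
  · refine h.congr_deriv ?_
    have hsum : Summable fun n : ℕ => a n * (n * z ^ (n - 1)) := by
      refine Summable.of_norm_bounded hu fun n => ?_
      rw [Real.norm_eq_abs, abs_mul, abs_mul, abs_pow, Nat.abs_cast]
      calc |a n| * (n * |z| ^ (n - 1)) ≤ |a n| * (n * r ^ (n - 1)) := by gcongr
        _ = _ := by ring
    rw [hsum.tsum_eq_zero_add, powSum]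
    simp only [CharP.cast_eq_zero, zero_mul, mul_zero, zero_add, Nat.add_sub_cancel]
    exact tsum_congr fun n => by rw [_root_.derivCoeff]; push_cast; ring
  · rw [Real.norm_eq_abs, abs_mul, abs_mul, abs_pow, Nat.abs_cast]
    have : |y| ≤ r := (abs_lt.2 hy).le
    calc |a n| * (n * |y| ^ (n - 1)) ≤ |a n| * (n * r ^ (n - 1)) := by gcongr
      _ = _ := by ring

end PowSummable

/-- The coefficients `a n p` are continuous in `p ∈ D`, with locally uniform majorants. -/
structure LocallyMajorized {P : Type*} [TopologicalSpace P] (D : Set P) (a : P → ℕ → ℝ) : Prop where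
  cont : ∀ n, ContinuousOn (fun p => a p n) D
  major : ∀ p ∈ D, ∃ V ∈ 𝓝[D] p, ∃ M : ℕ → ℝ, PowSummable M ∧ ∀ q ∈ V, ∀ n, |a q n| ≤ M n

namespace LocallyMajorized

variable {P : Type*} [TopologicalSpace P] {D : Set P} {a : P → ℕ → ℝ}

theorem powSummable (h : LocallyMajorized D a) {p : P} (hp : p ∈ D) : PowSummable (a p) := by
  obtain ⟨V, hV, M, hM, hb⟩ := h.major p hp
  exact hM.mono (hb p (mem_of_mem_nhdsWithin hp hV))

theorem derivCoeff (h : LocallyMajorized D a) : LocallyMajorized D (fun p => derivCoeff (a p)) := by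
  refine ⟨fun n => continuousOn_const.mul (h.cont (n + 1)), fun p hp => ?_⟩
  obtain ⟨V, hV, M, hM, hb⟩ := h.major p hp
  refine ⟨V, hV, _, hM.derivCoeff, fun q hq n => ?_⟩
  rw [_root_.derivCoeff, abs_mul, abs_of_nonneg (by positivity : (0 : ℝ) ≤ n + 1)]
  exact mul_le_mul_of_nonneg_left (hb q hq (n + 1)) (by positivity)

/-- By the Weierstrass test: near a given parameter and for |z| < r < 1 the series has a fixed
summable majorant, hence a jointly continuous sum. -/
theorem continuousOn (h : LocallyMajorized D a) :
    ContinuousOn (fun w : P × ℝ => powSum (a w.1) w.2) (D ×ˢ Ioo (-1) 1) := by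
  rintro ⟨p, z⟩ ⟨hp, hz⟩
  obtain ⟨V, hV, M, hM, hb⟩ := h.major p hp
  obtain ⟨r, hzr, hr1⟩ := exists_between (abs_lt.2 hz)
  have hr0 : 0 ≤ r := (abs_nonneg z).trans hzr.le
  have hc : ContinuousOn (fun w : P × ℝ => ∑' n, a w.1 n * w.2 ^ n) ((V ∩ D) ×ˢ Ioo (-r) r) := by
    refine continuousOn_tsum (fun n => ?_) (hM r hr0 hr1) (fun n w hw => ?_)
    · exact ((h.cont n).comp continuousOn_fst fun w hw => hw.1.2).mul (continuousOn_snd.pow n)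
    · rw [Real.norm_eq_abs, abs_mul, abs_pow]
      have h1 := hb w.1 hw.1.1 n
      have h2 : |w.2| ≤ r := (abs_lt.2 hw.2).le
      have h3 := h1.trans (le_abs_self _)
      gcongr
  refine (hc (p, z) ⟨⟨mem_of_mem_nhdsWithin hp hV, hp⟩, abs_lt.1 hzr⟩).mono_of_mem_nhdsWithin ?_
  rw [nhdsWithin_prod_eq]
  exact prod_mem_prod (inter_mem hV self_mem_nhdsWithin)
    (mem_nhdsWithin_of_mem_nhds (isOpen_Ioo.mem_nhds (abs_lt.1 hzr)))

end LocallyMajorized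

/-! ### The hypergeometric function -/

/-- The Taylor coefficients at `0` of the solution of the hypergeometric equation
`z (1 - z) F'' + 2 (ρ₁ - (ρ₁ + ρ₂) z) F' = κ F` with `F 0 = 1`; here `p = (ρ₁, ρ₂, κ)`. -/
def hyperCoeff (p : ℝ × ℝ × ℝ) : ℕ → ℝ
  | 0 => 1
  | n + 1 => (n * (n - 1) + 2 * (p.1 + p.2.1) * n + p.2.2) / ((n + 1) * (n + 2 * p.1)) *
      hyperCoeff p n

/-- The parameters for which `hyperCoeff` is used. -/
def hyperDomain : Set (ℝ × ℝ × ℝ) := {p | 1 / 2 ≤ p.1 ∧ 1 / 2 ≤ p.2.1 ∧ 0 ≤ p.2.2}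

/-- A majorant of the coefficients `hyperCoeff`. -/
def hyperMajorant (R : ℝ) : ℕ → ℝ
  | 0 => 1
  | n + 1 => (n ^ 2 + 4 * R * n + R) / (n + 1) ^ 2 * hyperMajorant R n

theorem hyperMajorant_pos {R : ℝ} (hR : 0 < R) : ∀ n, 0 < hyperMajorant R n
  | 0 => one_pos
  | n + 1 => mul_pos (by positivity) (hyperMajorant_pos hR n)

theorem powSummable_hyperMajorant {R : ℝ} (hR : 0 < R) : PowSummable (hyperMajorant R) := by
  intro r hr0 hr1
  rcases hr0.eq_or_lt with rfl | hr0
  · refine summable_of_ne_finset_zero (s := {0}) fun n hn => ?_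
    simp at hn
    simp [hn]
  have hpos : ∀ n, 0 < |hyperMajorant R n| * r ^ n := fun n =>
    mul_pos (abs_pos.2 (hyperMajorant_pos hR n).ne') (pow_pos hr0 n)
  refine summable_of_ratio_test_tendsto_lt_one hr1
    (Filter.Eventually.of_forall fun n => (hpos n).ne') ?_
  have h1 : Tendsto (fun n : ℕ => 1 / ((n : ℝ) + 1)) atTop (𝓝 0) :=
    tendsto_one_div_add_atTop_nhds_zero_nat
  -- The quotient of consecutive coefficients, with n² + 4Rn + R rewritten in powers of n + 1.
  have h2 : Tendsto (fun n : ℕ => (1 + (4 * R - 2) * (1 / ((n : ℝ) + 1)) +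
      (1 - 3 * R) * (1 / ((n : ℝ) + 1)) ^ 2) * r) atTop
      (𝓝 ((1 + (4 * R - 2) * 0 + (1 - 3 * R) * 0 ^ 2) * r)) :=
    (((h1.const_mul _).const_add 1).add ((h1.pow 2).const_mul _)).mul_const r
  have h3 : (1 + (4 * R - 2) * 0 + (1 - 3 * R) * 0 ^ 2) * r = r := by ring
  rw [h3] at h2
  refine h2.congr fun n => ?_
  rw [Real.norm_of_nonneg (hpos _).le, Real.norm_of_nonneg (hpos _).le,
    abs_of_pos (hyperMajorant_pos hR _), abs_of_pos (hyperMajorant_pos hR _), hyperMajorant]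
  have := (hyperMajorant_pos hR n).ne'
  have hn : (n : ℝ) + 1 ≠ 0 := by positivity
  field_simp
  ring

theorem natCast_mul_pred_nonneg (n : ℕ) : (0 : ℝ) ≤ n * (n - 1) := by
  cases n with
  | zero => simp
  | succ n => push_cast; simp; positivity

/-- This is where κ ≥ 0, that is c₃ ≥ c̄₃, is used: together with ρ₁, ρ₂ ≥ 1/2 it makes every factor
of the recursion nonnegative. -/
theorem hyperCoeff_nonneg {p : ℝ × ℝ × ℝ} (hp : p ∈ hyperDomain) : ∀ n, 0 ≤ hyperCoeff p n
  | 0 => zero_le_one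
  | n + 1 => by
    obtain ⟨h1, h2, h3⟩ := id hp
    have := natCast_mul_pred_nonneg n
    have h4 : 0 ≤ p.1 := by linarith
    have h5 : 0 ≤ p.2.1 := by linarith
    exact mul_nonneg (by positivity) (hyperCoeff_nonneg hp n)

/-- The bound ρ₁ ≥ 1/2 gives n + 2ρ₁ ≥ n + 1, so the denominators are at least those of the
majorant. -/
theorem hyperCoeff_le {p : ℝ × ℝ × ℝ} (hp : p ∈ hyperDomain) {R : ℝ} (h1 : p.1 ≤ R)
    (h2 : p.2.1 ≤ R) (h3 : p.2.2 ≤ R) : ∀ n, hyperCoeff p n ≤ hyperMajorant R n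
  | 0 => le_rfl
  | n + 1 => by
    obtain ⟨h4, h5, h6⟩ := id hp
    have hR : 0 < R := by linarith
    have hn : (0 : ℝ) ≤ n := n.cast_nonneg
    refine mul_le_mul ?_ (hyperCoeff_le hp h1 h2 h3 n) (hyperCoeff_nonneg hp n) (by positivity)
    rw [sq ((n : ℝ) + 1)]
    refine div_le_div₀ (by positivity) ?_ (by positivity) ?_
    · nlinarith
    · gcongr
      linarith

theorem locallyMajorized_hyperCoeff : LocallyMajorized hyperDomain hyperCoeff := by
  refine ⟨fun n => ?_, fun p hp => ?_⟩
  · induction n with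
    | zero => exact continuousOn_const
    | succ n ih =>
      refine ContinuousOn.mul (ContinuousOn.div (Continuous.continuousOn (by fun_prop))
        (Continuous.continuousOn (by fun_prop)) fun p hp => ?_) ih
      have := hp.1
      have hn : (0 : ℝ) ≤ n := n.cast_nonneg
      have : (0 : ℝ) < n + 2 * p.1 := by linarith
      positivity
  · set R := max p.1 (max p.2.1 p.2.2) + 1 with hR
    have hlt : p.1 < R ∧ p.2.1 < R ∧ p.2.2 < R := by
      refine ⟨?_, ?_, ?_⟩
      · have := le_max_left p.1 (max p.2.1 p.2.2); linarith
      · have := (le_max_left p.2.1 p.2.2).trans (le_max_right p.1 _); linarith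
      · have := (le_max_right p.2.1 p.2.2).trans (le_max_right p.1 _); linarith
    have hV : {q : ℝ × ℝ × ℝ | q.1 < R ∧ q.2.1 < R ∧ q.2.2 < R} ∈ 𝓝 p := by
      refine IsOpen.mem_nhds ?_ hlt
      exact (isOpen_lt continuous_fst continuous_const).inter
        ((isOpen_lt continuous_snd.fst continuous_const).inter
          (isOpen_lt continuous_snd.snd continuous_const))
    have hR0 : 0 < R := by have := hp.1; linarith [hlt.1]
    refine ⟨_, inter_mem (mem_nhdsWithin_of_mem_nhds hV) self_mem_nhdsWithin, hyperMajorant R,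
      powSummable_hyperMajorant hR0, fun q hq n => ?_⟩
    rw [abs_of_nonneg (hyperCoeff_nonneg hq.2 n)]
    exact hyperCoeff_le hq.2 hq.1.1.le hq.1.2.1.le hq.1.2.2.le n

/-- The hypergeometric function with coefficients `hyperCoeff p`. -/
def hyperF (p : ℝ × ℝ × ℝ) : ℝ → ℝ := powSum (hyperCoeff p)

/-- The derivative of `hyperF p`. -/
def hyperF₁ (p : ℝ × ℝ × ℝ) : ℝ → ℝ := powSum (derivCoeff (hyperCoeff p))

/-- The second derivative of `hyperF p`. -/
def hyperF₂ (p : ℝ × ℝ × ℝ) : ℝ → ℝ := powSum (derivCoeff (derivCoeff (hyperCoeff p)))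

theorem hasDerivAt_hyperF {p : ℝ × ℝ × ℝ} (hp : p ∈ hyperDomain) {z : ℝ} (hz : |z| < 1) :
    HasDerivAt (hyperF p) (hyperF₁ p z) z :=
  (locallyMajorized_hyperCoeff.powSummable hp).hasDerivAt hz

theorem hasDerivAt_hyperF₁ {p : ℝ × ℝ × ℝ} (hp : p ∈ hyperDomain) {z : ℝ} (hz : |z| < 1) :
    HasDerivAt (hyperF₁ p) (hyperF₂ p z) z :=
  (locallyMajorized_hyperCoeff.powSummable hp).derivCoeff.hasDerivAt hz

/-- All terms are nonnegative for z ≥ 0, and the term n = 0 equals 1. -/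
theorem hyperF_pos {p : ℝ × ℝ × ℝ} (hp : p ∈ hyperDomain) {z : ℝ} (h0 : 0 ≤ z) (h1 : z < 1) :
    0 < hyperF p z := by
  have h := (locallyMajorized_hyperCoeff.powSummable hp).hasSum
    (by rwa [abs_of_nonneg h0] : |z| < 1)
  have := h.summable.sum_le_tsum {0} fun n _ =>
    mul_nonneg (hyperCoeff_nonneg hp n) (pow_nonneg h0 n)
  have h2 : (1 : ℝ) ≤ hyperF p z := by
    rw [Finset.sum_singleton, pow_zero, mul_one] at this
    exact this
  linarith

theorem hyperF₁_nonneg {p : ℝ × ℝ × ℝ} (hp : p ∈ hyperDomain) {z : ℝ} (h0 : 0 ≤ z) :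
    0 ≤ hyperF₁ p z :=
  tsum_nonneg fun n => mul_nonneg (mul_nonneg (by positivity) (hyperCoeff_nonneg hp _))
    (pow_nonneg h0 n)

theorem continuousOn_hyperF : ContinuousOn (fun w : (ℝ × ℝ × ℝ) × ℝ => hyperF w.1 w.2)
    (hyperDomain ×ˢ Ioo (-1) 1) := locallyMajorized_hyperCoeff.continuousOn

theorem continuousOn_hyperF₁ : ContinuousOn (fun w : (ℝ × ℝ × ℝ) × ℝ => hyperF₁ w.1 w.2)
    (hyperDomain ×ˢ Ioo (-1) 1) := locallyMajorized_hyperCoeff.derivCoeff.continuousOn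

/-- The hypergeometric equation. -/
theorem hyperF_equation {p : ℝ × ℝ × ℝ} (hp : p ∈ hyperDomain) {z : ℝ} (hz : |z| < 1) :
    z * (1 - z) * hyperF₂ p z + 2 * (p.1 - (p.1 + p.2.1) * z) * hyperF₁ p z = p.2.2 * hyperF p z := by
  have ha := locallyMajorized_hyperCoeff.powSummable hp
  have s0 := ha.hasSum hz
  have s1 := ha.derivCoeff.hasSum hz
  have s1' := ha.hasSum_mul_deriv hz
  have s2 := ha.derivCoeff.hasSum_mul_deriv hz
  have s2' : HasSum (fun n : ℕ => n * (n - 1) * hyperCoeff p n * z ^ n)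
      (z * (z * hyperF₂ p z)) := by
    have h := s2.mul_left z
    have h2 := (hasSum_nat_add_iff (f := fun n : ℕ => (n : ℝ) * (n - 1) * hyperCoeff p n * z ^ n) 1).1
      (h.congr_term fun n => by rw [derivCoeff]; push_cast; ring)
    simpa [hyperF₂] using h2
  have hsum := (((s2.sub s2').add (s1.mul_left (2 * p.1))).sub
    (s1'.mul_left (2 * (p.1 + p.2.1)))).sub (s0.mul_left p.2.2)
  have hz0 : HasSum (fun _ : ℕ => (0 : ℝ)) _ := hsum.congr_term fun n => ?_
  · have := hz0.unique hasSum_zero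
    change z * hyperF₂ p z - z * (z * hyperF₂ p z) + 2 * p.1 * hyperF₁ p z
      - 2 * (p.1 + p.2.1) * (z * hyperF₁ p z) - p.2.2 * hyperF p z = 0 at this
    linarith
  · have hn : (0 : ℝ) < n + 2 * p.1 := by
      have := hp.1
      have hn : (0 : ℝ) ≤ n := n.cast_nonneg
      linarith
    -- Comparing the coefficients of z^n in the equation gives exactly the recursion that defines
    -- `hyperCoeff`.
    have hrec : (n + 1) * (n + 2 * p.1) * hyperCoeff p (n + 1) =
        (n * (n - 1) + 2 * (p.1 + p.2.1) * n + p.2.2) * hyperCoeff p n := by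
      rw [hyperCoeff]
      field_simp
    simp only [derivCoeff]
    linear_combination -z ^ n * hrec

attribute [irreducible] hyperF hyperF₁ hyperF₂

/-! ### The two extremal solutions of the Riccati equation -/

/-- The parameters `(c, ν)` with `ν > 0` and `c ∈ J_ν`. -/
def goodParams : Set ((Fin 3 → ℝ) × ℝ) := {a | 0 < a.2 ∧ a.1 ∈ paramJ a.2}

/-- The parameters `(ρ₁, ρ₂, κ)` of the hypergeometric function attached to `(c, ν)`. -/
def hyperParam (a : (Fin 3 → ℝ) × ℝ) : ℝ × ℝ × ℝ :=
  (1 / 2 * (1 + Real.sqrt (1 + a.1 0 / a.2 ^ 2)), 1 / 2 * (1 + Real.sqrt (1 + a.1 1 / a.2 ^ 2)),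
    (a.1 2 - c3bar (a.1 0) (a.1 1) a.2) / (2 * a.2 ^ 2))

theorem hyperParam_mem {a : (Fin 3 → ℝ) × ℝ} (ha : a ∈ goodParams) :
    hyperParam a ∈ hyperDomain := by
  refine ⟨?_, ?_, div_nonneg (sub_nonneg.2 ha.2.2.2) (by positivity)⟩
  · have := Real.sqrt_nonneg (1 + a.1 0 / a.2 ^ 2)
    simp only [hyperParam]
    linarith
  · have := Real.sqrt_nonneg (1 + a.1 1 / a.2 ^ 2)
    simp only [hyperParam]
    linarith

theorem sqrt_sq_add {ν c : ℝ} (hν : 0 < ν) :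
    Real.sqrt (ν ^ 2 + c) = ν * Real.sqrt (1 + c / ν ^ 2) := by
  rw [show ν ^ 2 + c = ν ^ 2 * (1 + c / ν ^ 2) by field_simp, Real.sqrt_mul (by positivity),
    Real.sqrt_sq hν.le]

/-- The indicial equation of the linearized equation at a pole; the number 1/2 (1 + √(1 + c/ν²)) is
its larger root. -/
theorem exponent_identity {ν c : ℝ} (hν : 0 < ν) (hc : -ν ^ 2 ≤ c) :
    4 * ν ^ 2 * ((1 / 2 * (1 + Real.sqrt (1 + c / ν ^ 2))) *
      (1 / 2 * (1 + Real.sqrt (1 + c / ν ^ 2)) - 1)) = c := by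
  have h : 0 ≤ 1 + c / ν ^ 2 := by
    rw [show 1 + c / ν ^ 2 = (ν ^ 2 + c) / ν ^ 2 by field_simp]
    exact div_nonneg (by linarith) (by positivity)
  have hs := Real.sq_sqrt h
  set s := Real.sqrt (1 + c / ν ^ 2)
  have : ν ^ 2 * (s ^ 2 - 1) = c := by
    rw [hs]
    field_simp
    ring
  linear_combination this

/-- This expresses c₃ through the hypergeometric parameters. It uses the explicit form of c̄₃, which
is the value of c₃ at which κ = 0. -/
theorem hyperParam_identity {a : (Fin 3 → ℝ) × ℝ} (ha : a ∈ goodParams) :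
    2 * a.2 ^ 2 * ((hyperParam a).2.2 - 2 * (hyperParam a).1 * (hyperParam a).2.1) =
      a.1 2 + 1 / 2 * (a.1 0 + a.1 1) := by
  have hν := ha.1
  have e0 := exponent_identity ha.1 ha.2.1
  have e1 := exponent_identity ha.1 ha.2.2.1
  simp only [hyperParam, c3bar, sqrt_sq_add hν]
  set s := Real.sqrt (1 + a.1 0 / a.2 ^ 2)
  set t := Real.sqrt (1 + a.1 1 / a.2 ^ 2)
  rw [mul_sub, mul_div_cancel₀ _ (by positivity : 2 * a.2 ^ 2 ≠ 0)]
  linear_combination 1 / 2 * e0 + 1 / 2 * e1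

theorem continuousOn_hyperParam : ContinuousOn hyperParam goodParams := by
  have hν : ContinuousOn (fun a : (Fin 3 → ℝ) × ℝ => a.2) goodParams := continuousOn_snd
  have hc : ∀ i, ContinuousOn (fun a : (Fin 3 → ℝ) × ℝ => a.1 i) goodParams := fun i =>
    ((continuous_apply i).comp continuous_fst).continuousOn
  have h0 : ∀ a ∈ goodParams, a.2 ^ 2 ≠ 0 := fun a ha => (pow_pos ha.1 2).ne'
  have hs : ∀ i, ContinuousOn (fun a : (Fin 3 → ℝ) × ℝ =>
      1 / 2 * (1 + Real.sqrt (1 + a.1 i / a.2 ^ 2))) goodParams := fun i =>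
    continuousOn_const.mul (continuousOn_const.add
      (continuousOn_const.add ((hc i).div (hν.pow 2) h0)).sqrt)
  have hq : ∀ i, ContinuousOn (fun a : (Fin 3 → ℝ) × ℝ =>
      Real.sqrt (a.2 ^ 2 + a.1 i)) goodParams := fun i => ((hν.pow 2).add (hc i)).sqrt
  refine (hs 0).prodMk ((hs 1).prodMk (ContinuousOn.div ((hc 2).sub ?_)
    (continuousOn_const.mul (hν.pow 2)) fun a ha => mul_ne_zero two_ne_zero (h0 a ha)))
  exact (continuousOn_const.mul ((hq 0).add (hq 1))).mul
    (((hq 0).add (hq 1)).add (continuousOn_const.mul hν))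

/-- The solution of the Riccati equation that is maximal on `(-1, 1)`. -/
def gPlus (a : (Fin 3 → ℝ) × ℝ) (x : ℝ) : ℝ :=
  2 * a.2 * ((hyperParam a).1 / (1 + x) - (hyperParam a).2.1 / (1 - x) +
    1 / 2 * (hyperF₁ (hyperParam a) ((1 + x) / 2) / hyperF (hyperParam a) ((1 + x) / 2)))

theorem abs_half_lt {x : ℝ} (hx : x ∈ Ioo (-1 : ℝ) 1) : |(1 + x) / 2| < 1 :=
  abs_lt.2 ⟨by linarith [hx.1], by linarith [hx.2]⟩

theorem hyperF_half_pos {a : (Fin 3 → ℝ) × ℝ} (ha : a ∈ goodParams) {x : ℝ}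
    (hx : x ∈ Ioo (-1 : ℝ) 1) : 0 < hyperF (hyperParam a) ((1 + x) / 2) :=
  hyperF_pos (hyperParam_mem ha) (by linarith [hx.1]) (by linarith [hx.2])

/-- The right-hand side of the Riccati equation solved for the derivative. -/
def riccatiRhs (g : (Fin 3 → ℝ) × ℝ → ℝ → ℝ) (a : (Fin 3 → ℝ) × ℝ) (x : ℝ) : ℝ :=
  a.2⁻¹ * (polyP a.1 x * ((1 - x ^ 2)⁻¹) ^ 2 - 1 / 2 * g a x ^ 2)

theorem hasDerivAt_half (x : ℝ) : HasDerivAt (fun x : ℝ => (1 + x) / 2) (1 / 2) x :=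
  ((hasDerivAt_id x).const_add 1).div_const 2

/-- With φ = (1 + x)^ρ₁ (1 - x)^ρ₂ F((1 + x)/2), `gPlus` is 2ν φ'/φ. The Riccati equation for it is
2ν² φ''/φ = P_c/(1 - x²)², which the indicial identities and the hypergeometric equation give. -/
theorem hasDerivAt_gPlus {a : (Fin 3 → ℝ) × ℝ} (ha : a ∈ goodParams) {x : ℝ}
    (hx : x ∈ Ioo (-1 : ℝ) 1) : HasDerivAt (gPlus a) (riccatiRhs gPlus a x) x := by
  have hp := hyperParam_mem ha
  have hz := abs_half_lt hx
  have hF := hyperF_half_pos ha hx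
  have h1 : 1 + x ≠ 0 := by linarith [hx.1]
  have h2 : 1 - x ≠ 0 := by linarith [hx.2]
  have hν := ha.1
  have dF := (hasDerivAt_hyperF hp hz).comp x (hasDerivAt_half x)
  have dF₁ := (hasDerivAt_hyperF₁ hp hz).comp x (hasDerivAt_half x)
  have e0 := exponent_identity ha.1 ha.2.1
  have e1 := exponent_identity ha.1 ha.2.2.1
  have e2 := hyperParam_identity ha
  have eq := hyperF_equation hp hz
  have d := ((((hasDerivAt_const x (hyperParam a).1).div ((hasDerivAt_id x).const_add 1) h1).sub
    ((hasDerivAt_const x (hyperParam a).2.1).div ((hasDerivAt_id x).const_sub 1) h2)).add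
    ((dF₁.div dF hF.ne').const_mul (1 / 2))).const_mul (2 * a.2)
  refine d.congr_deriv ?_
  have h3 : 1 - x ^ 2 = (1 + x) * (1 - x) := by ring
  rw [riccatiRhs, h3]
  simp only [gPlus, polyP, Function.comp_apply, id]
  change 4 * a.2 ^ 2 * ((hyperParam a).1 * ((hyperParam a).1 - 1)) = _ at e0
  change 4 * a.2 ^ 2 * ((hyperParam a).2.1 * ((hyperParam a).2.1 - 1)) = _ at e1
  generalize hyperParam a = p at *
  generalize hyperF₂ p ((1 + x) / 2) = F₂ at *
  generalize hyperF₁ p ((1 + x) / 2) = F₁ at *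
  generalize hyperF p ((1 + x) / 2) = F at *
  have hc2 : a.1 2 = 2 * a.2 ^ 2 * (p.2.2 - 2 * p.1 * p.2.1) - 1 / 2 * (a.1 0 + a.1 1) := by
    linarith
  rw [hc2, ← e0, ← e1]
  -- The hypergeometric equation solved for F''; at z = (1 + x)/2 one has z (1 - z) = (1 + x)(1 -
  -- x)/4, hence the factor 4.
  have hF₂ : F₂ = (p.2.2 * F - 2 * (p.1 - (p.1 + p.2.1) * ((1 + x) / 2)) * F₁) * 4 /
      ((1 + x) * (1 - x)) := by
    rw [eq_div_iff (mul_ne_zero h1 h2)]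
    linear_combination 4 * eq
  rw [hF₂]
  field_simp
  ring

/-- The exchange of the two poles. -/
def swapParam (a : (Fin 3 → ℝ) × ℝ) : (Fin 3 → ℝ) × ℝ := (![a.1 1, a.1 0, a.1 2], a.2)

theorem c3bar_comm (c₁ c₂ ν : ℝ) : c3bar c₁ c₂ ν = c3bar c₂ c₁ ν := by
  simp only [c3bar]
  ring

theorem swapParam_mem {a : (Fin 3 → ℝ) × ℝ} (ha : a ∈ goodParams) : swapParam a ∈ goodParams := by
  obtain ⟨h0, h1, h2, h3⟩ := ha
  refine ⟨h0, h2, h1, ?_⟩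
  rw [c3bar_comm] at h3
  exact h3

theorem continuous_swapParam : Continuous swapParam := by
  refine Continuous.prodMk (continuous_pi fun i => ?_) continuous_snd
  fin_cases i
  · exact (continuous_apply 1).comp continuous_fst
  · exact (continuous_apply 0).comp continuous_fst
  · change Continuous fun a : (Fin 3 → ℝ) × ℝ => a.1 2
    fun_prop

theorem polyP_swapParam (a : (Fin 3 → ℝ) × ℝ) (x : ℝ) :
    polyP (swapParam a).1 (-x) = polyP a.1 x := by
  simp [polyP, swapParam]
  ring

/-- The solution of the Riccati equation that is minimal on `(-1, 1)`. -/
def gMinus (a : (Fin 3 → ℝ) × ℝ) (x : ℝ) : ℝ := -gPlus (swapParam a) (-x)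

theorem neg_mem_Ioo {x : ℝ} (hx : x ∈ Ioo (-1 : ℝ) 1) : -x ∈ Ioo (-1 : ℝ) 1 :=
  ⟨by linarith [hx.2], by linarith [hx.1]⟩

/-- The Riccati equation is invariant under x ↦ -x, g ↦ -g combined with the exchange of c₁ and c₂.
-/
theorem hasDerivAt_gMinus {a : (Fin 3 → ℝ) × ℝ} (ha : a ∈ goodParams) {x : ℝ}
    (hx : x ∈ Ioo (-1 : ℝ) 1) : HasDerivAt (gMinus a) (riccatiRhs gMinus a x) x := by
  have h := ((hasDerivAt_gPlus (swapParam_mem ha) (neg_mem_Ioo hx)).comp x (hasDerivAt_neg x)).neg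
  refine h.congr_deriv ?_
  rw [riccatiRhs, riccatiRhs, polyP_swapParam, gMinus]
  simp [swapParam]

theorem mem_contClass {Λ : Type*} [TopologicalSpace Λ] {S : Set Λ} {f : Λ → ℝ → ℝ} :
    f ∈ (contClass S).carrier ↔ ContinuousOn (fun p : Λ × ℝ => f p.1 p.2) (S ×ˢ Ioo (-1) 1) :=
  Iff.rfl

theorem continuousOn_mem_contClass_param {Λ : Type*} [TopologicalSpace Λ] {S : Set Λ} {φ : Λ → ℝ}
    (h : ContinuousOn φ S) : (fun a _ => φ a) ∈ (contClass S).carrier :=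
  h.comp continuousOn_fst fun _ hp => hp.1

theorem var_mem_contClass {Λ : Type*} [TopologicalSpace Λ] (S : Set Λ) :
    (fun _ x => x) ∈ (contClass S).carrier := continuousOn_snd

theorem inv_mem_contClass {Λ : Type*} [TopologicalSpace Λ] {S : Set Λ} {f : Λ → ℝ → ℝ}
    (hf : f ∈ (contClass S).carrier) (h0 : ∀ a ∈ S, ∀ x ∈ Ioo (-1 : ℝ) 1, f a x ≠ 0) :
    (fun a x => (f a x)⁻¹) ∈ (contClass S).carrier :=
  ContinuousOn.inv₀ hf fun p hp => h0 p.1 hp.1 p.2 hp.2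

namespace Tower

variable {Λ : Type*} {S : Set Λ} {𝒜 : FamilyClass S}

theorem one_sub_sq (hx : (fun _ x => x) ∈ 𝒜.carrier) (k : ℕ) :
    Tower 𝒜 k (fun _ x => 1 - x ^ 2) :=
  (const 1 k).sub (var hx k).sq

theorem inv_one_sub_sq (hx : (fun _ x => x) ∈ 𝒜.carrier)
    (hi : (fun _ x => (1 - x ^ 2)⁻¹) ∈ 𝒜.carrier) (k : ℕ) :
    Tower 𝒜 k (fun _ x => (1 - x ^ 2)⁻¹) :=
  (one_sub_sq hx k).inv (fun _ _ _ hx => (one_sub_sq_pos hx).ne') hi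

theorem polyP {C : Λ → Fin 3 → ℝ} (hc : ∀ i, (fun a _ => C a i) ∈ 𝒜.carrier)
    (hx : (fun _ x => x) ∈ 𝒜.carrier) (k : ℕ) : Tower 𝒜 k (fun a x => polyP (C a) x) :=
  (((of_param (hc 0) k).mul ((const 1 k).sub (var hx k))).add
    ((of_param (hc 1) k).mul ((const 1 k).add (var hx k)))).add
    ((of_param (hc 2) k).mul (one_sub_sq hx k))

end Tower

theorem coord_mem_contClass (S : Set ((Fin 3 → ℝ) × ℝ)) (i : Fin 3) :
    (fun a _ => a.1 i) ∈ (contClass S).carrier :=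
  continuousOn_mem_contClass_param ((continuous_apply i).comp continuous_fst).continuousOn

theorem inv_one_sub_sq_mem_contClass {Λ : Type*} [TopologicalSpace Λ] (S : Set Λ) :
    (fun _ x => (1 - x ^ 2)⁻¹) ∈ (contClass S).carrier :=
  inv_mem_contClass (Tower.one_sub_sq (𝒜 := contClass S) (var_mem_contClass S) 0)
    fun _ _ _ hx => (one_sub_sq_pos hx).ne'

theorem inv_viscosity_mem_contClass : (fun a _ => a.2⁻¹) ∈ (contClass goodParams).carrier :=
  continuousOn_mem_contClass_param (continuousOn_snd.inv₀ fun _ ha => ha.1.ne')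

theorem continuousOn_hyperF_half :
    (fun a x => hyperF (hyperParam a) ((1 + x) / 2)) ∈ (contClass goodParams).carrier ∧
    (fun a x => hyperF₁ (hyperParam a) ((1 + x) / 2)) ∈ (contClass goodParams).carrier := by
  have hc : ContinuousOn (fun w : ((Fin 3 → ℝ) × ℝ) × ℝ => (hyperParam w.1, (1 + w.2) / 2))
      (goodParams ×ˢ Ioo (-1) 1) :=
    (continuousOn_hyperParam.comp continuousOn_fst fun _ hp => hp.1).prodMk
      (Continuous.continuousOn (by fun_prop))
  have hm : MapsTo (fun w : ((Fin 3 → ℝ) × ℝ) × ℝ => (hyperParam w.1, (1 + w.2) / 2))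
      (goodParams ×ˢ Ioo (-1) 1) (hyperDomain ×ˢ Ioo (-1) 1) := fun w hw =>
    ⟨hyperParam_mem hw.1, abs_lt.1 (abs_half_lt hw.2)⟩
  constructor
  · have h : ContinuousOn (fun w : ((Fin 3 → ℝ) × ℝ) × ℝ =>
        hyperF (hyperParam w.1) ((1 + w.2) / 2)) (goodParams ×ˢ Ioo (-1) 1) :=
      continuousOn_hyperF.comp hc hm
    exact mem_contClass.2 h
  · have h : ContinuousOn (fun w : ((Fin 3 → ℝ) × ℝ) × ℝ =>
        hyperF₁ (hyperParam w.1) ((1 + w.2) / 2)) (goodParams ×ˢ Ioo (-1) 1) :=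
      continuousOn_hyperF₁.comp hc hm
    exact mem_contClass.2 h

theorem gPlus_mem_contClass : gPlus ∈ (contClass goodParams).carrier := by
  let 𝒞 := contClass goodParams
  have h1 : (fun a _ => (hyperParam a).1) ∈ 𝒞.carrier :=
    continuousOn_mem_contClass_param (continuous_fst.comp_continuousOn continuousOn_hyperParam)
  have h2 : (fun a _ => (hyperParam a).2.1) ∈ 𝒞.carrier :=
    continuousOn_mem_contClass_param
      ((continuous_fst.comp continuous_snd).comp_continuousOn continuousOn_hyperParam)
  have h3 : (fun a _ => a.2) ∈ 𝒞.carrier := continuousOn_mem_contClass_param continuousOn_snd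
  have hx := var_mem_contClass goodParams
  have h4 : (fun _ x => (1 + x)⁻¹) ∈ 𝒞.carrier :=
    inv_mem_contClass (𝒞.add_mem (𝒞.const_mem 1) hx) fun _ _ x hx => by linarith [hx.1]
  have h5 : (fun _ x => (1 + -1 * x)⁻¹) ∈ 𝒞.carrier :=
    inv_mem_contClass (𝒞.add_mem (𝒞.const_mem 1) (𝒞.mul_mem (𝒞.const_mem (-1)) hx))
      fun _ _ x hx => by linarith [hx.2]
  have h6 := 𝒞.mul_mem continuousOn_hyperF_half.2
    (inv_mem_contClass continuousOn_hyperF_half.1 fun a ha x hx => (hyperF_half_pos ha hx).ne')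
  refine 𝒞.congr_mem (𝒞.mul_mem (𝒞.mul_mem (𝒞.const_mem 2) h3)
    (𝒞.add_mem (𝒞.add_mem (𝒞.mul_mem h1 h4) (𝒞.mul_mem (𝒞.const_mem (-1)) (𝒞.mul_mem h2 h5)))
      (𝒞.mul_mem (𝒞.const_mem (1 / 2)) h6))) fun a _ x _ => ?_
  rw [gPlus]
  ring

theorem tower_riccatiRhs {S : Set ((Fin 3 → ℝ) × ℝ)} {𝒜 : FamilyClass S}
    {g : (Fin 3 → ℝ) × ℝ → ℝ → ℝ} (hc : ∀ i, (fun a _ => a.1 i) ∈ 𝒜.carrier)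
    (hx : (fun _ x => x) ∈ 𝒜.carrier) (hi : (fun _ x => (1 - x ^ 2)⁻¹) ∈ 𝒜.carrier)
    (hν : (fun a _ => a.2⁻¹) ∈ 𝒜.carrier) {k : ℕ} (hg : Tower 𝒜 k g) :
    Tower 𝒜 k (riccatiRhs g) :=
  (Tower.of_param hν k).mul (((Tower.polyP hc hx k).mul (Tower.inv_one_sub_sq hx hi k).sq).sub
    (hg.sq.const_mul (1 / 2)))

/-- The Riccati equation writes g' as a polynomial in g with coefficients already in the class, so
joint continuity of g alone propagates to all derivatives. -/
theorem tower_gPlus (k : ℕ) : Tower (contClass goodParams) k gPlus :=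
  Tower.bootstrap gPlus_mem_contClass (fun _ ha _ hx => hasDerivAt_gPlus ha hx)
    (fun _ hk => tower_riccatiRhs (coord_mem_contClass _) (var_mem_contClass _)
      (inv_one_sub_sq_mem_contClass _) inv_viscosity_mem_contClass hk) k

theorem mem_contClass_pullback {Λ Λ' : Type*} [TopologicalSpace Λ] [TopologicalSpace Λ']
    {S : Set Λ} {S' : Set Λ'} {φ : Λ' → Λ} {σ : ℝ} (hσ : σ = 1 ∨ σ = -1)
    (hφ : ∀ a ∈ S', φ a ∈ S) (hφc : ContinuousOn φ S') (f : Λ → ℝ → ℝ)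
    (hf : f ∈ (contClass S).carrier) :
    (fun a x => f (φ a) (σ * x)) ∈ (contClass S').carrier := by
  refine ContinuousOn.comp (f := fun p : Λ' × ℝ => (φ p.1, σ * p.2)) hf
    ((hφc.comp continuousOn_fst fun _ hp => hp.1).prodMk
      (continuousOn_const.mul continuousOn_snd)) fun p hp => ⟨hφ _ hp.1, ?_⟩
  rcases hσ with rfl | rfl
  · simpa using hp.2
  · simpa using neg_mem_Ioo hp.2

theorem tower_gMinus (k : ℕ) : Tower (contClass goodParams) k gMinus :=
  ((tower_gPlus k).pullback (σ := -1) (Or.inr rfl) (fun _ ha => swapParam_mem ha)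
    (mem_contClass_pullback (Or.inr rfl) (fun _ ha => swapParam_mem ha)
      continuous_swapParam.continuousOn)).neg.congr fun _ _ _ _ => by simp [gMinus]

/-! ### Comparison lemmas for ordinary differential equations -/

/-- An upper bound, independent of the initial value, for the Riccati equation
`2 ν g' = G ^ 2 - g ^ 2`. -/
theorem riccati_le {g g' G G' : ℝ → ℝ} {ν v M lo x : ℝ} (hν : 0 < ν) (hv : 0 < v) (hM : 0 ≤ M)
    (hx : lo < x) (hg : ∀ y ∈ Icc lo x, HasDerivAt g (g' y) y)
    (hG : ∀ y ∈ Icc lo x, HasDerivAt G (G' y) y)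
    (heq : ∀ y ∈ Icc lo x, ν * g' y = 1 / 2 * G y ^ 2 - 1 / 2 * g y ^ 2)
    (hGv : ∀ y ∈ Icc lo x, v ≤ G y) (hG' : ∀ y ∈ Icc lo x, |G' y| ≤ M) :
    g x - G x ≤ ν * (2 / (x - lo) + (M / v + 1)) := by
  -- C is chosen so that |G'| ≤ C v. Where (y - lo)(g - G) meets the barrier 2ν + Cν(y - lo), the
  -- difference g - G is at least Cν, so the damping G (g - G) absorbs ν G'.
  set C := M / v + 1 with hC
  have hC0 : 0 < C := by positivity
  have hCv : M ≤ C * v := by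
    rw [hC, add_mul, div_mul_cancel₀ _ hv.ne']
    linarith
  -- The weight y - lo vanishes at the left end, so no information on g there is needed.
  have df : ∀ y ∈ Icc lo x, HasDerivAt (fun y => (y - lo) * (g y - G y))
      (1 * (g y - G y) + (y - lo) * (g' y - G' y)) y := fun y hy =>
    ((hasDerivAt_id y).sub_const lo).mul ((hg y hy).sub (hG y hy))
  have dB : ∀ y : ℝ, HasDerivAt (fun y => 2 * ν + C * ν * (y - lo)) (C * ν * 1) y := fun y =>
    (((hasDerivAt_id y).sub_const lo).const_mul (C * ν)).const_add (2 * ν)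
  have key := image_le_of_deriv_right_lt_deriv_boundary'
    (fun y hy => (df y hy).continuousAt.continuousWithinAt)
    (fun y hy => (df y (Ico_subset_Icc_self hy)).hasDerivWithinAt) (B := fun y => 2 * ν + C * ν * (y - lo))
    (by simp; positivity) (fun y _ => (dB y).continuousAt.continuousWithinAt)
    (fun y _ => (dB y).hasDerivWithinAt) (fun y hy h => ?_) (right_mem_Icc.2 hx.le)
  · have hs : 0 < x - lo := sub_pos.2 hx
    have : g x - G x ≤ (2 * ν + C * ν * (x - lo)) / (x - lo) := by
      rw [le_div_iff₀ hs]
      linarith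
    calc g x - G x ≤ _ := this
      _ = _ := by field_simp
  · have hy' := Ico_subset_Icc_self hy
    have e := heq y hy'
    have hb := abs_le.1 (hG' y hy')
    have hGy := hGv y hy'
    have hs : 0 ≤ y - lo := sub_nonneg.2 hy.1
    set s := y - lo
    have hD : C * ν ≤ g y - G y := by
      by_contra hc
      push Not at hc
      nlinarith
    set D := g y - G y with hDdef
    have hg'y : ν * g' y = -(D ^ 2 / 2) - G y * D := by
      rw [e, hDdef]
      ring
    have h1 : ν * (1 * D + s * (g' y - G' y)) =
        D * (ν - s * D / 2) - s * G y * D - s * ν * G' y := by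
      linear_combination s * hg'y
    -- The constant 2ν in the barrier makes the quadratic term -D²/2 pay for the derivative of the
    -- weight.
    have h2 : ν - s * D / 2 = -(C * ν * s / 2) := by linear_combination -(1 / 2) * h
    rw [h2] at h1
    have hD0 : 0 ≤ D := by
      have : 0 ≤ C * ν := by positivity
      linarith
    have hG0 : 0 ≤ G y := hv.le.trans hGy
    have h3 : s * (v * (C * ν)) ≤ s * (G y * D) := by
      gcongr
    have h4 : -(s * ν * G' y) ≤ s * (ν * (C * v)) := by
      have : s * ν * (-G' y) ≤ s * ν * (C * v) := by
        gcongr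
        linarith
      linarith
    have h5 : 0 ≤ D * (C * ν * s / 2) := by positivity
    have h6 : ν * (1 * D + s * (g' y - G' y)) ≤ 0 := by
      rw [h1]
      linarith
    have h7 : 1 * D + s * (g' y - G' y) ≤ 0 := by
      by_contra hc
      push Not at hc
      have := mul_pos hν hc
      linarith
    have h8 : 0 < C * ν * 1 := by positivity
    linarith

/-- A lower bound for nonnegative solutions of the Riccati equation `2 ν g' = G ^ 2 - g ^ 2`. -/
theorem le_riccati {g g' G G' : ℝ → ℝ} {ν v M Γ lo x : ℝ} (hν : 0 < ν) (hv : 0 < v) (hM : 0 ≤ M)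
    (hΓ : 0 < Γ) (hx : lo < x) (hx2 : x - lo ≤ 2) (hg : ∀ y ∈ Icc lo x, HasDerivAt g (g' y) y)
    (hG : ∀ y ∈ Icc lo x, HasDerivAt G (G' y) y)
    (heq : ∀ y ∈ Icc lo x, ν * g' y = 1 / 2 * G y ^ 2 - 1 / 2 * g y ^ 2)
    (hGv : ∀ y ∈ Icc lo x, v ≤ G y) (hGΓ : ∀ y ∈ Icc lo x, G y ≤ Γ)
    (hG' : ∀ y ∈ Icc lo x, |G' y| ≤ M) (hg0 : ∀ y ∈ Icc lo x, 0 ≤ g y) :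
    G x - g x ≤ ν * ((4 * Γ / v + 8 * M / v + 1) / (x - lo)) := by
  -- At a contact point s (G - g) = Cν. The part 4Γ/v of C forces s v ≥ 4ν there, which controls the
  -- derivative of the weight; the part 8M/v dominates the contribution of G', where s ≤ 2.
  set C := 4 * Γ / v + 8 * M / v + 1 with hC
  have hC0 : 0 < C := by positivity
  have hCv : 4 * Γ + 8 * M + v = C * v := by
    rw [hC]
    field_simp
  have df : ∀ y ∈ Icc lo x, HasDerivAt (fun y => (y - lo) * (G y - g y))
      (1 * (G y - g y) + (y - lo) * (G' y - g' y)) y := fun y hy =>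
    ((hasDerivAt_id y).sub_const lo).mul ((hG y hy).sub (hg y hy))
  have key := image_le_of_deriv_right_lt_deriv_boundary'
    (fun y hy => (df y hy).continuousAt.continuousWithinAt)
    (fun y hy => (df y (Ico_subset_Icc_self hy)).hasDerivWithinAt) (B := fun _ => C * ν)
    (B' := fun _ => 0)
    (by simp; positivity) continuousOn_const
    (fun y _ => (hasDerivAt_const y _).hasDerivWithinAt) (fun y hy h => ?_) (right_mem_Icc.2 hx.le)
  · have hs : 0 < x - lo := sub_pos.2 hx
    rw [← mul_div_assoc, le_div_iff₀ hs]
    linarith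
  · have hy' := Ico_subset_Icc_self hy
    have e := heq y hy'
    have hb := abs_le.1 (hG' y hy')
    have hGy := hGv y hy'
    have hGy2 := hGΓ y hy'
    have hgy := hg0 y hy'
    have hs : 0 ≤ y - lo := sub_nonneg.2 hy.1
    have hs2 : y - lo ≤ 2 := by linarith [hy.2]
    set s := y - lo
    set E := G y - g y with hE
    have hCν : 0 < C * ν := by positivity
    have hE0 : 0 < E := by
      by_contra hc
      push Not at hc
      nlinarith
    -- The only use of g ≥ 0 besides h2 below: it bounds the error at a contact point, so that
    -- contact cannot occur close to the left end.
    have hEΓ : E ≤ Γ := by linarith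
    have hsΓ : C * ν ≤ s * Γ := by nlinarith
    have hsv : 4 * ν ≤ s * v := by
      have h1 : 4 * Γ ≤ C * v := by linarith
      have h2 : ν * (4 * Γ) ≤ ν * (C * v) := by gcongr
      have h3 : C * ν * v ≤ s * Γ * v := by gcongr
      have h4 : Γ * (4 * ν) ≤ Γ * (s * v) := by linarith
      exact le_of_mul_le_mul_left h4 hΓ
    have h1 : ν * (1 * E + s * (G' y - g' y)) =
        E * (ν - s * (g y + G y) / 2) + s * ν * G' y := by
      rw [hE]
      linear_combination -s * e
    have h2 : E * (ν - s * (g y + G y) / 2) ≤ E * (-(s * v / 4)) := by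
      gcongr
      nlinarith
    have h3 : E * (-(s * v / 4)) = -(ν * (C * v)) / 4 := by linear_combination -(v / 4) * h
    have h4 : s * ν * G' y ≤ 2 * ν * M := by
      calc s * ν * G' y ≤ s * ν * M := by gcongr; exact hb.2
        _ ≤ 2 * ν * M := by gcongr
    have h5 : ν * (1 * E + s * (G' y - g' y)) < 0 := by
      rw [h1]
      have : 0 < ν * (Γ + v / 4) := by positivity
      rw [h3, ← hCv] at h2
      linarith
    by_contra hc
    push Not at hc
    have := mul_nonneg hν.le hc
    linarith

/-- An interior bound for solutions of the stiff linear equation `ν y' = -A y + h`. -/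
theorem stiff_linear_le {y y' A h : ℝ → ℝ} {ν A₀ H Y lo x : ℝ} (hν : 0 < ν) (hν1 : ν ≤ 1)
    (hA₀ : 0 < A₀) (hH : 0 ≤ H) (hY : 0 < Y) (hx : lo < x) (hx2 : x - lo ≤ 2)
    (hy : ∀ t ∈ Icc lo x, HasDerivAt y (y' t) t)
    (heq : ∀ t ∈ Icc lo x, ν * y' t = -(A t * y t) + h t)
    (hA : ∀ t ∈ Icc lo x, A₀ ≤ A t) (hh : ∀ t ∈ Icc lo x, |h t| ≤ H)
    (hyY : ∀ t ∈ Icc lo x, |ν * y t| ≤ Y) :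
    y x ≤ (16 * Y / A₀ ^ 2 + 8 * H / A₀ + 1) / (x - lo) ^ 2 := by
  -- The barrier for (t - lo)² y is the constant C. At contact, the crude bound |ν y| ≤ Y gives Cν ≤
  -- s² Y. The part 16Y/A₀² then yields s A₀ ≥ 4ν, using ν² ≤ ν, and the part 8H/A₀ dominates the
  -- source, as s² ≤ 4.
  set C := 16 * Y / A₀ ^ 2 + 8 * H / A₀ + 1 with hC
  have hC0 : 0 < C := by positivity
  have hCA : 8 * H < C * A₀ := by
    have : C * A₀ = 16 * Y / A₀ + 8 * H + A₀ := by
      rw [hC]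
      field_simp
    have h2 : 0 < 16 * Y / A₀ := by positivity
    linarith
  have hCY : 16 * Y ≤ C * A₀ ^ 2 := by
    have : C * A₀ ^ 2 = 16 * Y + 8 * H * A₀ + A₀ ^ 2 := by
      rw [hC]
      field_simp
    have h2 : 0 ≤ 8 * H * A₀ := by positivity
    have h3 : 0 ≤ A₀ ^ 2 := by positivity
    linarith
  have df : ∀ t ∈ Icc lo x, HasDerivAt (fun t => (t - lo) ^ 2 * y t)
      (2 * (t - lo) * y t + (t - lo) ^ 2 * y' t) t := fun t ht => by
    refine ((((hasDerivAt_id t).sub_const lo).pow 2).mul (hy t ht)).congr_deriv ?_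
    simp
  have key := image_le_of_deriv_right_lt_deriv_boundary'
    (fun t ht => (df t ht).continuousAt.continuousWithinAt)
    (fun t ht => (df t (Ico_subset_Icc_self ht)).hasDerivWithinAt) (B := fun _ => C)
    (B' := fun _ => 0)
    (by simp; positivity) continuousOn_const
    (fun t _ => (hasDerivAt_const t _).hasDerivWithinAt) (fun t ht hf => ?_) (right_mem_Icc.2 hx.le)
  · have hs : 0 < x - lo := sub_pos.2 hx
    rw [le_div_iff₀ (by positivity)]
    linarith
  · have ht' := Ico_subset_Icc_self ht
    have e := heq t ht'
    have hAt := hA t ht'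
    have hht := (abs_le.1 (hh t ht')).2
    have hyt := (abs_le.1 (hyY t ht')).2
    have hs : 0 ≤ t - lo := sub_nonneg.2 ht.1
    have hs2 : t - lo ≤ 2 := by linarith [ht.2]
    set s := t - lo
    have hy0 : 0 < y t := by
      by_contra hc
      push Not at hc
      have := mul_nonpos_of_nonneg_of_nonpos (sq_nonneg s) hc
      linarith
    have h1 : C * ν ≤ s ^ 2 * Y := by
      have : s ^ 2 * (ν * y t) ≤ s ^ 2 * Y := by gcongr
      nlinarith
    have h2 : 4 * ν ≤ s * A₀ := by
      refine le_of_sq_le_sq ?_ (by positivity)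
      have h3 : C * ν * A₀ ^ 2 ≤ s ^ 2 * Y * A₀ ^ 2 := by gcongr
      have h4 : ν * (16 * Y) ≤ ν * (C * A₀ ^ 2) := by gcongr
      have h5 : Y * (16 * ν) ≤ Y * (s ^ 2 * A₀ ^ 2) := by linarith
      have h6 := le_of_mul_le_mul_left h5 hY
      have h7 : ν ^ 2 ≤ ν := by nlinarith
      calc (4 * ν) ^ 2 = 16 * ν ^ 2 := by ring
        _ ≤ 16 * ν := by gcongr
        _ ≤ s ^ 2 * A₀ ^ 2 := h6
        _ = _ := by ring
    have h3 : ν * (2 * s * y t + s ^ 2 * y' t) = s * y t * (2 * ν - s * A t) + s ^ 2 * h t := by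
      linear_combination s ^ 2 * e
    have h4 : s * y t * (2 * ν - s * A t) ≤ s * y t * (-(s * A₀ / 2)) := by
      gcongr
      have : s * A₀ ≤ s * A t := by gcongr
      linarith
    have h5 : s * y t * (-(s * A₀ / 2)) = -(C * A₀) / 2 := by linear_combination -(A₀ / 2) * hf
    have h6 : s ^ 2 * h t ≤ 2 ^ 2 * H := by
      calc s ^ 2 * h t ≤ s ^ 2 * H := by gcongr
        _ ≤ 2 ^ 2 * H := by gcongr
    by_contra hc
    push Not at hc
    have := mul_nonneg hν.le hc
    rw [h3] at this
    linarith

/-! ### The parameter sets -/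

/-- Decreasing one coordinate slightly stays in the set and strictly worsens the corresponding
inequality. -/
theorem interior_paramJ_lt {ν : ℝ} {c : Fin 3 → ℝ} (hc : c ∈ interior (paramJ ν)) :
    -ν ^ 2 < c 0 ∧ -ν ^ 2 < c 1 ∧ c3bar (c 0) (c 1) ν < c 2 := by
  have key : ∀ i : Fin 3, ∃ t : ℝ, t < 0 ∧ (c + t • Pi.single i (1 : ℝ)) ∈ paramJ ν := fun i => by
    have hcont : Continuous fun t : ℝ => c + t • Pi.single i (1 : ℝ) := by fun_prop
    have : (fun t : ℝ => c + t • Pi.single i (1 : ℝ)) ⁻¹' paramJ ν ∈ 𝓝 (0 : ℝ) := by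
      refine hcont.continuousAt.preimage_mem_nhds ?_
      simpa using mem_interior_iff_mem_nhds.1 hc
    obtain ⟨δ, hδ, h⟩ := Metric.mem_nhds_iff.1 this
    refine ⟨-(δ / 2), by linarith, h ?_⟩
    rw [Metric.mem_ball, dist_zero_right, norm_neg, Real.norm_eq_abs, abs_of_pos (by linarith)]
    linarith
  refine ⟨?_, ?_, ?_⟩
  · obtain ⟨t, ht, h, _⟩ := key 0
    simp at h
    linarith
  · obtain ⟨t, ht, _, h, _⟩ := key 1
    simp at h
    linarith
  · obtain ⟨t, ht, _, _, h⟩ := key 2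
    simp at h
    linarith

theorem paramSet_subset : paramSet ⊆ goodParams := fun _ ha => ⟨ha.1, interior_subset ha.2.2⟩

theorem c3bar_antitone {c₁ c₂ ν : ℝ} (hν : 0 ≤ ν) :
    c3bar c₁ c₂ ν ≤ c3bar c₁ c₂ 0 := by
  have h1 : Real.sqrt (0 ^ 2 + c₁) ≤ Real.sqrt (ν ^ 2 + c₁) := Real.sqrt_le_sqrt (by nlinarith)
  have h2 : Real.sqrt (0 ^ 2 + c₂) ≤ Real.sqrt (ν ^ 2 + c₂) := Real.sqrt_le_sqrt (by nlinarith)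
  have h3 := Real.sqrt_nonneg (0 ^ 2 + c₁)
  have h4 := Real.sqrt_nonneg (0 ^ 2 + c₂)
  rw [c3bar, c3bar, mul_assoc, mul_assoc]
  have : (Real.sqrt (0 ^ 2 + c₁) + Real.sqrt (0 ^ 2 + c₂)) *
      (Real.sqrt (0 ^ 2 + c₁) + Real.sqrt (0 ^ 2 + c₂) + 2 * 0) ≤
      (Real.sqrt (ν ^ 2 + c₁) + Real.sqrt (ν ^ 2 + c₂)) *
      (Real.sqrt (ν ^ 2 + c₁) + Real.sqrt (ν ^ 2 + c₂) + 2 * ν) := by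
    gcongr
  exact mul_le_mul_of_nonpos_left this (by norm_num)

/-- As c̄₃ decreases in ν, an inviscid interior parameter is admissible for every positive
viscosity. -/
theorem mem_goodParams {c : Fin 3 → ℝ} (hc : c ∈ interior (paramJ 0)) {ν : ℝ} (hν : 0 < ν) :
    (c, ν) ∈ goodParams := by
  obtain ⟨h0, h1, h2⟩ := interior_paramJ_lt hc
  have := sq_nonneg ν
  refine ⟨hν, ?_, ?_, (c3bar_antitone hν.le).trans h2.le⟩
  · change -ν ^ 2 ≤ c 0
    linarith
  · change -ν ^ 2 ≤ c 1
    linarith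

/-- With c₁ = s² and c₂ = t², replacing c₃ by its lower bound -(s + t)²/2 turns P_c(x) into the
square (s (1 - x) - t (1 + x))²/2. -/
theorem polyP_pos {c : Fin 3 → ℝ} (hc : c ∈ interior (paramJ 0)) {x : ℝ}
    (hx : x ∈ Ioo (-1 : ℝ) 1) : 0 < polyP c x := by
  obtain ⟨h0, h1, h2⟩ := interior_paramJ_lt hc
  have h3 := one_sub_sq_pos hx
  have e0 := Real.sq_sqrt (show 0 ≤ (0 : ℝ) ^ 2 + c 0 by linarith)
  have e1 := Real.sq_sqrt (show 0 ≤ (0 : ℝ) ^ 2 + c 1 by linarith)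
  rw [c3bar] at h2
  set s := Real.sqrt (0 ^ 2 + c 0)
  set t := Real.sqrt (0 ^ 2 + c 1)
  have h4 := mul_lt_mul_of_pos_right h2 h3
  have h5 := sq_nonneg (s * (1 - x) - t * (1 + x))
  rw [polyP]
  have h6 : c 0 = s ^ 2 := by linarith
  have h7 : c 1 = t ^ 2 := by linarith
  rw [h6, h7]
  nlinarith

/-- The profile of the Euler solution: `u_θ = ± eulerProfile c (cos θ) sin θ / r`. -/
def eulerProfile (c : Fin 3 → ℝ) (x : ℝ) : ℝ := Real.sqrt (2 * polyP c x) * (1 - x ^ 2)⁻¹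

theorem eulerProfile_pos {c : Fin 3 → ℝ} (hc : c ∈ interior (paramJ 0)) {x : ℝ}
    (hx : x ∈ Ioo (-1 : ℝ) 1) : 0 < eulerProfile c x := by
  have := polyP_pos hc hx
  have := one_sub_sq_pos hx
  rw [eulerProfile]
  positivity

theorem eulerProfile_sq {c : Fin 3 → ℝ} (hc : c ∈ interior (paramJ 0)) {x : ℝ}
    (hx : x ∈ Ioo (-1 : ℝ) 1) : 1 / 2 * eulerProfile c x ^ 2 = polyP c x * ((1 - x ^ 2)⁻¹) ^ 2 := by
  have := polyP_pos hc hx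
  rw [eulerProfile, mul_pow, Real.sq_sqrt (by positivity)]
  ring

theorem tower_eulerProfile (k : ℕ) : Tower (contClass (interior (paramJ 0))) k eulerProfile := by
  let 𝒞 := contClass (interior (paramJ 0))
  have hP : ∀ k, Tower 𝒞 k (fun c x => 2 * polyP c x) := fun k =>
    (Tower.polyP (C := fun c => c) (fun i => continuousOn_mem_contClass_param
      (continuous_apply i).continuousOn) (var_mem_contClass _) k).const_mul 2
  have hpos : ∀ c ∈ interior (paramJ 0), ∀ x ∈ Ioo (-1 : ℝ) 1, 0 < 2 * polyP c x :=
    fun c hc x hx => mul_pos two_pos (polyP_pos hc hx)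
  have hs : (fun c x => Real.sqrt (2 * polyP c x)) ∈ 𝒞.carrier :=
    mem_contClass.2 (mem_contClass.1 (hP 0)).sqrt
  refine (Tower.sqrt hP hpos hs (inv_mem_contClass hs fun c hc x hx =>
    (Real.sqrt_pos.2 (hpos c hc x hx)).ne') k).mul
    (Tower.inv_one_sub_sq (var_mem_contClass _) (inv_one_sub_sq_mem_contClass _) k)

/-- The parameters `(c, ν)` with `c ∈ K` and `0 < ν ≤ 1`. -/
def inviscidSet (K : Set (Fin 3 → ℝ)) : Set ((Fin 3 → ℝ) × ℝ) := {a | a.1 ∈ K ∧ 0 < a.2 ∧ a.2 ≤ 1}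

/-- The families on `inviscidSet K` that are bounded on `[-1 + δ, 1 - δ]` for all `δ > 0`, uniformly
in the viscosity. -/
def uniformClass (K : Set (Fin 3 → ℝ)) : FamilyClass (inviscidSet K) :=
  bddClass (inviscidSet K) (fun δ => {p | p.1 ∈ inviscidSet K ∧ -1 + δ ≤ p.2 ∧ p.2 ≤ 1 - δ})
    fun _ _ _ hp => ⟨hp.1, by linarith [hp.2.1], by linarith [hp.2.2]⟩

theorem mem_uniformClass {K : Set (Fin 3 → ℝ)} {f : (Fin 3 → ℝ) × ℝ → ℝ → ℝ} :
    f ∈ (uniformClass K).carrier ↔ ∀ δ, 0 < δ → ∃ C, ∀ a ∈ inviscidSet K, ∀ x, -1 + δ ≤ x →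
      x ≤ 1 - δ → |f a x| ≤ C := by
  constructor
  · intro h δ hδ
    obtain ⟨C, hC⟩ := h δ hδ
    exact ⟨C, fun a ha x h1 h2 => hC (a, x) ⟨ha, h1, h2⟩⟩
  · intro h δ hδ
    obtain ⟨C, hC⟩ := h δ hδ
    exact ⟨C, fun p hp => hC p.1 hp.1 p.2 hp.2.1 hp.2.2⟩

theorem viscosity_mem_uniformClass (K : Set (Fin 3 → ℝ)) :
    (fun a _ => a.2) ∈ (uniformClass K).carrier :=
  mem_uniformClass.2 fun _ _ => ⟨1, fun a ha _ _ _ => by rw [abs_of_pos ha.2.1]; exact ha.2.2⟩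

/-- Families that do not depend on the viscosity. -/
theorem mem_uniformClass_of_contClass {K : Set (Fin 3 → ℝ)} (hK : IsCompact K)
    {S : Set (Fin 3 → ℝ)} (hKS : K ⊆ S) {f : (Fin 3 → ℝ) → ℝ → ℝ}
    (hf : f ∈ (contClass S).carrier) : (fun a x => f a.1 x) ∈ (uniformClass K).carrier := by
  refine mem_uniformClass.2 fun δ hδ => ?_
  have hc : ContinuousOn (fun p : (Fin 3 → ℝ) × ℝ => f p.1 p.2) (K ×ˢ Icc (-1 + δ) (1 - δ)) :=
    ContinuousOn.mono hf (prod_mono hKS fun x hx => ⟨by linarith [hx.1], by linarith [hx.2]⟩)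
  obtain ⟨C, hC⟩ := (hK.prod isCompact_Icc).exists_bound_of_continuousOn hc
  exact ⟨C, fun a ha x h1 h2 => hC (a.1, x) ⟨ha.1, h1, h2⟩⟩

theorem Tower.uniformClass_of_contClass {K : Set (Fin 3 → ℝ)} (hK : IsCompact K)
    {S : Set (Fin 3 → ℝ)} (hKS : K ⊆ S) {f : (Fin 3 → ℝ) → ℝ → ℝ} {k : ℕ}
    (hf : Tower (contClass S) k f) : Tower (uniformClass K) k (fun a x => f a.1 x) :=
  (hf.pullback (ℬ := uniformClass K) (φ := Prod.fst) (σ := 1) (Or.inl rfl) (fun a ha => hKS ha.1)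
    fun f hf => by simpa using mem_uniformClass_of_contClass hK hKS hf).congr
    fun _ _ _ _ => by simp

theorem var_mem_uniformClass (K : Set (Fin 3 → ℝ)) :
    (fun _ x => x) ∈ (uniformClass K).carrier :=
  mem_uniformClass.2 fun δ hδ => ⟨1, fun _ _ x h1 h2 => abs_le.2 ⟨by linarith, by linarith⟩⟩

/-- The uniform regularity of solutions of stiff linear equations `ν y' = -A y + h`. -/
theorem Tower.of_stiff_linear {K : Set (Fin 3 → ℝ)} {A : (Fin 3 → ℝ) × ℝ → ℝ → ℝ}
    (hA₀ : ∀ δ, 0 < δ → ∃ A₀ > 0, ∀ a ∈ inviscidSet K, ∀ x, -1 + δ ≤ x → x ≤ 1 - δ → A₀ ≤ A a x)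
    (k : ℕ) : ∀ {y y' h : (Fin 3 → ℝ) × ℝ → ℝ → ℝ},
    (∀ a ∈ inviscidSet K, ∀ x ∈ Ioo (-1 : ℝ) 1, HasDerivAt (y a) (y' a x) x) →
    (∀ a ∈ inviscidSet K, ∀ x ∈ Ioo (-1 : ℝ) 1, a.2 * y' a x = -(A a x * y a x) + h a x) →
    Tower (uniformClass K) k A → Tower (uniformClass K) k h →
    (fun a x => a.2 * y a x) ∈ (uniformClass K).carrier → Tower (uniformClass K) k y := by
  have base : ∀ {y y' h : (Fin 3 → ℝ) × ℝ → ℝ → ℝ},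
      (∀ a ∈ inviscidSet K, ∀ x ∈ Ioo (-1 : ℝ) 1, HasDerivAt (y a) (y' a x) x) →
      (∀ a ∈ inviscidSet K, ∀ x ∈ Ioo (-1 : ℝ) 1, a.2 * y' a x = -(A a x * y a x) + h a x) →
      h ∈ (uniformClass K).carrier →
      (fun a x => a.2 * y a x) ∈ (uniformClass K).carrier → y ∈ (uniformClass K).carrier := by
    intro y y' h hy heq hh hyν
    refine mem_uniformClass.2 fun δ hδ => ?_
    have hδ2 : 0 < δ / 2 := by linarith
    obtain ⟨A₀, hA₀pos, hA⟩ := hA₀ (δ / 2) hδ2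
    obtain ⟨H, hH⟩ := mem_uniformClass.1 hh (δ / 2) hδ2
    obtain ⟨Y, hY⟩ := mem_uniformClass.1 hyν (δ / 2) hδ2
    refine ⟨(16 * (|Y| + 1) / A₀ ^ 2 + 8 * |H| / A₀ + 1) / (δ / 2) ^ 2, fun a ha x h1 h2 => ?_⟩
    have hI : ∀ t ∈ Icc (-1 + δ / 2) x, t ∈ Ioo (-1 : ℝ) 1 := fun t ht =>
      ⟨by linarith [ht.1], by linarith [ht.2]⟩
    have hle : ∀ t ∈ Icc (-1 + δ / 2) x, t ≤ 1 - δ / 2 := fun t ht => by linarith [ht.2]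
    have hmono : (16 * (|Y| + 1) / A₀ ^ 2 + 8 * |H| / A₀ + 1) / (x - (-1 + δ / 2)) ^ 2 ≤
        (16 * (|Y| + 1) / A₀ ^ 2 + 8 * |H| / A₀ + 1) / (δ / 2) ^ 2 := by
      gcongr
      linarith
    have hb : ∀ t ∈ Icc (-1 + δ / 2) x, |h a t| ≤ |H| := fun t ht =>
      (hH a ha t ht.1 (hle t ht)).trans (le_abs_self H)
    have hb2 : ∀ t ∈ Icc (-1 + δ / 2) x, |a.2 * y a t| ≤ |Y| + 1 := fun t ht => by
      have := (hY a ha t ht.1 (hle t ht)).trans (le_abs_self Y)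
      linarith
    refine abs_le'.2 ⟨?_, ?_⟩
    · exact (stiff_linear_le ha.2.1 ha.2.2 hA₀pos (abs_nonneg H) (by positivity) (by linarith)
        (by linarith) (fun t ht => hy a ha t (hI t ht)) (fun t ht => heq a ha t (hI t ht))
        (fun t ht => hA a ha t ht.1 (hle t ht)) hb hb2).trans hmono
    · exact (stiff_linear_le (y := fun t => -y a t) (y' := fun t => -y' a t) (h := fun t => -h a t)
        ha.2.1 ha.2.2 hA₀pos (abs_nonneg H) (by positivity)
        (by linarith) (by linarith) (fun t ht => (hy a ha t (hI t ht)).neg)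
        (fun t ht => by linear_combination -heq a ha t (hI t ht))
        (fun t ht => hA a ha t ht.1 (hle t ht)) (fun t ht => by rw [abs_neg]; exact hb t ht)
        (fun t ht => by rw [mul_neg, abs_neg]; exact hb2 t ht)).trans hmono
  induction k with
  | zero =>
    intro y y' h hy heq _ hh hyν
    exact base hy heq hh hyν
  | succ k ih =>
    intro y y' h hy heq hA hh hyν
    have yk := ih hy heq hA.of_succ hh.of_succ hyν
    have dA := fun a (ha : a ∈ inviscidSet K) x hx => hA.hasDerivAt_deriv ha (x := x) hx
    have dh := fun a (ha : a ∈ inviscidSet K) x hx => hh.hasDerivAt_deriv ha (x := x) hx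
    refine ⟨yk.mem, y', hy, ?_⟩
    -- The derivative y' solves ν y'' = -A y' + (h' - A' y), with the same damping; its a priori
    -- bound is the equation itself, ν y' = -A y + h.
    refine ih (y' := fun a x => a.2⁻¹ * (-(deriv (A a) x * y a x + A a x * y' a x) + deriv (h a) x))
      (h := fun a x => deriv (h a) x - deriv (A a) x * y a x) (fun a ha x hx => ?_)
      (fun a ha x hx => ?_) hA.of_succ (hh.tower_deriv.sub (hA.tower_deriv.mul yk)) ?_
    · have d := ((((dA a ha x hx).mul (hy a ha x hx)).neg).add (dh a ha x hx)).const_mul a.2⁻¹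
      refine d.congr_of_eventuallyEq (eventuallyEq_of_eqOn (fun t ht => ?_) hx)
      have := heq a ha t ht
      have hν := ha.2.1.ne'
      simp only [Pi.add_apply, Pi.neg_apply, Pi.mul_apply]
      rw [← this]
      field_simp
    · have hν := ha.2.1.ne'
      field_simp
      ring
    · exact (uniformClass K).congr_mem (((hA.of_succ.mul yk).neg.add hh.of_succ).mem)
        fun a ha x hx => (heq a ha x hx).symm

/-- The maximal solution stays above the solution `2 ν / (1 + x)` with zero right-hand side. -/
theorem le_gPlus {a : (Fin 3 → ℝ) × ℝ} (hc : a.1 ∈ interior (paramJ 0)) (hν : 0 < a.2) {x : ℝ}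
    (hx : x ∈ Ioo (-1 : ℝ) 1) : 2 * a.2 / (1 + x) ≤ gPlus a x := by
  have ha : a ∈ goodParams := mem_goodParams hc hν
  have hp := hyperParam_mem ha
  have hρ : 1 < (hyperParam a).1 := by
    have : 0 < a.1 0 := by simpa using (interior_paramJ_lt hc).1
    have h1 : 1 < Real.sqrt (1 + a.1 0 / a.2 ^ 2) := by
      rw [Real.lt_sqrt zero_le_one]
      have : 0 < a.1 0 / a.2 ^ 2 := by positivity
      linarith
    simp only [hyperParam]
    linarith
  have hρ₂ : 0 < (hyperParam a).2.1 := by linarith [hp.2.1]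
  -- The comparison starts at -1 + η. There the excess (ρ₁ - 1)/η of the singular term over 1/(1 +
  -- x) is at least ρ₂, hence at least ρ₂/(1 - x); the last entry keeps the starting point to the
  -- left of `x`.
  set η := min (min 1 (((hyperParam a).1 - 1) / (hyperParam a).2.1)) ((1 + x) / 2) with hη
  have hη0 : 0 < η := lt_min (lt_min one_pos (div_pos (by linarith) hρ₂)) (by linarith [hx.1])
  have hη1 : η ≤ 1 := (min_le_left _ _).trans (min_le_left _ _)
  have hη2 : η * (hyperParam a).2.1 ≤ (hyperParam a).1 - 1 := by
    rw [← le_div_iff₀ hρ₂]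
    exact (min_le_left _ _).trans (min_le_right _ _)
  have hη3 : η ≤ (1 + x) / 2 := min_le_right _ _
  have hI : ∀ t ∈ Icc (-1 + η) x, t ∈ Ioo (-1 : ℝ) 1 := fun t ht =>
    ⟨by linarith [ht.1], ht.2.trans_lt hx.2⟩
  have dh : ∀ t ∈ Icc (-1 + η) x, HasDerivAt (fun t => 2 * a.2 / (1 + t))
      (-(2 * a.2) / (1 + t) ^ 2) t := fun t ht => by
    refine ((hasDerivAt_const t (2 * a.2)).div ((hasDerivAt_id t).const_add 1)
      (by have := (hI t ht).1; simp only [id]; linarith)).congr_deriv ?_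
    simp
  have dg := fun t ht => hasDerivAt_gPlus ha (hI t ht)
  refine image_le_of_deriv_right_lt_deriv_boundary'
    (fun t ht => (dh t ht).continuousAt.continuousWithinAt)
    (fun t ht => (dh t (Ico_subset_Icc_self ht)).hasDerivWithinAt) ?_
    (fun t ht => (dg t ht).continuousAt.continuousWithinAt)
    (fun t ht => (dg t (Ico_subset_Icc_self ht)).hasDerivWithinAt) (fun t ht h => ?_)
    (right_mem_Icc.2 (by linarith))
  · have hm : -1 + η ∈ Ioo (-1 : ℝ) 1 := hI _ (left_mem_Icc.2 (by linarith))
    have hF := hyperF_half_pos ha hm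
    have hF₁ := hyperF₁_nonneg hp (z := (1 + (-1 + η)) / 2) (by linarith)
    have hq := div_nonneg hF₁ hF.le
    rw [gPlus, div_eq_mul_one_div (2 * a.2)]
    refine mul_le_mul_of_nonneg_left ?_ (by linarith)
    have e1 : 1 + (-1 + η) = η := by ring
    have e2 : 1 - (-1 + η) = 2 - η := by ring
    rw [e1] at hq ⊢
    rw [e2]
    have h2 : (hyperParam a).2.1 / (2 - η) ≤ (hyperParam a).2.1 := div_le_self hρ₂.le (by linarith)
    have h3 : (hyperParam a).2.1 ≤ ((hyperParam a).1 - 1) / η := by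
      rw [le_div_iff₀ hη0]
      linarith
    have h4 : ((hyperParam a).1 - 1) / η = (hyperParam a).1 / η - 1 / η := by ring
    linarith
  -- The function h = 2ν/(1 + t) satisfies ν h' + h²/2 = 0, and P_c > 0 makes the comparison strict.
  · have ht' := hI t (Ico_subset_Icc_self ht)
    have h1 : 0 < 1 + t := by linarith [ht'.1]
    have h2 := polyP_pos hc ht'
    have h3 := one_sub_sq_pos ht'
    rw [riccatiRhs, ← h]
    have h4 : 0 < a.2⁻¹ * (polyP a.1 t * ((1 - t ^ 2)⁻¹) ^ 2) := by positivity
    have h5 : a.2⁻¹ * (polyP a.1 t * ((1 - t ^ 2)⁻¹) ^ 2 - 1 / 2 * (2 * a.2 / (1 + t)) ^ 2) =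
        a.2⁻¹ * (polyP a.1 t * ((1 - t ^ 2)⁻¹) ^ 2) + -(2 * a.2) / (1 + t) ^ 2 := by
      field_simp
      ring
    rw [h5]
    linarith

/-- The reciprocal of the positive profile is jointly continuous, hence bounded on compact sets. -/
theorem exists_lower_bound_eulerProfile {K : Set (Fin 3 → ℝ)} (hK : IsCompact K)
    (hKJ : K ⊆ interior (paramJ 0)) {δ : ℝ} (hδ : 0 < δ) : ∃ v > 0, ∀ a ∈ inviscidSet K, ∀ x,
      -1 + δ ≤ x → x ≤ 1 - δ → v ≤ eulerProfile a.1 x := by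
  have h := mem_uniformClass_of_contClass hK hKJ (inv_mem_contClass (tower_eulerProfile 0)
    fun c hc x hx => (eulerProfile_pos hc hx).ne')
  obtain ⟨C, hC⟩ := mem_uniformClass.1 h δ hδ
  refine ⟨(|C| + 1)⁻¹, by positivity, fun a ha x h1 h2 => ?_⟩
  have hpos := eulerProfile_pos (hKJ ha.1) (x := x) ⟨by linarith, by linarith⟩
  have := hC a ha x h1 h2
  rw [abs_of_pos (inv_pos.2 hpos)] at this
  rw [inv_le_comm₀ (by positivity) hpos]
  linarith [le_abs_self C]

/-- The quotient of `gPlus - eulerProfile` by the viscosity. -/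
def gPlusError (a : (Fin 3 → ℝ) × ℝ) (x : ℝ) : ℝ := a.2⁻¹ * (gPlus a x - eulerProfile a.1 x)

/-- Both conclusions come from one estimate |g - G| ≤ Cν. The second will serve as the damping
constant for the equations satisfied by the derivatives. -/
theorem gPlusError_bound_and_gPlus_lower {K : Set (Fin 3 → ℝ)} (hK : IsCompact K)
    (hKJ : K ⊆ interior (paramJ 0)) :
    gPlusError ∈ (uniformClass K).carrier ∧
    ∀ δ, 0 < δ → ∃ A₀ > 0, ∀ a ∈ inviscidSet K, ∀ x, -1 + δ ≤ x → x ≤ 1 - δ → A₀ ≤ gPlus a x := by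
  have tG : ∀ k, Tower (uniformClass K) k (fun a x => eulerProfile a.1 x) := fun k =>
    Tower.uniformClass_of_contClass hK hKJ (tower_eulerProfile k)
  have key : ∀ δ, 0 < δ → ∃ C > 0, ∀ a ∈ inviscidSet K, ∀ x, -1 + δ ≤ x → x ≤ 1 - δ →
      |gPlus a x - eulerProfile a.1 x| ≤ a.2 * C := by
    intro δ hδ
    -- Starting the barriers at -1 + δ/2 leaves a distance at least δ/2 for the attraction to act.
    have hδ2 : 0 < δ / 2 := by linarith
    obtain ⟨v, hv, hGv⟩ := exists_lower_bound_eulerProfile hK hKJ hδ2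
    obtain ⟨Γ, hΓ⟩ := mem_uniformClass.1 (tG 0).mem (δ / 2) hδ2
    obtain ⟨M, hM⟩ := mem_uniformClass.1 (tG 1).tower_deriv.mem (δ / 2) hδ2
    refine ⟨(2 / (δ / 2) + (|M| / v + 1)) +
      (4 * (|Γ| + 1) / v + 8 * |M| / v + 1) / (δ / 2), by positivity, fun a ha x h1 h2 => ?_⟩
    have hν := ha.2.1
    have hI : ∀ t ∈ Icc (-1 + δ / 2) x, t ∈ Ioo (-1 : ℝ) 1 := fun t ht =>
      ⟨by linarith [ht.1], by linarith [ht.2]⟩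
    have hle : ∀ t ∈ Icc (-1 + δ / 2) x, t ≤ 1 - δ / 2 := fun t ht => by linarith [ht.2]
    have hg := fun t ht => hasDerivAt_gPlus (mem_goodParams (hKJ ha.1) hν) (hI t ht)
    have hG := fun t ht => (tG 1).hasDerivAt_deriv ha (hI t ht)
    have heq : ∀ t ∈ Icc (-1 + δ / 2) x, a.2 * riccatiRhs gPlus a t =
        1 / 2 * eulerProfile a.1 t ^ 2 - 1 / 2 * gPlus a t ^ 2 := fun t ht => by
      rw [eulerProfile_sq (hKJ ha.1) (hI t ht), riccatiRhs, mul_inv_cancel_left₀ hν.ne']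
    have hg0 : ∀ t ∈ Icc (-1 + δ / 2) x, 0 ≤ gPlus a t := fun t ht =>
      (div_nonneg (by linarith) (by linarith [(hI t ht).1])).trans (le_gPlus (hKJ ha.1) hν (hI t ht))
    have b1 := riccati_le hν hv (abs_nonneg M) (by linarith) hg hG heq
      (fun t ht => hGv a ha t ht.1 (hle t ht))
      (fun t ht => (hM a ha t ht.1 (hle t ht)).trans (le_abs_self M))
    have b2 := le_riccati hν hv (abs_nonneg M) (by positivity : 0 < |Γ| + 1) (by linarith)
      (by linarith) hg hG heq (fun t ht => hGv a ha t ht.1 (hle t ht))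
      (fun t ht => by
        have := (le_abs_self _).trans (hΓ a ha t ht.1 (hle t ht))
        linarith [le_abs_self Γ])
      (fun t ht => (hM a ha t ht.1 (hle t ht)).trans (le_abs_self M)) hg0
    have c1 : 2 / (x - (-1 + δ / 2)) + (|M| / v + 1) ≤ 2 / (δ / 2) + (|M| / v + 1) := by
      gcongr
      linarith
    have c2 : (4 * (|Γ| + 1) / v + 8 * |M| / v + 1) / (x - (-1 + δ / 2)) ≤
        (4 * (|Γ| + 1) / v + 8 * |M| / v + 1) / (δ / 2) := by
      gcongr
      linarith
    have c3 : 0 ≤ 2 / (δ / 2) + (|M| / v + 1) := by positivity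
    have c4 : 0 ≤ (4 * (|Γ| + 1) / v + 8 * |M| / v + 1) / (δ / 2) := by positivity
    refine abs_le'.2 ⟨?_, ?_⟩
    · refine b1.trans (mul_le_mul_of_nonneg_left ?_ hν.le)
      linarith
    · rw [neg_sub]
      refine b2.trans (mul_le_mul_of_nonneg_left ?_ hν.le)
      linarith
  refine ⟨mem_uniformClass.2 fun δ hδ => ?_, fun δ hδ => ?_⟩
  · obtain ⟨C, _, hC⟩ := key δ hδ
    refine ⟨C, fun a ha x h1 h2 => ?_⟩
    rw [gPlusError, abs_mul, abs_of_pos (inv_pos.2 ha.2.1), inv_mul_le_iff₀ ha.2.1]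
    exact hC a ha x h1 h2
  · obtain ⟨C, hC0, hC⟩ := key δ hδ
    obtain ⟨v, hv, hGv⟩ := exists_lower_bound_eulerProfile hK hKJ hδ
    refine ⟨v / (C + 1), by positivity, fun a ha x h1 h2 => ?_⟩
    have hx : x ∈ Ioo (-1 : ℝ) 1 := ⟨by linarith, by linarith⟩
    have b1 := (abs_le.1 (hC a ha x h1 h2)).1
    have b2 := hGv a ha x h1 h2
    -- The comparison function 2ν/(1 + x) is at least ν. This turns v ≤ g + Cν into v ≤ (1 + C) g,
    -- with no smallness of ν.
    have b3 : a.2 ≤ gPlus a x := by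
      refine le_trans ?_ (le_gPlus (hKJ ha.1) ha.2.1 hx)
      rw [le_div_iff₀ (by linarith [hx.1])]
      nlinarith [ha.2.1, hx.2]
    have b4 : a.2 * C ≤ gPlus a x * C := by gcongr
    rw [div_le_iff₀ (by positivity)]
    linarith

/-- The uniform `O(ν)` estimate, with all derivatives, between `gPlus` and the Euler profile. -/
theorem tower_gPlusError {K : Set (Fin 3 → ℝ)} (hK : IsCompact K)
    (hKJ : K ⊆ interior (paramJ 0)) (k : ℕ) : Tower (uniformClass K) k gPlusError := by
  obtain ⟨hbase, hA₀⟩ := gPlusError_bound_and_gPlus_lower hK hKJ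
  have tG : ∀ k, Tower (uniformClass K) k (fun a x => eulerProfile a.1 x) := fun k =>
    Tower.uniformClass_of_contClass hK hKJ (tower_eulerProfile k)
  have tν : ∀ k, Tower (uniformClass K) k (fun a _ => a.2) := fun k =>
    Tower.of_param (viscosity_mem_uniformClass K) k
  set G₁ : (Fin 3 → ℝ) × ℝ → ℝ → ℝ := fun a => deriv (fun x => eulerProfile a.1 x) with hG₁
  have tG₁ : ∀ k, Tower (uniformClass K) k G₁ := fun k => (tG (k + 1)).tower_deriv
  set G₂ : (Fin 3 → ℝ) × ℝ → ℝ → ℝ := fun a => deriv (G₁ a) with hG₂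
  have tG₂ : ∀ k, Tower (uniformClass K) k G₂ := fun k => (tG₁ (k + 1)).tower_deriv
  have dG : ∀ a ∈ inviscidSet K, ∀ x ∈ Ioo (-1 : ℝ) 1,
      HasDerivAt (fun x => eulerProfile a.1 x) (G₁ a x) x := fun a ha x hx =>
    (tG 1).hasDerivAt_deriv ha hx
  have dG₁ : ∀ a ∈ inviscidSet K, ∀ x ∈ Ioo (-1 : ℝ) 1, HasDerivAt (G₁ a) (G₂ a x) x :=
    fun a ha x hx => (tG₁ 1).hasDerivAt_deriv ha hx
  have eg : ∀ a ∈ inviscidSet K, ∀ x, gPlus a x = eulerProfile a.1 x + a.2 * gPlusError a x :=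
    fun a ha x => by
      rw [gPlusError, mul_inv_cancel_left₀ ha.2.1.ne']
      ring
  -- Inserting g = G + νE in the Riccati equation gives ν E' = -νE²/2 - G E - G'.
  set E₁ : (Fin 3 → ℝ) × ℝ → ℝ → ℝ := fun a x => a.2⁻¹ * (-(1 / 2 * (a.2 * gPlusError a x ^ 2)) -
    eulerProfile a.1 x * gPlusError a x - G₁ a x) with hE₁
  have dE : ∀ a ∈ inviscidSet K, ∀ x ∈ Ioo (-1 : ℝ) 1, HasDerivAt (gPlusError a) (E₁ a x) x := by
    intro a ha x hx
    have d := ((hasDerivAt_gPlus (mem_goodParams (hKJ ha.1) ha.2.1) hx).sub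
      (dG a ha x hx)).const_mul a.2⁻¹
    refine d.congr_deriv ?_
    have e1 : riccatiRhs gPlus (a.1, a.2) x = a.2⁻¹ * (1 / 2 * eulerProfile a.1 x ^ 2 -
        1 / 2 * gPlus a x ^ 2) := by
      rw [eulerProfile_sq (hKJ ha.1) hx, riccatiRhs]
    have hν := ha.2.1.ne'
    rw [e1, eg a ha x, hE₁]
    field_simp
    ring
  induction k with
  | zero => exact hbase
  | succ k ih =>
    have t1 : Tower (uniformClass K) k (fun a x => -(1 / 2 * (a.2 * gPlusError a x ^ 2)) -
        eulerProfile a.1 x * gPlusError a x - G₁ a x) :=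
      ((((tν k).mul ih.sq).const_mul (1 / 2)).neg.sub ((tG k).mul ih)).sub (tG₁ k)
    -- Differentiating once more, ν E₁' = -g E₁ - G' E - G'': the quadratic term and G combine into
    -- the damping g = G + νE, and the source involves only E.
    refine ⟨hbase, E₁, dE, Tower.of_stiff_linear hA₀ k (y := E₁)
      (y' := fun a x => a.2⁻¹ * (-(1 / 2 * (a.2 * (2 * gPlusError a x * E₁ a x))) -
        (G₁ a x * gPlusError a x + eulerProfile a.1 x * E₁ a x) - G₂ a x))
      (h := fun a x => -(G₁ a x * gPlusError a x) - G₂ a x) (fun a ha x hx => ?_)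
      (fun a ha x hx => ?_) ?_ (((tG₁ k).mul ih).neg.sub (tG₂ k)) ?_⟩
    · refine ((((((dE a ha x hx).pow 2).const_mul a.2).const_mul (1 / 2)).neg.sub
        ((dG a ha x hx).mul (dE a ha x hx))).sub (dG₁ a ha x hx)).const_mul a.2⁻¹
        |>.congr_deriv ?_
      simp only [Nat.cast_ofNat, Nat.reduceSub, pow_one]
    · rw [eg a ha x, mul_inv_cancel_left₀ ha.2.1.ne']
      ring
    · exact ((tG k).add ((tν k).mul ih)).congr fun a ha x _ => (eg a ha x).symm
    · exact (uniformClass K).congr_mem t1.mem fun a ha x _ => by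
        rw [hE₁]
        exact (mul_inv_cancel_left₀ ha.2.1.ne' _).symm

/-! ### The minimal solution -/

/-- The exchange of the two poles, for the parameter `c`. -/
def swapC (c : Fin 3 → ℝ) : Fin 3 → ℝ := ![c 1, c 0, c 2]

theorem continuous_swapC : Continuous swapC := by
  refine continuous_pi fun i => ?_
  fin_cases i
  · exact continuous_apply 1
  · exact continuous_apply 0
  · change Continuous fun c : Fin 3 → ℝ => c 2
    fun_prop

theorem swapC_swapC (c : Fin 3 → ℝ) : swapC (swapC c) = c := by
  ext i
  fin_cases i <;> rfl

theorem swapC_mem_paramJ {ν : ℝ} {c : Fin 3 → ℝ} (hc : c ∈ paramJ ν) : swapC c ∈ paramJ ν := by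
  obtain ⟨h1, h2, h3⟩ := hc
  refine ⟨h2, h1, ?_⟩
  rw [c3bar_comm] at h3
  exact h3

theorem swapC_mem_interior {ν : ℝ} {c : Fin 3 → ℝ} (hc : c ∈ interior (paramJ ν)) :
    swapC c ∈ interior (paramJ ν) := by
  have h : swapC ⁻¹' interior (paramJ ν) ⊆ paramJ ν := fun d hd => by
    rw [← swapC_swapC d]
    exact swapC_mem_paramJ (interior_subset hd)
  have h2 : swapC ⁻¹' interior (paramJ ν) ⊆ interior (paramJ ν) :=
    interior_maximal h (isOpen_interior.preimage continuous_swapC)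
  exact h2 (by rwa [mem_preimage, swapC_swapC])

theorem eulerProfile_swapC (c : Fin 3 → ℝ) (x : ℝ) :
    eulerProfile (swapC c) (-x) = eulerProfile c x := by
  have : polyP (swapC c) (-x) = polyP c x := polyP_swapParam (c, 0) x
  rw [eulerProfile, eulerProfile, this, neg_sq]

section Inviscid

variable {K : Set (Fin 3 → ℝ)}

theorem mem_uniformClass_swap {f : (Fin 3 → ℝ) × ℝ → ℝ → ℝ}
    (hf : f ∈ (uniformClass (swapC '' K)).carrier) :
    (fun a x => f (swapParam a) (-1 * x)) ∈ (uniformClass K).carrier := by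
  refine mem_uniformClass.2 fun δ hδ => ?_
  obtain ⟨C, hC⟩ := mem_uniformClass.1 hf δ hδ
  exact ⟨C, fun a ha x h1 h2 => hC (swapParam a) ⟨mem_image_of_mem swapC ha.1, ha.2⟩ _
    (by linarith) (by linarith)⟩

/-- The quotient of `gMinus + eulerProfile` by the viscosity. -/
def gMinusError (a : (Fin 3 → ℝ) × ℝ) (x : ℝ) : ℝ := a.2⁻¹ * (gMinus a x + eulerProfile a.1 x)

theorem tower_gMinusError (hK : IsCompact K) (hKJ : K ⊆ interior (paramJ 0)) (k : ℕ) :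
    Tower (uniformClass K) k gMinusError := by
  have hK' : IsCompact (swapC '' K) := hK.image continuous_swapC
  have hKJ' : swapC '' K ⊆ interior (paramJ 0) := by
    rintro _ ⟨c, hc, rfl⟩
    exact swapC_mem_interior (hKJ hc)
  refine ((tower_gPlusError hK' hKJ' k).pullback (ℬ := uniformClass K) (φ := swapParam) (σ := -1)
    (Or.inr rfl) (fun a ha => (⟨mem_image_of_mem swapC ha.1, ha.2⟩ :
      swapParam a ∈ inviscidSet (swapC '' K)))
    fun f hf => mem_uniformClass_swap hf).neg.congr fun a ha x _ => ?_
  have h := eulerProfile_swapC a.1 x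
  have h2 : (swapParam a).1 = swapC a.1 := rfl
  have h3 : (swapParam a).2 = a.2 := rfl
  rw [gMinusError, gPlusError, gMinus, neg_one_mul, h2, h, h3]
  ring

theorem tower_viscosity (K : Set (Fin 3 → ℝ)) (k : ℕ) : Tower (uniformClass K) k (fun a _ => a.2) :=
  Tower.of_param (viscosity_mem_uniformClass K) k

theorem tower_eulerProfile_uniform (hK : IsCompact K) (hKJ : K ⊆ interior (paramJ 0)) (k : ℕ) :
    Tower (uniformClass K) k (fun a x => eulerProfile a.1 x) :=
  Tower.uniformClass_of_contClass hK hKJ (tower_eulerProfile k)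

theorem tower_gPlus_uniform (hK : IsCompact K) (hKJ : K ⊆ interior (paramJ 0)) (k : ℕ) :
    Tower (uniformClass K) k gPlus :=
  (((tower_viscosity K k).mul (tower_gPlusError hK hKJ k)).add
    (tower_eulerProfile_uniform hK hKJ k)).congr fun a ha x _ => by
      rw [gPlusError, mul_inv_cancel_left₀ ha.2.1.ne']
      ring

theorem tower_gMinus_uniform (hK : IsCompact K) (hKJ : K ⊆ interior (paramJ 0)) (k : ℕ) :
    Tower (uniformClass K) k gMinus :=
  (((tower_viscosity K k).mul (tower_gMinusError hK hKJ k)).sub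
    (tower_eulerProfile_uniform hK hKJ k)).congr fun a ha x _ => by
      rw [gMinusError, mul_inv_cancel_left₀ ha.2.1.ne']
      ring

/-- Both `gPlus` and, by reflection, `-gMinus` are bounded below by positive constants independent
of ν. -/
theorem exists_gap (hK : IsCompact K) (hKJ : K ⊆ interior (paramJ 0)) {δ : ℝ} (hδ : 0 < δ) :
    ∃ A₀ > 0, ∀ a ∈ inviscidSet K, ∀ x, -1 + δ ≤ x → x ≤ 1 - δ →
      2 * A₀ ≤ gPlus a x - gMinus a x := by
  have hK' : IsCompact (swapC '' K) := hK.image continuous_swapC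
  have hKJ' : swapC '' K ⊆ interior (paramJ 0) := by
    rintro _ ⟨c, hc, rfl⟩
    exact swapC_mem_interior (hKJ hc)
  obtain ⟨A, hA, h1⟩ := (gPlusError_bound_and_gPlus_lower hK hKJ).2 δ hδ
  obtain ⟨B, hB, h2⟩ := (gPlusError_bound_and_gPlus_lower hK' hKJ').2 δ hδ
  refine ⟨min A B, lt_min hA hB, fun a ha x hx1 hx2 => ?_⟩
  have e1 := h1 a ha x hx1 hx2
  have e2 := h2 (swapParam a) ⟨mem_image_of_mem swapC ha.1, ha.2⟩ (-x) (by linarith) (by linarith)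
  have := min_le_left A B
  have := min_le_right A B
  rw [gMinus]
  linarith

end Inviscid

/-! ### The transition between the two extremal solutions -/

/-- The quotient of the two positive solutions of the linearized Riccati equation. -/
def ratio (a : (Fin 3 → ℝ) × ℝ) (x : ℝ) : ℝ :=
  hyperF (hyperParam (swapParam a)) ((1 + -1 * x) / 2) / hyperF (hyperParam a) ((1 + x) / 2)

theorem ratio_pos {a : (Fin 3 → ℝ) × ℝ} (ha : a ∈ goodParams) {x : ℝ} (hx : x ∈ Ioo (-1 : ℝ) 1) :
    0 < ratio a x := by
  refine div_pos (hyperF_half_pos (swapParam_mem ha) ?_) (hyperF_half_pos ha hx)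
  rw [neg_one_mul]
  exact neg_mem_Ioo hx

/-- The singular parts at the poles cancel, because the reflection exchanges the exponents ρ₁ and
ρ₂. -/
theorem gMinus_sub_gPlus {a : (Fin 3 → ℝ) × ℝ} (x : ℝ) :
    gMinus a x - gPlus a x = -(a.2 * (hyperF₁ (hyperParam (swapParam a)) ((1 + -1 * x) / 2) /
      hyperF (hyperParam (swapParam a)) ((1 + -1 * x) / 2) +
      hyperF₁ (hyperParam a) ((1 + x) / 2) / hyperF (hyperParam a) ((1 + x) / 2))) := by
  have h1 : (hyperParam (swapParam a)).1 = (hyperParam a).2.1 := rfl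
  have h2 : (hyperParam (swapParam a)).2.1 = (hyperParam a).1 := rfl
  have h3 : (swapParam a).2 = a.2 := rfl
  rw [gMinus, gPlus, gPlus, h1, h2, h3, neg_one_mul]
  ring

theorem gMinus_le_gPlus {a : (Fin 3 → ℝ) × ℝ} (ha : a ∈ goodParams) {x : ℝ}
    (hx : x ∈ Ioo (-1 : ℝ) 1) : gMinus a x - gPlus a x ≤ 0 := by
  have hx' : -1 * x ∈ Ioo (-1 : ℝ) 1 := by
    rw [neg_one_mul]
    exact neg_mem_Ioo hx
  have h1 := div_nonneg (hyperF₁_nonneg (hyperParam_mem ha) (z := (1 + x) / 2)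
    (by linarith [hx.1])) (hyperF_half_pos ha hx).le
  have h2 := div_nonneg (hyperF₁_nonneg (hyperParam_mem (swapParam_mem ha))
    (z := (1 + -1 * x) / 2) (by linarith [hx.2])) (hyperF_half_pos (swapParam_mem ha) hx').le
  rw [gMinus_sub_gPlus, neg_nonpos]
  exact mul_nonneg ha.1.le (add_nonneg h2 h1)

/-- The logarithmic derivative of a quotient of two solutions φ is the difference of their
logarithmic derivatives g/(2ν). -/
theorem hasDerivAt_ratio {a : (Fin 3 → ℝ) × ℝ} (ha : a ∈ goodParams) {x : ℝ}
    (hx : x ∈ Ioo (-1 : ℝ) 1) :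
    HasDerivAt (ratio a) (ratio a x * ((gMinus a x - gPlus a x) / (2 * a.2))) x := by
  have hx' : -1 * x ∈ Ioo (-1 : ℝ) 1 := by
    rw [neg_one_mul]
    exact neg_mem_Ioo hx
  have hF := hyperF_half_pos ha hx
  have hF' := hyperF_half_pos (swapParam_mem ha) hx'
  have d1 := (hasDerivAt_hyperF (hyperParam_mem ha) (abs_half_lt hx)).comp x (hasDerivAt_half x)
  have d2 := (hasDerivAt_hyperF (hyperParam_mem (swapParam_mem ha)) (abs_half_lt hx')).comp x
    ((((hasDerivAt_id x).const_mul (-1)).const_add 1).div_const 2)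
  refine (d2.div d1 hF.ne').congr_deriv ?_
  have hν := ha.1.ne'
  rw [gMinus_sub_gPlus, ratio]
  simp only [Function.comp_apply, id]
  generalize hyperF (hyperParam (swapParam a)) ((1 + -1 * x) / 2) = F' at *
  generalize hyperF (hyperParam a) ((1 + x) / 2) = F at *
  field_simp
  ring

theorem ratio_antitone {a : (Fin 3 → ℝ) × ℝ} (ha : a ∈ goodParams) {x y : ℝ}
    (hx : x ∈ Ioo (-1 : ℝ) 1) (hy : y ∈ Ioo (-1 : ℝ) 1) (hxy : x ≤ y) : ratio a y ≤ ratio a x := by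
  have hanti : AntitoneOn (ratio a) (Ioo (-1) 1) := by
    refine antitoneOn_of_deriv_nonpos (convex_Ioo _ _)
      (fun t ht => (hasDerivAt_ratio ha ht).continuousAt.continuousWithinAt)
      (fun t ht => ?_) fun t ht => ?_
    · rw [interior_Ioo] at ht
      exact (hasDerivAt_ratio ha ht).differentiableAt.differentiableWithinAt
    · rw [interior_Ioo] at ht
      rw [(hasDerivAt_ratio ha ht).deriv]
      exact mul_nonpos_of_nonneg_of_nonpos (ratio_pos ha ht).le
        (div_nonpos_of_nonpos_of_nonneg (gMinus_le_gPlus ha ht) (by linarith [ha.1]))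
  exact hanti hx hy hxy

/-- The gap makes `ratio · exp(A₀ t / ν)` nonincreasing on the interval. -/
theorem ratio_decay {a : (Fin 3 → ℝ) × ℝ} (ha : a ∈ goodParams) {x y A₀ : ℝ}
    (hx : x ∈ Ioo (-1 : ℝ) 1) (hy : y ∈ Ioo (-1 : ℝ) 1) (hxy : x ≤ y)
    (hA₀ : ∀ t ∈ Icc x y, 2 * A₀ ≤ gPlus a t - gMinus a t) :
    ratio a y ≤ ratio a x * Real.exp (-(A₀ * (y - x) / a.2)) := by
  have hν := ha.1
  have hsub : Icc x y ⊆ Ioo (-1) 1 := fun t ht => ⟨hx.1.trans_le ht.1, ht.2.trans_lt hy.2⟩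
  have d : ∀ t ∈ Icc x y, HasDerivAt (fun t => ratio a t * Real.exp (A₀ / a.2 * t))
      (ratio a t * ((gMinus a t - gPlus a t) / (2 * a.2)) * Real.exp (A₀ / a.2 * t) +
        ratio a t * (Real.exp (A₀ / a.2 * t) * (A₀ / a.2 * 1))) t := fun t ht =>
    (hasDerivAt_ratio ha (hsub ht)).mul (((hasDerivAt_id t).const_mul (A₀ / a.2)).exp)
  have hanti : AntitoneOn (fun t => ratio a t * Real.exp (A₀ / a.2 * t)) (Icc x y) := by
    refine antitoneOn_of_deriv_nonpos (convex_Icc _ _)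
      (fun t ht => (d t ht).continuousAt.continuousWithinAt) (fun t ht => ?_) fun t ht => ?_
    · exact (d t (interior_subset ht)).differentiableAt.differentiableWithinAt
    · have ht' := interior_subset ht
      rw [(d t ht').deriv]
      have h1 := hA₀ t ht'
      have h2 := ratio_pos ha (hsub ht')
      have h3 := Real.exp_pos (A₀ / a.2 * t)
      have h4 : (gMinus a t - gPlus a t) / (2 * a.2) + A₀ / a.2 ≤ 0 := by
        have : (gMinus a t - gPlus a t) / (2 * a.2) + A₀ / a.2 =
            -(gPlus a t - gMinus a t - 2 * A₀) / (2 * a.2) := by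
          field_simp
          ring
        rw [this]
        exact div_nonpos_of_nonpos_of_nonneg (by linarith) (by linarith)
      have h5 := mul_nonpos_of_nonneg_of_nonpos (mul_pos h2 h3).le h4
      linarith
  have h := hanti (left_mem_Icc.2 hxy) (right_mem_Icc.2 hxy) hxy
  simp only at h
  rw [← mul_le_mul_iff_left₀ (Real.exp_pos (A₀ / a.2 * y))]
  refine h.trans_eq ?_
  rw [mul_assoc, ← Real.exp_add]
  congr 2
  field_simp
  ring

/-- Exponential smallness beats every power of 1/ν, since exp y ≥ y^N/N!. -/
theorem inv_pow_mul_exp_le {ν B : ℝ} (hν : 0 < ν) (hB : 0 < B) (N : ℕ) :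
    ν⁻¹ ^ N * Real.exp (-(B / ν)) ≤ N.factorial / B ^ N := by
  have h := Real.pow_div_factorial_le_exp (B / ν) (by positivity) N
  have hf : (0 : ℝ) < N.factorial := by exact_mod_cast N.factorial_pos
  rw [Real.exp_neg, ← div_eq_mul_inv, div_le_div_iff₀ (Real.exp_pos _) (by positivity)]
  rw [div_le_iff₀ hf, div_pow] at h
  rw [inv_pow]
  calc (ν ^ N)⁻¹ * B ^ N = B ^ N / ν ^ N := by ring
    _ ≤ _ := h
    _ = _ := mul_comm _ _

/-- The weight of the minimal solution in the solution with a transition at `cos θ₀`. -/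
def weight (b : ((Fin 3 → ℝ) × ℝ) × ℝ) (x : ℝ) : ℝ :=
  ratio b.1 x * (ratio b.1 (Real.cos b.2) + ratio b.1 x)⁻¹

/-- The solution of the Riccati equation with a transition at `cos θ₀`. -/
def gMatch (b : ((Fin 3 → ℝ) × ℝ) × ℝ) (x : ℝ) : ℝ :=
  gPlus b.1 x + (gMinus b.1 x - gPlus b.1 x) * weight b x

/-- The parameters `((c, ν), θ₀)`. -/
def goodParamsAngle : Set (((Fin 3 → ℝ) × ℝ) × ℝ) := goodParams ×ˢ Ioo 0 Real.pi

theorem cos_mem_Ioo {θ : ℝ} (hθ : θ ∈ Ioo 0 Real.pi) : Real.cos θ ∈ Ioo (-1 : ℝ) 1 := by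
  constructor
  · rw [← Real.cos_pi]
    exact Real.cos_lt_cos_of_nonneg_of_le_pi hθ.1.le le_rfl hθ.2
  · rw [← Real.cos_zero]
    exact Real.cos_lt_cos_of_nonneg_of_le_pi le_rfl hθ.2.le hθ.1

section Weight

variable {b : ((Fin 3 → ℝ) × ℝ) × ℝ} {x : ℝ}

theorem ratio_sum_pos (hb : b ∈ goodParamsAngle) (hx : x ∈ Ioo (-1 : ℝ) 1) :
    0 < ratio b.1 (Real.cos b.2) + ratio b.1 x :=
  add_pos (ratio_pos hb.1 (cos_mem_Ioo hb.2)) (ratio_pos hb.1 hx)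

/-- The weight R/(R₀ + R) is a logistic function of log R, hence satisfies a logistic equation. -/
theorem hasDerivAt_weight (hb : b ∈ goodParamsAngle) (hx : x ∈ Ioo (-1 : ℝ) 1) :
    HasDerivAt (weight b) (b.1.2⁻¹ * (1 / 2 * (weight b x * (1 - weight b x) *
      (gMinus b.1 x - gPlus b.1 x)))) x := by
  have h0 := (ratio_sum_pos hb hx).ne'
  have d := hasDerivAt_ratio hb.1 hx
  refine (d.mul ((d.const_add (ratio b.1 (Real.cos b.2))).inv h0)).congr_deriv ?_
  have hν := hb.1.1.ne'
  rw [weight]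
  simp only [Pi.inv_apply]
  field_simp
  ring

/-- `gMatch` is 2ν φ'/φ for the positive combination φ = R₀ φ₊ + φ₋, where R₀ is the value of φ₋/φ₊
at cos θ₀. -/
theorem hasDerivAt_gMatch (hb : b ∈ goodParamsAngle) (hx : x ∈ Ioo (-1 : ℝ) 1) :
    HasDerivAt (gMatch b) (b.1.2⁻¹ * (polyP b.1.1 x * ((1 - x ^ 2)⁻¹) ^ 2 -
      1 / 2 * gMatch b x ^ 2)) x := by
  have d1 := hasDerivAt_gPlus hb.1 hx
  have d2 := hasDerivAt_gMinus hb.1 hx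
  refine (d1.add ((d2.sub d1).mul (hasDerivAt_weight hb hx))).congr_deriv ?_
  rw [riccatiRhs, riccatiRhs, gMatch]
  simp only [Pi.sub_apply]
  ring

theorem weight_nonneg (hb : b ∈ goodParamsAngle) (hx : x ∈ Ioo (-1 : ℝ) 1) : 0 ≤ weight b x :=
  mul_nonneg (ratio_pos hb.1 hx).le (inv_nonneg.2 (ratio_sum_pos hb hx).le)

theorem one_sub_weight (hb : b ∈ goodParamsAngle) (hx : x ∈ Ioo (-1 : ℝ) 1) :
    1 - weight b x = ratio b.1 (Real.cos b.2) / (ratio b.1 (Real.cos b.2) + ratio b.1 x) := by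
  have h0 := (ratio_sum_pos hb hx).ne'
  rw [weight]
  field_simp
  ring

end Weight

theorem ratio_mem_contClass : ratio ∈ (contClass goodParams).carrier := by
  have h1 := mem_contClass_pullback (S := goodParams) (S' := goodParams) (φ := swapParam) (σ := -1)
    (Or.inr rfl) (fun _ ha => swapParam_mem ha) continuous_swapParam.continuousOn _
    continuousOn_hyperF_half.1
  have h2 := inv_mem_contClass continuousOn_hyperF_half.1
    fun a ha x hx => (hyperF_half_pos ha hx).ne'
  exact (contClass goodParams).congr_mem ((contClass goodParams).mul_mem h1 h2)
    fun a _ x _ => (div_eq_mul_inv _ _).symm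

theorem mem_contClass_angle {f : (Fin 3 → ℝ) × ℝ → ℝ → ℝ}
    (hf : f ∈ (contClass goodParams).carrier) :
    (fun b x => f b.1 x) ∈ (contClass goodParamsAngle).carrier := by
  have := mem_contClass_pullback (S := goodParams) (S' := goodParamsAngle) (φ := Prod.fst) (σ := 1)
    (Or.inl rfl) (fun b hb => hb.1) continuousOn_fst f hf
  simpa using this

theorem tower_angle {f : (Fin 3 → ℝ) × ℝ → ℝ → ℝ} {k : ℕ}
    (hf : Tower (contClass goodParams) k f) :
    Tower (contClass goodParamsAngle) k (fun b x => f b.1 x) :=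
  (hf.pullback (ℬ := contClass goodParamsAngle) (φ := Prod.fst) (σ := 1) (Or.inl rfl)
    (fun b hb => hb.1) fun f hf => by simpa using mem_contClass_angle hf).congr
    fun _ _ _ _ => by simp

theorem weight_mem_contClass : weight ∈ (contClass goodParamsAngle).carrier := by
  let 𝒞 := contClass goodParamsAngle
  have h1 : (fun b x => ratio b.1 x) ∈ 𝒞.carrier := mem_contClass_angle ratio_mem_contClass
  have h2 : (fun b _ => ratio b.1 (Real.cos b.2)) ∈ 𝒞.carrier := by
    refine continuousOn_mem_contClass_param ?_
    have hr := mem_contClass.1 ratio_mem_contClass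
    have hc : ContinuousOn (fun b : ((Fin 3 → ℝ) × ℝ) × ℝ => (b.1, Real.cos b.2))
        goodParamsAngle := Continuous.continuousOn (by fun_prop)
    exact hr.comp hc fun b hb => ⟨hb.1, cos_mem_Ioo hb.2⟩
  exact 𝒞.mul_mem h1 (inv_mem_contClass (𝒞.add_mem h2 h1)
    fun b hb x hx => (ratio_sum_pos hb hx).ne')

theorem tower_weight (k : ℕ) : Tower (contClass goodParamsAngle) k weight := by
  refine Tower.bootstrap weight_mem_contClass (fun b hb x hx => hasDerivAt_weight hb hx)
    (fun k hk => ?_) k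
  exact (tower_angle (Tower.of_param inv_viscosity_mem_contClass k)).mul
    (((hk.mul ((Tower.const 1 k).sub hk)).mul
      ((tower_angle (tower_gMinus k)).sub (tower_angle (tower_gPlus k)))).const_mul (1 / 2))

theorem tower_gMatch (k : ℕ) : Tower (contClass goodParamsAngle) k gMatch :=
  (tower_angle (tower_gPlus k)).add
    (((tower_angle (tower_gMinus k)).sub (tower_angle (tower_gPlus k))).mul (tower_weight k))

/-! ### Estimates away from the transition -/

/-- The parameters `((c, ν), θ₀)` with `c ∈ K`, `0 < ν ≤ 1`. -/
def inviscidSetAngle (K : Set (Fin 3 → ℝ)) : Set (((Fin 3 → ℝ) × ℝ) × ℝ) :=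
  inviscidSet K ×ˢ Ioo 0 Real.pi

/-- The families that are uniformly bounded on `[cos θ₀ + δ, 1 - δ]` for all `δ > 0`. -/
def upperClass (K : Set (Fin 3 → ℝ)) : FamilyClass (inviscidSetAngle K) :=
  bddClass (inviscidSetAngle K)
    (fun δ => {p | p.1 ∈ inviscidSetAngle K ∧ Real.cos p.1.2 + δ ≤ p.2 ∧ p.2 ≤ 1 - δ})
    fun _ _ p hp => ⟨hp.1, by linarith [hp.2.1, Real.neg_one_le_cos p.1.2], by linarith [hp.2.2]⟩

/-- The families that are uniformly bounded on `[-1 + δ, cos θ₀ - δ]` for all `δ > 0`. -/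
def lowerClass (K : Set (Fin 3 → ℝ)) : FamilyClass (inviscidSetAngle K) :=
  bddClass (inviscidSetAngle K)
    (fun δ => {p | p.1 ∈ inviscidSetAngle K ∧ -1 + δ ≤ p.2 ∧ p.2 ≤ Real.cos p.1.2 - δ})
    fun _ _ p hp => ⟨hp.1, by linarith [hp.2.1], by linarith [hp.2.2, Real.cos_le_one p.1.2]⟩

section Matched

variable {K : Set (Fin 3 → ℝ)}

theorem tower_upper {f : (Fin 3 → ℝ) × ℝ → ℝ → ℝ} {k : ℕ} (hf : Tower (uniformClass K) k f) :
    Tower (upperClass K) k (fun b x => f b.1 x) := by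
  refine (hf.pullback (ℬ := upperClass K) (φ := Prod.fst) (σ := 1) (Or.inl rfl)
    (fun b hb => hb.1) fun f hf => ?_).congr fun _ _ _ _ => by simp
  intro δ hδ
  obtain ⟨C, hC⟩ := mem_uniformClass.1 hf δ hδ
  refine ⟨C, fun p hp => ?_⟩
  simp only [one_mul]
  exact hC p.1.1 hp.1.1 p.2 (by linarith [hp.2.1, Real.neg_one_le_cos p.1.2]) hp.2.2

theorem tower_lower {f : (Fin 3 → ℝ) × ℝ → ℝ → ℝ} {k : ℕ} (hf : Tower (uniformClass K) k f) :
    Tower (lowerClass K) k (fun b x => f b.1 x) := by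
  refine (hf.pullback (ℬ := lowerClass K) (φ := Prod.fst) (σ := 1) (Or.inl rfl)
    (fun b hb => hb.1) fun f hf => ?_).congr fun _ _ _ _ => by simp
  intro δ hδ
  obtain ⟨C, hC⟩ := mem_uniformClass.1 hf δ hδ
  refine ⟨C, fun p hp => ?_⟩
  simp only [one_mul]
  exact hC p.1.1 hp.1.1 p.2 hp.2.1 (by linarith [hp.2.2, Real.cos_le_one p.1.2])

theorem mem_goodParamsAngle (hKJ : K ⊆ interior (paramJ 0)) {b : ((Fin 3 → ℝ) × ℝ) × ℝ}
    (hb : b ∈ inviscidSetAngle K) : b ∈ goodParamsAngle :=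
  ⟨mem_goodParams (hKJ hb.1.1) hb.1.2.1, hb.2⟩

theorem inv_pow_mul_weight_mem (hK : IsCompact K) (hKJ : K ⊆ interior (paramJ 0)) (N : ℕ) :
    (fun b x => b.1.2⁻¹ ^ N * weight b x) ∈ (upperClass K).carrier := by
  intro δ hδ
  obtain ⟨A₀, hA₀, hgap⟩ := exists_gap hK hKJ (half_pos hδ)
  refine ⟨N.factorial / (A₀ * (δ / 2)) ^ N, ?_⟩
  rintro ⟨b, x⟩ ⟨hb, h1, h2⟩
  simp only at hb h1 h2 ⊢
  have hg := mem_goodParamsAngle hKJ hb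
  have hν := hg.1.1
  have hx0 := cos_mem_Ioo hb.2
  have hx : x ∈ Ioo (-1 : ℝ) 1 := ⟨by linarith [hx0.1], by linarith⟩
  -- The decay is used only on [x - δ/2, x], which stays away from the poles; from cos θ₀ to x - δ/2
  -- monotonicity suffices. This makes the bound uniform in θ₀, even as θ₀ tends to a pole.
  have hx' : x - δ / 2 ∈ Ioo (-1 : ℝ) 1 := ⟨by linarith [hx0.1], by linarith⟩
  have hd := ratio_decay hg.1 hx' hx (by linarith) (A₀ := A₀) fun t ht =>
    hgap b.1 hb.1 t (by linarith [ht.1, hx0.1]) (by linarith [ht.2])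
  have hm := ratio_antitone hg.1 hx0 hx' (by linarith)
  have hr0 := ratio_pos hg.1 hx0
  have hr := ratio_pos hg.1 hx
  rw [show x - (x - δ / 2) = δ / 2 by ring] at hd
  have hw : weight b x ≤ Real.exp (-(A₀ * (δ / 2) / b.1.2)) := by
    rw [weight, ← div_eq_mul_inv, div_le_iff₀ (ratio_sum_pos hg hx)]
    have he := Real.exp_pos (-(A₀ * (δ / 2) / b.1.2))
    have h3 := mul_le_mul_of_nonneg_right hm he.le
    have h4 := mul_pos he hr
    linarith
  rw [abs_of_nonneg (mul_nonneg (by positivity) (weight_nonneg hg hx))]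
  exact (mul_le_mul_of_nonneg_left hw (by positivity)).trans
    (inv_pow_mul_exp_le hν (by positivity) N)

theorem inv_pow_mul_one_sub_weight_mem (hK : IsCompact K) (hKJ : K ⊆ interior (paramJ 0)) (N : ℕ) :
    (fun b x => b.1.2⁻¹ ^ N * (1 - weight b x)) ∈ (lowerClass K).carrier := by
  intro δ hδ
  obtain ⟨A₀, hA₀, hgap⟩ := exists_gap hK hKJ (half_pos hδ)
  refine ⟨N.factorial / (A₀ * (δ / 2)) ^ N, ?_⟩
  rintro ⟨b, x⟩ ⟨hb, h1, h2⟩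
  simp only at hb h1 h2 ⊢
  have hg := mem_goodParamsAngle hKJ hb
  have hν := hg.1.1
  have hx0 := cos_mem_Ioo hb.2
  have hx : x ∈ Ioo (-1 : ℝ) 1 := ⟨by linarith, by linarith [hx0.2]⟩
  have hx' : x + δ / 2 ∈ Ioo (-1 : ℝ) 1 := ⟨by linarith, by linarith [hx0.2]⟩
  have hd := ratio_decay hg.1 hx hx' (by linarith) (A₀ := A₀) fun t ht =>
    hgap b.1 hb.1 t (by linarith [ht.1]) (by linarith [ht.2, hx0.2])
  have hm := ratio_antitone hg.1 hx' hx0 (by linarith)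
  have hr0 := ratio_pos hg.1 hx0
  have hr := ratio_pos hg.1 hx
  rw [show x + δ / 2 - x = δ / 2 by ring] at hd
  have hw : 1 - weight b x ≤ Real.exp (-(A₀ * (δ / 2) / b.1.2)) := by
    rw [one_sub_weight hg hx, div_le_iff₀ (ratio_sum_pos hg hx)]
    have he := Real.exp_pos (-(A₀ * (δ / 2) / b.1.2))
    have h4 := mul_pos he hr0
    linarith
  have hw0 : 0 ≤ 1 - weight b x := by
    rw [one_sub_weight hg hx]
    exact div_nonneg hr0.le (ratio_sum_pos hg hx).le
  rw [abs_of_nonneg (mul_nonneg (by positivity) hw0)]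
  exact (mul_le_mul_of_nonneg_left hw (by positivity)).trans
    (inv_pow_mul_exp_le hν (by positivity) N)

/-- Exponentially small solutions of a logistic equation are small with all derivatives. -/
theorem tower_of_logistic {S : Set (((Fin 3 → ℝ) × ℝ) × ℝ)} {𝒜 : FamilyClass S}
    {w D : ((Fin 3 → ℝ) × ℝ) × ℝ → ℝ → ℝ} (hD : ∀ k, Tower 𝒜 k D)
    (hw : ∀ b ∈ S, ∀ x ∈ Ioo (-1 : ℝ) 1,
      HasDerivAt (w b) (b.1.2⁻¹ * (1 / 2 * (w b x * (1 - w b x) * D b x))) x)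
    (hsmall : ∀ N : ℕ, (fun b x => b.1.2⁻¹ ^ N * w b x) ∈ 𝒜.carrier) (k : ℕ) :
    ∀ N : ℕ, Tower 𝒜 k (fun b x => b.1.2⁻¹ ^ N * w b x) := by
  induction k with
  | zero => exact hsmall
  | succ k ih =>
    intro N
    have hw0 : Tower 𝒜 k w := (ih 0).congr fun _ _ _ _ => by simp
    refine ⟨hsmall N, _, fun b hb x hx => (hw b hb x hx).const_mul (b.1.2⁻¹ ^ N), ?_⟩
    -- Each derivative costs one factor 1/ν, so the induction has to carry all powers N at once.
    refine (((ih (N + 1)).mul (((Tower.const 1 k).sub hw0).mul (hD k))).const_mul (1 / 2)).congr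
      fun b _ x _ => ?_
    rw [pow_succ]
    ring

theorem tower_gMatch_upper (hK : IsCompact K) (hKJ : K ⊆ interior (paramJ 0)) (k : ℕ) :
    Tower (upperClass K) k (fun b x => b.1.2⁻¹ * (gMatch b x - eulerProfile b.1.1 x)) := by
  have hD : ∀ k, Tower (upperClass K) k (fun b x => gMinus b.1 x - gPlus b.1 x) := fun k =>
    tower_upper ((tower_gMinus_uniform hK hKJ k).sub (tower_gPlus_uniform hK hKJ k))
  have hw := tower_of_logistic hD
    (fun b hb x hx => hasDerivAt_weight (mem_goodParamsAngle hKJ hb) hx)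
    (inv_pow_mul_weight_mem hK hKJ) k 1
  refine ((tower_upper (tower_gPlusError hK hKJ k)).add ((hD k).mul hw)).congr fun b _ x _ => ?_
  rw [gPlusError, gMatch, pow_one]
  ring

/-- Here the small quantity is 1 - w, which solves the logistic equation with the sign of the gap
reversed; the solution is compared with `gMinus`. -/
theorem tower_gMatch_lower (hK : IsCompact K) (hKJ : K ⊆ interior (paramJ 0)) (k : ℕ) :
    Tower (lowerClass K) k (fun b x => b.1.2⁻¹ * (gMatch b x + eulerProfile b.1.1 x)) := by
  have hD : ∀ k, Tower (lowerClass K) k (fun b x => gPlus b.1 x - gMinus b.1 x) := fun k =>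
    tower_lower ((tower_gPlus_uniform hK hKJ k).sub (tower_gMinus_uniform hK hKJ k))
  have hw := tower_of_logistic (w := fun b x => 1 - weight b x) hD
    (fun b hb x hx => ((hasDerivAt_weight (mem_goodParamsAngle hKJ hb) hx).const_sub 1).congr_deriv
      (by ring)) (inv_pow_mul_one_sub_weight_mem hK hKJ) k 1
  refine ((tower_lower (tower_gMinusError hK hKJ k)).add ((hD k).mul hw)).congr fun b _ x _ => ?_
  rw [gMinusError, gMatch, pow_one]
  ring

end Matched

/-! ### From profiles to C^m norms on the sphere -/

/-- The part of the unit sphere at height between `-1 + δ` and `1 - δ`. -/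
def sphereZone (δ : ℝ) : Set E3 := {X | ‖X‖ = 1 ∧ -1 + δ ≤ height X ∧ height X ≤ 1 - δ}

theorem height_of_norm_eq_one {X : E3} (hX : ‖X‖ = 1) : height X = X 2 := by simp [height, hX]

theorem isCompact_sphereZone (δ : ℝ) : IsCompact (sphereZone δ) := by
  have h : sphereZone δ = Metric.sphere 0 1 ∩
      (fun X : E3 => (EuclideanSpace.proj 2 : E3 →L[ℝ] ℝ) X) ⁻¹' Icc (-1 + δ) (1 - δ) := by
    ext X
    simp only [sphereZone, mem_ofPred_eq, mem_inter_iff, mem_sphere_zero_iff_norm, mem_preimage,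
      mem_Icc, PiLp.proj_apply]
    constructor
    · rintro ⟨h1, h2⟩
      exact ⟨h1, by rwa [height_of_norm_eq_one h1] at h2⟩
    · rintro ⟨h1, h2⟩
      exact ⟨h1, by rwa [height_of_norm_eq_one h1]⟩
  rw [h]
  exact (isCompact_sphere 0 1).inter_right
    (isClosed_Icc.preimage (EuclideanSpace.proj 2 : E3 →L[ℝ] ℝ).continuous)

theorem mem_offAxis_of_abs_height_lt {X : E3} (hX : ‖X‖ = 1) (h : height X ∈ Ioo (-1 : ℝ) 1) :
    X ∈ offAxis := by
  have h1 := norm_sq_eq X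
  rw [hX] at h1
  rw [height_of_norm_eq_one hX] at h
  by_contra hc
  simp only [offAxis, mem_ofPred_eq, not_or, not_not] at hc
  rw [hc.1, hc.2] at h1
  nlinarith [one_sub_sq_pos h]

theorem sphereZone_subset_offAxis {δ : ℝ} (hδ : 0 < δ) : sphereZone δ ⊆ offAxis := fun X hX =>
  mem_offAxis_of_abs_height_lt hX.1 ⟨by linarith [hX.2.1], by linarith [hX.2.2]⟩

theorem exists_bound_iteratedFDerivWithin {F : Type*} [NormedAddCommGroup F] [NormedSpace ℝ F]
    {f : E3 → F} (hf : ContDiffOn ℝ ∞ f offAxis) {K : Set E3} (hK : IsCompact K)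
    (hKo : K ⊆ offAxis) (m : ℕ) :
    ∃ D : ℝ, 1 ≤ D ∧ ∀ X ∈ K, ∀ k ≤ m, ‖iteratedFDerivWithin ℝ k f offAxis X‖ ≤ D := by
  have h : ∀ k : ℕ, ∃ D : ℝ, ∀ X ∈ K, ‖iteratedFDerivWithin ℝ k f offAxis X‖ ≤ D := fun k =>
    hK.exists_bound_of_continuousOn
      ((hf.continuousOn_iteratedFDerivWithin (by exact_mod_cast le_top)
        isOpen_offAxis.uniqueDiffOn).mono hKo)
  choose D hD using h
  have hsum : ∀ k ≤ m, D k ≤ 1 + ∑ i ∈ Finset.range (m + 1), |D i| := fun k hk => by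
    have := Finset.single_le_sum (f := fun i => |D i|) (fun i _ => abs_nonneg (D i))
      (Finset.mem_range.2 (Nat.lt_succ_of_le hk))
    linarith [le_abs_self (D k)]
  exact ⟨1 + ∑ i ∈ Finset.range (m + 1), |D i|,
    by linarith [Finset.sum_nonneg fun i (_ : i ∈ Finset.range (m + 1)) => abs_nonneg (D i)],
    fun X hX k hk => (hD k X hX).trans (hsum k hk)⟩

/-- Faà di Bruno and Leibniz: the derivatives of `height` and `w` are bounded on the compact set, so
`M` does not depend on the profile. -/
theorem exists_bound_smul_comp_height {F : Type*} [NormedAddCommGroup F] [NormedSpace ℝ F]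
    {w : E3 → F} (hw : ContDiffOn ℝ ∞ w offAxis) {K : Set E3} (hK : IsCompact K)
    (hKo : K ⊆ offAxis) (m : ℕ) :
    ∃ M : ℝ, 0 ≤ M ∧ ∀ a : ℝ → ℝ, ContDiffOn ℝ ∞ a (Ioo (-1) 1) → ∀ X ∈ K, ∀ B : ℝ,
      (∀ j ≤ m, |iteratedDerivWithin j a (Ioo (-1) 1) (height X)| ≤ B) →
      ∀ k ≤ m, ‖iteratedFDerivWithin ℝ k (fun Y => a (height Y) • w Y) offAxis X‖ ≤ M * B := by
  obtain ⟨D, hD1, hD⟩ := exists_bound_iteratedFDerivWithin contDiffOn_height hK hKo m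
  obtain ⟨D', hD1', hD'⟩ := exists_bound_iteratedFDerivWithin hw hK hKo m
  have hD0 : 0 ≤ D := zero_le_one.trans hD1
  have hD0' : 0 ≤ D' := zero_le_one.trans hD1'
  refine ⟨2 ^ m * (m.factorial * D ^ m) * D', by positivity, fun a ha X hX B hB k hk => ?_⟩
  have hB0 : 0 ≤ B := (abs_nonneg _).trans (hB 0 (Nat.zero_le m))
  have hmaps : MapsTo height offAxis (Ioo (-1) 1) := fun Y hY => height_mem hY
  have hu := isOpen_offAxis.uniqueDiffOn (𝕜 := ℝ)
  have hcomp : ∀ i ≤ m, ‖iteratedFDerivWithin ℝ i (fun Y => a (height Y)) offAxis X‖ ≤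
      m.factorial * D ^ m * B := fun i hi => by
    have h1 := norm_iteratedFDerivWithin_comp_le (n := i) (C := B) (D := D) ha contDiffOn_height
      (by exact_mod_cast le_top) isOpen_Ioo.uniqueDiffOn hu hmaps (hKo hX)
      (fun j hj => by
        rw [norm_iteratedFDerivWithin_eq_norm_iteratedDerivWithin, Real.norm_eq_abs]
        exact hB j (hj.trans hi))
      -- The composition bound asks for D^j at order j ≥ 1; this is why D ≥ 1 was arranged.
      (fun j hj1 hj => (hD X hX j (hj.trans hi)).trans (le_self_pow₀ hD1 (by omega)))
    refine h1.trans ?_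
    have h2 : (i.factorial : ℝ) ≤ m.factorial := by exact_mod_cast Nat.factorial_le hi
    have h3 : D ^ i ≤ D ^ m := pow_le_pow_right₀ hD1 hi
    calc (i.factorial : ℝ) * B * D ^ i ≤ m.factorial * B * D ^ m := by gcongr
      _ = m.factorial * D ^ m * B := by ring
  refine (norm_iteratedFDerivWithin_smul_le (N := ∞) (ha.comp contDiffOn_height hmaps) hw hu
    (hKo hX) (by exact_mod_cast le_top)).trans ?_
  have hterm : ∀ i ∈ Finset.range (k + 1), (k.choose i : ℝ) *
      ‖iteratedFDerivWithin ℝ i (a ∘ height) offAxis X‖ *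
      ‖iteratedFDerivWithin ℝ (k - i) w offAxis X‖ ≤
      k.choose i * (m.factorial * D ^ m * B * D') := fun i hi => by
    have hi' : i ≤ m := (Nat.lt_succ_iff.1 (Finset.mem_range.1 hi)).trans hk
    rw [mul_assoc]
    refine mul_le_mul_of_nonneg_left ?_ (Nat.cast_nonneg _)
    exact mul_le_mul (hcomp i hi') (hD' X hX _ ((Nat.sub_le k i).trans hk)) (norm_nonneg _)
      (by positivity)
  refine (Finset.sum_le_sum hterm).trans ?_
  rw [← Finset.sum_mul]
  have hchoose : ∑ i ∈ Finset.range (k + 1), (k.choose i : ℝ) ≤ 2 ^ m := by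
    have h1 : ∑ i ∈ Finset.range (k + 1), (k.choose i : ℝ) = 2 ^ k := by
      exact_mod_cast Nat.sum_range_choose k
    rw [h1]
    exact pow_le_pow_right₀ one_le_two hk
  calc _ ≤ 2 ^ m * (m.factorial * D ^ m * B * D') :=
        mul_le_mul_of_nonneg_right hchoose (by positivity)
    _ = _ := by ring

/-- Velocity and pressure together. -/
def flowField (a b q : ℝ → ℝ) (X : E3) : E3 × ℝ := (velocityField a b X, pressureField q X)

/-- After extension along rays, only functions of the height times fixed smooth fields remain. -/
theorem flowField_radial (a b q : ℝ → ℝ) {X : E3} (hX : X ∈ offAxis) :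
    flowField a b q (‖X‖⁻¹ • X) = a (height X) • ((‖X‖⁻¹ • X, 0) : E3 × ℝ) +
      b (height X) • ((EuclideanSpace.single 2 1, 0) : E3 × ℝ) +
      q (height X) • ((0, 1) : E3 × ℝ) := by
  have h0 : 0 < ‖X‖ := norm_pos_iff.2 (ne_zero_of_mem_offAxis hX)
  have h1 : ‖‖X‖⁻¹ • X‖ = 1 := by
    rw [norm_smul, norm_inv, norm_norm, inv_mul_cancel₀ h0.ne']
  simp [flowField, velocityField, pressureField, height_smul X (inv_pos.2 h0), h1]

theorem exists_sphereCmNorm_flowField_le (m : ℕ) {δ : ℝ} (hδ : 0 < δ) :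
    ∃ M : ℝ, 0 ≤ M ∧ ∀ a b q : ℝ → ℝ, ContDiffOn ℝ ∞ a (Ioo (-1) 1) →
      ContDiffOn ℝ ∞ b (Ioo (-1) 1) → ContDiffOn ℝ ∞ q (Ioo (-1) 1) →
      ∀ A ⊆ sphereZone δ, ∀ B : ℝ,
      (∀ X ∈ A, ∀ j ≤ m, |iteratedDerivWithin j a (Ioo (-1) 1) (height X)| ≤ B ∧
        |iteratedDerivWithin j b (Ioo (-1) 1) (height X)| ≤ B ∧
        |iteratedDerivWithin j q (Ioo (-1) 1) (height X)| ≤ B) →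
      sphereCmNorm m A (flowField a b q) ≤ ENNReal.ofReal (M * B) := by
  have hK := isCompact_sphereZone δ
  have hKo := sphereZone_subset_offAxis hδ
  have hu := isOpen_offAxis.uniqueDiffOn (𝕜 := ℝ)
  have hmaps : MapsTo height offAxis (Ioo (-1) 1) := fun Y hY => height_mem hY
  have hw₁ : ContDiffOn ℝ ∞ (fun X : E3 => ((‖X‖⁻¹ • X, 0) : E3 × ℝ)) offAxis :=
    (contDiffOn_inv_norm.smul contDiffOn_id).prodMk contDiffOn_const
  have hw₂ : ContDiffOn ℝ ∞ (fun _ : E3 => ((EuclideanSpace.single 2 1, 0) : E3 × ℝ)) offAxis :=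
    contDiffOn_const
  have hw₃ : ContDiffOn ℝ ∞ (fun _ : E3 => ((0, 1) : E3 × ℝ)) offAxis := contDiffOn_const
  obtain ⟨M₁, hM₁, h₁⟩ := exists_bound_smul_comp_height hw₁ hK hKo m
  obtain ⟨M₂, hM₂, h₂⟩ := exists_bound_smul_comp_height hw₂ hK hKo m
  obtain ⟨M₃, hM₃, h₃⟩ := exists_bound_smul_comp_height hw₃ hK hKo m
  refine ⟨(m + 1) * (M₁ + M₂ + M₃), by positivity, fun a b q ha hb hq A hA B hB => ?_⟩
  refine iSup₂_le fun X hX => ?_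
  have hXo := hKo (hA hX)
  have hs {φ : ℝ → ℝ} {w : E3 → E3 × ℝ} (hφ : ContDiffOn ℝ ∞ φ (Ioo (-1) 1))
      (hw : ContDiffOn ℝ ∞ w offAxis) : ContDiffOn ℝ ∞ (fun Y => φ (height Y) • w Y) offAxis :=
    (hφ.comp contDiffOn_height hmaps).smul hw
  have hk : ∀ k ∈ Finset.range (m + 1),
      ‖iteratedFDeriv ℝ k (fun y : E3 => flowField a b q (‖y‖⁻¹ • y)) X‖ₑ ≤
        ENNReal.ofReal ((M₁ + M₂ + M₃) * B) := fun k hk => by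
    have hkm : k ≤ m := Nat.lt_succ_iff.1 (Finset.mem_range.1 hk)
    have hki : ((k : ℕ∞) : WithTop ℕ∞) ≤ ∞ := by exact_mod_cast le_top
    rw [← ofReal_norm]
    refine ENNReal.ofReal_le_ofReal ?_
    rw [← iteratedFDerivWithin_of_isOpen k isOpen_offAxis hXo,
      iteratedFDerivWithin_congr (fun Y hY => flowField_radial a b q hY) hXo]
    have e1 := iteratedFDerivWithin_add_apply (i := k)
      (((hs ha hw₁).add (hs hb hw₂)).contDiffWithinAt hXo |>.of_le hki)
      ((hs hq hw₃).contDiffWithinAt hXo |>.of_le hki) hu hXo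
    have e2 := iteratedFDerivWithin_add_apply (i := k)
      ((hs ha hw₁).contDiffWithinAt hXo |>.of_le hki)
      ((hs hb hw₂).contDiffWithinAt hXo |>.of_le hki) hu hXo
    refine (congrArg norm (e1.trans (congrArg (· + _) e2))).trans_le ?_
    refine (norm_add₃_le).trans ?_
    have b1 := h₁ a ha X (hA hX) B (fun j hj => (hB X hX j hj).1) k hkm
    have b2 := h₂ b hb X (hA hX) B (fun j hj => (hB X hX j hj).2.1) k hkm
    have b3 := h₃ q hq X (hA hX) B (fun j hj => (hB X hX j hj).2.2) k hkm
    linarith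
  refine (Finset.sum_le_sum hk).trans ?_
  rw [Finset.sum_const, Finset.card_range, ← ENNReal.ofReal_nsmul]
  refine ENNReal.ofReal_le_ofReal (le_of_eq ?_)
  simp only [nsmul_eq_mul]
  push_cast
  ring

theorem flowField_sub (a b q a' b' q' : ℝ → ℝ) (X : E3) :
    flowField a b q X - flowField a' b' q' X =
      flowField (fun t => a t - a' t) (fun t => b t - b' t) (fun t => q t - q' t) X := by
  simp only [flowField, velocityField, pressureField, Prod.mk_sub_mk, sub_mul, sub_smul]
  congr 1
  abel

theorem sphereCmNorm_congr {F : Type*} [NormedAddCommGroup F] [NormedSpace ℝ F] {m : ℕ}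
    {A : Set E3} (hA : A ⊆ offAxis) {f g : E3 → F} (h : EqOn f g offAxis) :
    sphereCmNorm m A f = sphereCmNorm m A g := by
  refine iSup_congr fun X => iSup_congr fun hX => Finset.sum_congr rfl fun k _ => ?_
  have hev : (fun y : E3 => f (‖y‖⁻¹ • y)) =ᶠ[𝓝 X] fun y => g (‖y‖⁻¹ • y) :=
    Filter.eventually_of_mem (isOpen_offAxis.mem_nhds (hA hX)) fun Y hY =>
      h (smul_mem_offAxis hY (inv_ne_zero (norm_ne_zero_iff.2 (ne_zero_of_mem_offAxis hY))))
  rw [(hev.iteratedFDeriv ℝ k).eq_of_nhds]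

/-- On the unit sphere the squared distances to the poles are 2 ∓ 2x₃. -/
theorem sphereAwayFromPoles_subset_sphereZone {ε : ℝ} (hε : 0 < ε) :
    sphereAwayFromPoles ε ⊆ sphereZone (ε ^ 2 / 2) := by
  rintro X ⟨hX, hb⟩
  rw [mem_sphere_zero_iff_norm] at hX
  simp only [mem_union, Metric.mem_ball, not_or, not_lt, dist_eq_norm] at hb
  have hS := pow_le_pow_left₀ hε.le hb.1 2
  have hN := pow_le_pow_left₀ hε.le hb.2 2
  have h1 := norm_sq_eq X
  rw [hX] at h1
  rw [norm_sq_eq] at hS hN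
  simp only [southPole, northPole, PiLp.sub_apply, Matrix.cons_val_zero, Matrix.cons_val_one,
    Matrix.cons_val] at hS hN
  refine ⟨hX, ?_, ?_⟩
  · rw [height_of_norm_eq_one hX]
    linarith
  · rw [height_of_norm_eq_one hX]
    linarith

theorem cos_polarAngle (X : E3) : Real.cos (polarAngle X) = height X := by
  have h2 : |X 2| ≤ ‖X‖ := by
    rw [← Real.norm_eq_abs]
    exact PiLp.norm_apply_le X 2
  have h := abs_le.1 (abs_div (X 2) ‖X‖ ▸ div_le_one_of_le₀ (abs_norm X ▸ h2) (abs_nonneg _))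
  rw [polarAngle, Real.cos_arccos h.1 h.2, height, div_eq_mul_inv]

/-- The cosine is uniformly strictly decreasing on `[0, π]`. -/
theorem exists_cos_add_le {ε : ℝ} (hε : 0 < ε) :
    ∃ δ : ℝ, 0 < δ ∧ ∀ a b : ℝ, 0 ≤ a → b ≤ Real.pi → a + ε ≤ b →
      Real.cos b + δ ≤ Real.cos a := by
  have hπ := Real.pi_pos
  have hm : 0 < min ε Real.pi := lt_min hε hπ
  have hs : 0 < Real.sin (min ε Real.pi / 2) :=
    Real.sin_pos_of_pos_of_lt_pi (by linarith) (by linarith [min_le_right ε Real.pi])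
  refine ⟨2 * Real.sin (min ε Real.pi / 2) ^ 2, by positivity, fun a b ha hb hab => ?_⟩
  have h1 : Real.sin (min ε Real.pi / 2) ≤ Real.sin ((b - a) / 2) :=
    Real.sin_le_sin_of_le_of_le_pi_div_two (by linarith) (by linarith)
      (by linarith [min_le_left ε Real.pi])
  -- Both (a + b)/2 and its supplement are at least (b - a)/2, as 0 ≤ a and b ≤ π.
  have h2 : Real.sin ((b - a) / 2) ≤ Real.sin ((a + b) / 2) := by
    rcases le_total ((a + b) / 2) (Real.pi / 2) with h | h
    · exact Real.sin_le_sin_of_le_of_le_pi_div_two (by linarith) h (by linarith)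
    · rw [← Real.sin_pi_sub ((a + b) / 2)]
      exact Real.sin_le_sin_of_le_of_le_pi_div_two (by linarith) (by linarith) (by linarith)
  have h3 : Real.cos a - Real.cos b = 2 * (Real.sin ((a + b) / 2) * Real.sin ((b - a) / 2)) := by
    rw [Real.cos_sub_cos, ← neg_sub b a, neg_div, Real.sin_neg]
    ring
  have h4 := mul_le_mul (h1.trans h2) h1 hs.le (hs.le.trans (h1.trans h2))
  nlinarith

theorem Tower.exists_bound_iteratedDerivWithin {Λ : Type*} {S : Set Λ} {R : ℝ → Set (Λ × ℝ)}
    {hR : ∀ δ, 0 < δ → R δ ⊆ S ×ˢ Ioo (-1) 1} {f : Λ → ℝ → ℝ}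
    (hf : ∀ k, Tower (bddClass S R hR) k f) (m : ℕ) {δ : ℝ} (hδ : 0 < δ) :
    ∃ C : ℝ, ∀ p ∈ R δ, ∀ j ≤ m, |iteratedDerivWithin j (f p.1) (Ioo (-1) 1) p.2| ≤ C := by
  have h : ∀ j : ℕ, ∃ C : ℝ, ∀ p ∈ R δ, |iteratedDerivWithin j (f p.1) (Ioo (-1) 1) p.2| ≤ C :=
    fun j => (hf j).iteratedDerivWithin_mem le_rfl δ hδ
  choose C hC using h
  refine ⟨∑ i ∈ Finset.range (m + 1), |C i|, fun p hp j hj => ((hC j p hp).trans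
    (le_abs_self _)).trans ?_⟩
  exact Finset.single_le_sum (f := fun i => |C i|) (fun i _ => abs_nonneg (C i))
    (Finset.mem_range.2 (Nat.lt_succ_of_le hj))

/-- The flow is linear in its profiles, so a common factor `r` passes to the norm; it will be the
viscosity. -/
theorem exists_sphereCmNorm_flowField_le_of_tower {Λ : Type*} {S : Set Λ} {R : ℝ → Set (Λ × ℝ)}
    {hR : ∀ δ, 0 < δ → R δ ⊆ S ×ˢ Ioo (-1) 1} {a b q : Λ → ℝ → ℝ}
    (ha : ∀ k, Tower (bddClass S R hR) k a) (hb : ∀ k, Tower (bddClass S R hR) k b)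
    (hq : ∀ k, Tower (bddClass S R hR) k q) (m : ℕ) {δ : ℝ} (hδ : 0 < δ) {A : Λ → Set E3}
    (hA : ∀ l ∈ S, ∀ X ∈ A l, X ∈ sphereZone δ ∧ (l, height X) ∈ R δ) :
    ∃ C : ℝ, ∀ l ∈ S, ∀ r : ℝ, 0 ≤ r → sphereCmNorm m (A l)
      (flowField (fun t => r * a l t) (fun t => r * b l t) (fun t => r * q l t)) ≤
        ENNReal.ofReal (C * r) := by
  obtain ⟨Ca, hCa⟩ := Tower.exists_bound_iteratedDerivWithin ha m hδ
  obtain ⟨Cb, hCb⟩ := Tower.exists_bound_iteratedDerivWithin hb m hδ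
  obtain ⟨Cq, hCq⟩ := Tower.exists_bound_iteratedDerivWithin hq m hδ
  obtain ⟨M, hM0, hM⟩ := exists_sphereCmNorm_flowField_le m hδ
  refine ⟨M * max Ca (max Cb Cq), fun l hl r hr => ?_⟩
  have hs {f : Λ → ℝ → ℝ} (hf : ∀ k, Tower (bddClass S R hR) k f) :
      ContDiffOn ℝ ∞ (f l) (Ioo (-1) 1) := Tower.contDiffOn_infty hf hl
  rw [mul_assoc]
  refine hM _ _ _ (contDiffOn_const.mul (hs ha)) (contDiffOn_const.mul (hs hb))
    (contDiffOn_const.mul (hs hq)) (A l) (fun X hX => (hA l hl X hX).1) _ fun X hX j hj => ?_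
  have hp := (hA l hl X hX).2
  have hmem := (hR δ hδ hp).2
  have hscale {f : Λ → ℝ → ℝ} (hf : ∀ k, Tower (bddClass S R hR) k f) {C : ℝ}
      (hC : |iteratedDerivWithin j (f l) (Ioo (-1) 1) (height X)| ≤ C)
      (hle : C ≤ max Ca (max Cb Cq)) :
      |iteratedDerivWithin j (fun t => r * f l t) (Ioo (-1) 1) (height X)| ≤
        max Ca (max Cb Cq) * r := by
    rw [iteratedDerivWithin_const_mul hmem isOpen_Ioo.uniqueDiffOn r
      (((hs hf) _ hmem).of_le (by exact_mod_cast le_top)), abs_mul, abs_of_nonneg hr, mul_comm]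
    exact mul_le_mul_of_nonneg_right (hC.trans hle) hr
  exact ⟨hscale ha (hCa _ hp j hj) (le_max_left _ _),
    hscale hb (hCb _ hp j hj) ((le_max_left _ _).trans (le_max_right _ _)),
    hscale hq (hCq _ hp j hj) ((le_max_right _ _).trans (le_max_right _ _))⟩

theorem Tower.radialProfile {Λ : Type*} {S : Set Λ} {𝒜 : FamilyClass S} {f : Λ → ℝ → ℝ}
    (hx : (fun _ x => x) ∈ 𝒜.carrier) (hf : ∀ k, Tower 𝒜 k f) (k : ℕ) :
    Tower 𝒜 k (fun a => _root_.radialProfile (f a)) :=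
  ((Tower.one_sub_sq hx k).mul (hf (k + 1)).tower_deriv).sub ((Tower.var hx k).mul (hf k))

theorem Tower.pressureProfile {Λ : Type*} {S : Set Λ} {𝒜 : FamilyClass S} {f : Λ → ℝ → ℝ}
    {ν c : Λ → ℝ} (hx : (fun _ x => x) ∈ 𝒜.carrier) (hν : ∀ k, Tower 𝒜 k (fun a _ => ν a))
    (hc : ∀ k, Tower 𝒜 k (fun a _ => c a)) (hf : ∀ k, Tower 𝒜 k f) (k : ℕ) :
    Tower 𝒜 k (fun a => _root_.pressureProfile (ν a) (c a) (f a)) := by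
  have h := (((hc k).add ((hν k).mul (((Tower.one_sub_sq hx k).mul (hf (k + 1)).tower_deriv).sub
    (((Tower.var hx k).mul (hf k)).const_mul 2)))).sub
    (((Tower.one_sub_sq hx k).mul (hf k).sq).const_mul (1 / 2)))
  refine h.congr fun a _ x _ => ?_
  simp only [_root_.pressureProfile]
  ring

/-- The difference of the flows with the profiles `g` and `G` is of order `ν` if `(g - G) / ν` is
uniformly bounded with all its derivatives. -/
theorem exists_sphereCmNorm_sub_le {Λ : Type*} {S : Set Λ} {R : ℝ → Set (Λ × ℝ)}
    {hR : ∀ δ, 0 < δ → R δ ⊆ S ×ˢ Ioo (-1) 1} {g G : Λ → ℝ → ℝ} {ν : Λ → ℝ} (c : Λ → ℝ)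
    (hx : (fun _ x => x) ∈ (bddClass S R hR).carrier) (hν0 : ∀ l ∈ S, 0 < ν l)
    (hν : ∀ k, Tower (bddClass S R hR) k (fun l _ => ν l))
    (hG : ∀ k, Tower (bddClass S R hR) k G)
    (hE : ∀ k, Tower (bddClass S R hR) k (fun l x => (ν l)⁻¹ * (g l x - G l x)))
    (m : ℕ) {δ : ℝ} (hδ : 0 < δ) {A : Λ → Set E3}
    (hA : ∀ l ∈ S, ∀ X ∈ A l, X ∈ sphereZone δ ∧ (l, height X) ∈ R δ) :
    ∃ C : ℝ, 0 ≤ C ∧ ∀ l ∈ S, sphereCmNorm m (A l) (fun X =>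
      flowField (radialProfile (g l)) (fun t => -g l t) (pressureProfile (ν l) (c l) (g l)) X -
      flowField (radialProfile (G l)) (fun t => -G l t) (pressureProfile 0 (c l) (G l)) X) ≤
        ENNReal.ofReal (C * ν l) := by
  set E : Λ → ℝ → ℝ := fun l x => (ν l)⁻¹ * (g l x - G l x) with hEdef
  have hgE : ∀ l ∈ S, ∀ x, g l x = G l x + ν l * E l x := fun l hl x => by
    have := (hν0 l hl).ne'
    simp only [hEdef]
    field_simp
    ring
  have hg : ∀ k, Tower (bddClass S R hR) k g := fun k =>
    ((hG k).add ((hν k).mul (hE k))).congr fun l hl x _ => (hgE l hl x).symm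
  -- The pressure difference divided by ν: the quadratic term contributes through g² - G² = νE (g +
  -- G).
  have hq : ∀ k, Tower (bddClass S R hR) k (fun l x =>
      ((1 - x ^ 2) * deriv (g l) x - 2 * (x * g l x)) -
        1 / 2 * ((1 - x ^ 2) * (E l x * (g l x + G l x)))) := fun k =>
    (((Tower.one_sub_sq hx k).mul (hg (k + 1)).tower_deriv).sub
      (((Tower.var hx k).mul (hg k)).const_mul 2)).sub
      (((Tower.one_sub_sq hx k).mul ((hE k).mul ((hg k).add (hG k)))).const_mul (1 / 2))
  obtain ⟨C, hC⟩ := exists_sphereCmNorm_flowField_le_of_tower (Tower.radialProfile hx hE)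
    (fun k => (hE k).neg) hq m hδ hA
  refine ⟨max C 0, le_max_right _ _, fun l hl => ?_⟩
  have hν0' := (hν0 l hl).le
  refine (le_of_eq ?_).trans ((hC l hl (ν l) hν0').trans
    (ENNReal.ofReal_le_ofReal (mul_le_mul_of_nonneg_right (le_max_left _ _) hν0')))
  refine sphereCmNorm_congr (fun X hX => sphereZone_subset_offAxis hδ (hA l hl X hX).1)
    fun X hX => ?_
  have ht := height_mem hX
  have hd : deriv (g l) (height X) = deriv (G l) (height X) + ν l * deriv (E l) (height X) := by
    refine HasDerivAt.deriv ((((hG 1).hasDerivAt_deriv hl ht).add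
      (((hE 1).hasDerivAt_deriv hl ht).const_mul (ν l))).congr_of_eventuallyEq
      (Filter.Eventually.of_forall fun x => ?_))
    exact hgE l hl x
  have h1 := hgE l hl (height X)
  simp only [flowField_sub]
  have e {a b q a' b' q' : ℝ → ℝ} (h₁ : a (height X) = a' (height X))
      (h₂ : b (height X) = b' (height X)) (h₃ : q (height X) = q' (height X)) :
      flowField a b q X = flowField a' b' q' X := by
    simp only [flowField, velocityField, pressureField, h₁, h₂, h₃]
  refine e ?_ ?_ ?_
  · simp only [radialProfile, hd, h1]
    ring
  · simp only [h1]
    ring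
  · simp only [pressureProfile, hd, h1]
    ring

/-- Joint continuity of each derivative becomes uniform in t by compactness of the interval. -/
theorem eventually_iteratedDerivWithin_sub_le {Λ : Type*} [TopologicalSpace Λ] {S D : Set Λ}
    (hD : D ⊆ S) {f : Λ → ℝ → ℝ} (hf : ∀ k, Tower (contClass S) k f) (m : ℕ) {δ : ℝ} (hδ : 0 < δ)
    {l : Λ} (hl : l ∈ D) {η : ℝ} (hη : 0 < η) :
    ∀ᶠ l' in 𝓝[D] l, ∀ t ∈ Icc (-1 + δ) (1 - δ), ∀ j ≤ m,
      |iteratedDerivWithin j (fun x => f l' x - f l x) (Ioo (-1) 1) t| ≤ η := by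
  have hj : ∀ j : ℕ, ∀ᶠ l' in 𝓝 l, ∀ t ∈ Icc (-1 + δ) (1 - δ), l' ∈ D →
      |iteratedDerivWithin j (fun x => f l' x - f l x) (Ioo (-1) 1) t| ≤ η := fun j => by
    refine isCompact_Icc.eventually_forall_of_forall_eventually fun t ht => ?_
    have ht' : t ∈ Ioo (-1 : ℝ) 1 := ⟨by linarith [ht.1], by linarith [ht.2]⟩
    have hc : ContinuousOn (fun p : Λ × ℝ => iteratedDerivWithin j (f p.1) (Ioo (-1) 1) p.2)
      (S ×ˢ Ioo (-1) 1) := mem_contClass.1 ((hf j).iteratedDerivWithin_mem le_rfl)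
    have hn : ∀ᶠ p in 𝓝 (l, t), p ∈ S ×ˢ Ioo (-1 : ℝ) 1 →
        |iteratedDerivWithin j (f p.1) (Ioo (-1) 1) p.2 -
          iteratedDerivWithin j (f l) (Ioo (-1) 1) t| < η / 2 := by
      have := (Metric.continuousWithinAt_iff'.1 (hc (l, t) ⟨hD hl, ht'⟩)) (η / 2) (half_pos hη)
      rw [eventually_nhdsWithin_iff] at this
      exact this
    have hn' : ∀ᶠ p : Λ × ℝ in 𝓝 (l, t), (l, p.2) ∈ S ×ˢ Ioo (-1 : ℝ) 1 →
        |iteratedDerivWithin j (f l) (Ioo (-1) 1) p.2 -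
          iteratedDerivWithin j (f l) (Ioo (-1) 1) t| < η / 2 := by
      have hcont : Tendsto (fun p : Λ × ℝ => (l, p.2)) (𝓝 (l, t)) (𝓝 (l, t)) :=
        (by fun_prop : Continuous fun p : Λ × ℝ => (l, p.2)).tendsto' _ _ rfl
      exact hcont.eventually hn
    have hI : ∀ᶠ p : Λ × ℝ in 𝓝 (l, t), p.2 ∈ Ioo (-1 : ℝ) 1 :=
      continuous_snd.continuousAt.eventually (isOpen_Ioo.mem_nhds ht')
    filter_upwards [hn, hn', hI] with p h1 h2 h3 hp
    have hs : ∀ l' ∈ S, ContDiffWithinAt ℝ j (f l') (Ioo (-1) 1) p.2 := fun l' hl' =>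
      ((Tower.contDiffOn_infty hf hl') _ h3).of_le (by exact_mod_cast le_top)
    have e := iteratedDerivWithin_sub h3 isOpen_Ioo.uniqueDiffOn (hs _ (hD hp)) (hs _ (hD hl))
    have e' : iteratedDerivWithin j (fun x => f p.1 x - f l x) (Ioo (-1) 1) p.2 = _ := e
    rw [e']
    have b1 := abs_lt.1 (h1 ⟨hD hp, h3⟩)
    have b2 := abs_lt.1 (h2 ⟨hD hl, h3⟩)
    rw [abs_le]
    constructor <;> linarith [b1.1, b1.2, b2.1, b2.2]
  have hall := (Finset.eventually_all (Finset.range (m + 1))).2 fun j _ => hj j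
  rw [eventually_nhdsWithin_iff]
  filter_upwards [hall] with l' h hl' t ht j hjm
  exact h j (Finset.mem_range.2 (Nat.lt_succ_of_le hjm)) t ht hl'

theorem exists_bound_iteratedDerivWithin_contClass {Λ : Type*} [TopologicalSpace Λ] {S : Set Λ}
    {f : Λ → ℝ → ℝ} (hf : ∀ k, Tower (contClass S) k f) (m : ℕ) {δ : ℝ} (hδ : 0 < δ)
    {l : Λ} (hl : l ∈ S) :
    ∃ B : ℝ, ∀ t ∈ Icc (-1 + δ) (1 - δ), ∀ j ≤ m,
      |iteratedDerivWithin j (f l) (Ioo (-1) 1) t| ≤ B := by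
  have h : ∀ j : ℕ, ∃ B : ℝ, ∀ t ∈ Icc (-1 + δ) (1 - δ),
      ‖iteratedDerivWithin j (f l) (Ioo (-1) 1) t‖ ≤ B := fun j => by
    refine isCompact_Icc.exists_bound_of_continuousOn ?_
    refine ((Tower.contDiffOn_infty hf hl).continuousOn_iteratedDerivWithin
      (by exact_mod_cast le_top) isOpen_Ioo.uniqueDiffOn).mono fun t ht => ?_
    exact ⟨by linarith [ht.1], by linarith [ht.2]⟩
  choose B hB using h
  refine ⟨∑ i ∈ Finset.range (m + 1), |B i|, fun t ht j hj => ((hB j t ht).trans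
    (le_abs_self _)).trans ?_⟩
  exact Finset.single_le_sum (f := fun i => |B i|) (fun i _ => abs_nonneg (B i))
    (Finset.mem_range.2 (Nat.lt_succ_of_le hj))

theorem continuousIntoCm_flowField {Λ : Type*} [TopologicalSpace Λ] {S D : Set Λ} (hD : D ⊆ S)
    {a b q : Λ → ℝ → ℝ} (ha : ∀ k, Tower (contClass S) k a) (hb : ∀ k, Tower (contClass S) k b)
    (hq : ∀ k, Tower (contClass S) k q) (m : ℕ) {δ : ℝ} (hδ : 0 < δ) {A : Set E3}
    (hA : A ⊆ sphereZone δ) :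
    ContinuousIntoCm m A D (fun l => flowField (a l) (b l) (q l)) := by
  obtain ⟨M, hM0, hM⟩ := exists_sphereCmNorm_flowField_le m hδ
  intro l hl
  have hs {f : Λ → ℝ → ℝ} (hf : ∀ k, Tower (contClass S) k f) {l' : Λ} (hl' : l' ∈ D) :
      ContDiffOn ℝ ∞ (f l') (Ioo (-1) 1) := Tower.contDiffOn_infty hf (hD hl')
  constructor
  · obtain ⟨Ba, hBa⟩ := exists_bound_iteratedDerivWithin_contClass ha m hδ (hD hl)
    obtain ⟨Bb, hBb⟩ := exists_bound_iteratedDerivWithin_contClass hb m hδ (hD hl)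
    obtain ⟨Bq, hBq⟩ := exists_bound_iteratedDerivWithin_contClass hq m hδ (hD hl)
    refine (hM _ _ _ (hs ha hl) (hs hb hl) (hs hq hl) A hA (max Ba (max Bb Bq))
      fun X hX j hj => ?_).trans_lt ENNReal.ofReal_lt_top
    have ht : height X ∈ Icc (-1 + δ) (1 - δ) := (hA hX).2
    exact ⟨(hBa _ ht j hj).trans (le_max_left _ _),
      (hBb _ ht j hj).trans ((le_max_left _ _).trans (le_max_right _ _)),
      (hBq _ ht j hj).trans ((le_max_right _ _).trans (le_max_right _ _))⟩
  · rw [ENNReal.tendsto_nhds_zero]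
    intro e he
    rcases eq_or_ne e ⊤ with rfl | he'
    · exact Filter.Eventually.of_forall fun _ => le_top
    have he0 : 0 < e.toReal := ENNReal.toReal_pos he.ne' he'
    -- M + 1 rather than M, since M may be 0.
    have hη : 0 < e.toReal / (M + 1) := by positivity
    filter_upwards [eventually_iteratedDerivWithin_sub_le hD ha m hδ hl hη,
      eventually_iteratedDerivWithin_sub_le hD hb m hδ hl hη,
      eventually_iteratedDerivWithin_sub_le hD hq m hδ hl hη, self_mem_nhdsWithin]
      with l' h1 h2 h3 hl'
    have hd : (fun X => flowField (a l') (b l') (q l') X - flowField (a l) (b l) (q l) X) =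
        flowField (fun t => a l' t - a l t) (fun t => b l' t - b l t) (fun t => q l' t - q l t) :=
      funext fun X => flowField_sub _ _ _ _ _ _ X
    rw [hd]
    refine (hM _ _ _ ((hs ha hl').sub (hs ha hl)) ((hs hb hl').sub (hs hb hl))
      ((hs hq hl').sub (hs hq hl)) A hA (e.toReal / (M + 1)) fun X hX j hj => ?_).trans ?_
    · have ht : height X ∈ Icc (-1 + δ) (1 - δ) := (hA hX).2
      exact ⟨h1 _ ht j hj, h2 _ ht j hj, h3 _ ht j hj⟩
    · refine (ENNReal.ofReal_le_ofReal ?_).trans ENNReal.ofReal_toReal_le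
      rw [mul_div_assoc', div_le_iff₀ (by positivity)]
      nlinarith

/-! ### The Euler solutions -/

theorem sin_polarAngle_pos {X : E3} (hX : X ∈ offAxis) :
    0 < Real.sin (polarAngle X) ∧ Real.sin (polarAngle X) ^ 2 = 1 - height X ^ 2 := by
  have h1 : Real.sin (polarAngle X) ^ 2 = 1 - height X ^ 2 := by
    rw [Real.sin_sq, cos_polarAngle]
  have h0 : 0 ≤ Real.sin (polarAngle X) :=
    Real.sin_nonneg_of_nonneg_of_le_pi (Real.arccos_nonneg _) (Real.arccos_le_pi _)
  refine ⟨lt_of_le_of_ne h0 fun h => ?_, h1⟩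
  rw [← h] at h1
  linarith [one_sub_sq_pos (height_mem hX)]

theorem sphPoint_polarAngle_meridianAngle {X : E3} (hX : X ∈ offAxis) :
    sphPoint ‖X‖ (polarAngle X) (meridianAngle X) = X := by
  have h0 : 0 < ‖X‖ := norm_pos_iff.2 (ne_zero_of_mem_offAxis hX)
  obtain ⟨hs, hs2⟩ := sin_polarAngle_pos hX
  have hn : ‖X‖ * Real.sin (polarAngle X) = ‖(⟨X 0, X 1⟩ : ℂ)‖ := by
    refine (pow_left_inj₀ (by positivity) (norm_nonneg _) two_ne_zero).1 ?_
    rw [mul_pow, hs2, ← Complex.normSq_eq_norm_sq, Complex.normSq_mk, height]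
    have := norm_sq_eq X
    field_simp
    linarith
  ext i
  fin_cases i
  · have := Complex.norm_mul_cos_arg (⟨X 0, X 1⟩ : ℂ)
    rw [← hn] at this
    simpa [sphPoint, eR, meridianAngle, mul_assoc] using this
  · have := Complex.norm_mul_sin_arg (⟨X 0, X 1⟩ : ℂ)
    rw [← hn] at this
    simpa [sphPoint, eR, meridianAngle, mul_assoc] using this
  · simp only [sphPoint, eR, cos_polarAngle, height]
    simp
    field_simp

theorem hasDerivAt_eulerProfile {c : Fin 3 → ℝ} (hc : c ∈ interior (paramJ 0)) {t : ℝ}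
    (ht : t ∈ Ioo (-1 : ℝ) 1) :
    HasDerivAt (eulerProfile c) (deriv (polyP c) t / Real.sqrt (2 * polyP c t) * (1 - t ^ 2)⁻¹ +
      Real.sqrt (2 * polyP c t) * (2 * t * ((1 - t ^ 2)⁻¹) ^ 2)) t := by
  have hP := polyP_pos hc ht
  have h1 : HasDerivAt (fun x => Real.sqrt (2 * polyP c x))
      (deriv (polyP c) t / Real.sqrt (2 * polyP c t)) t := by
    refine (((hasDerivAt_polyP c t).differentiableAt.hasDerivAt.const_mul 2).sqrt
      (by positivity)).congr_deriv ?_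
    rw [mul_div_mul_left _ _ two_ne_zero]
  have h2 : HasDerivAt (fun x : ℝ => (1 - x ^ 2)⁻¹) (2 * t * ((1 - t ^ 2)⁻¹) ^ 2) t := by
    have hm : HasDerivAt (fun t : ℝ => 1 - t ^ 2) (-(2 * t)) t := by
      simpa using (hasDerivAt_pow 2 t).const_sub 1
    refine (hm.inv (one_sub_sq_pos ht).ne').congr_deriv ?_
    rw [neg_neg, inv_pow, div_eq_mul_inv]
  exact h1.mul h2

/-- Since (1 - t²) G = √(2P_c), the radial component ((1 - t²) G)' is P_c'/√(2P_c); the sign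
multiplies the whole profile. -/
theorem eulerV_eqOn (s : ℝ) {c : Fin 3 → ℝ} (hc : c ∈ interior (paramJ 0)) :
    EqOn (eulerV s c) (velocityField (radialProfile fun x => s * eulerProfile c x)
      (fun t => -(s * eulerProfile c t))) offAxis := by
  intro X hX
  have h0 : 0 < ‖X‖ := norm_pos_iff.2 (ne_zero_of_mem_offAxis hX)
  obtain ⟨hs, hs2⟩ := sin_polarAngle_pos hX
  have ht := height_mem hX
  have hm := one_sub_sq_pos ht
  have hU : 0 < Real.sqrt (2 * polyP c (height X)) :=
    Real.sqrt_pos.2 (mul_pos two_pos (polyP_pos hc ht))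
  conv_rhs => rw [← sphPoint_polarAngle_meridianAngle hX]
  rw [velocityField_sphPoint _ _ h0, eulerV, cos_polarAngle]
  congr 2
  · rw [radialProfile, ((hasDerivAt_eulerProfile hc ht).const_mul s).deriv, eulerProfile]
    field_simp
    ring
  · rw [eulerProfile, ← hs2]
    field_simp

/-- The pressure depends on the profile only through its square, hence not on the sign; moreover
P_c'' = -2c₃. -/
theorem eulerQ_eqOn {s : ℝ} (hs1 : s ^ 2 = 1) {c : Fin 3 → ℝ} (hc : c ∈ interior (paramJ 0)) :
    EqOn (eulerQ c) (pressureField (pressureProfile 0 (c 2) fun x => s * eulerProfile c x))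
      offAxis := by
  intro X hX
  have h0 : 0 < ‖X‖ := norm_pos_iff.2 (ne_zero_of_mem_offAxis hX)
  obtain ⟨hs, hs2⟩ := sin_polarAngle_pos hX
  have ht := height_mem hX
  have hm := one_sub_sq_pos ht
  have hG := eulerProfile_sq hc ht
  rw [eulerQ, cos_polarAngle, deriv_deriv_polyP, hs2, pressureField, pressureProfile, mul_pow, hs1]
  have hG' : eulerProfile c (height X) ^ 2 = 2 * (polyP c (height X) * ((1 - height X ^ 2)⁻¹) ^ 2) := by
    linarith
  rw [hG']
  field_simp
  ring

theorem Riccati.of_hasDerivAt {ν : ℝ} {c : Fin 3 → ℝ} {g : ℝ → ℝ} (hν : 0 < ν)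
    (h : ∀ x ∈ Ioo (-1 : ℝ) 1,
      HasDerivAt g (ν⁻¹ * (polyP c x * ((1 - x ^ 2)⁻¹) ^ 2 - 1 / 2 * g x ^ 2)) x) :
    Riccati ν c g := by
  intro t ht
  have hm := one_sub_sq_pos ht
  rw [(h t ht).deriv]
  field_simp
  ring

theorem riccati_eulerProfile {s : ℝ} (hs1 : s ^ 2 = 1) {c : Fin 3 → ℝ}
    (hc : c ∈ interior (paramJ 0)) : Riccati 0 c (fun x => s * eulerProfile c x) := by
  intro t ht
  have hG := eulerProfile_sq hc ht
  rw [zero_mul, zero_add, mul_pow, hs1, one_mul, hG, inv_pow, div_eq_mul_inv]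

theorem isHomSolution_euler {s : ℝ} (hs1 : s ^ 2 = 1) {c : Fin 3 → ℝ}
    (hc : c ∈ interior (paramJ 0)) : IsHomSolution 0 (eulerV s c) (eulerQ c) :=
  ((riccati_eulerProfile hs1 hc).isHomSolution
    (contDiffOn_const.mul (Tower.contDiffOn_infty tower_eulerProfile hc))).congr
    (eulerV_eqOn s hc) (eulerQ_eqOn hs1 hc)

theorem sphereBand_subset_offAxis : sphereBand 0 Real.pi ⊆ offAxis := by
  rintro X ⟨hX, h⟩
  refine mem_offAxis_of_abs_height_lt (mem_sphere_zero_iff_norm.1 hX) ?_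
  rw [← cos_polarAngle]
  exact cos_mem_Ioo h

/-- The two fields are opposite, so equality would make both vanish. A nonzero horizontal coordinate
of X then kills the radial profile, and the third component kills G, which is positive. -/
theorem eulerV_ne {c : Fin 3 → ℝ} (hc : c ∈ interior (paramJ 0)) {X : E3} (hX : X ∈ offAxis) :
    eulerV 1 c X ≠ eulerV (-1) c X := by
  intro h
  have h0 : 0 < ‖X‖ := norm_pos_iff.2 (ne_zero_of_mem_offAxis hX)
  have hG := eulerProfile_pos hc (height_mem hX)
  rw [eulerV_eqOn 1 hc hX, eulerV_eqOn (-1) hc hX] at h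
  have h1 : ∀ s : ℝ, radialProfile (fun x => s * eulerProfile c x) =
      fun t => s * radialProfile (eulerProfile c) t := fun s => by
    funext t
    simp only [radialProfile, deriv_const_mul_field]
    ring
  have h2 : velocityField (radialProfile (eulerProfile c)) (fun t => -eulerProfile c t) X = 0 := by
    rw [h1, h1] at h
    simp only [velocityField, one_mul, neg_mul, neg_smul, neg_neg] at h ⊢
    have h3 : (2 : ℝ) • ((radialProfile (eulerProfile c) (height X) * ‖X‖⁻¹ ^ 2) • X -
        (eulerProfile c (height X) * ‖X‖⁻¹) • (EuclideanSpace.single 2 1 : E3)) = 0 := by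
      rw [two_smul]
      nth_rewrite 1 [sub_eq_add_neg]
      rw [h]
      abel
    rw [← sub_eq_add_neg]
    exact (smul_eq_zero.1 h3).resolve_left two_ne_zero
  have hi (i : Fin 3) := congrArg (fun Y : E3 => Y i) h2
  simp only [velocityField_apply, PiLp.zero_apply] at hi
  have hα : radialProfile (eulerProfile c) (height X) = 0 := by
    rcases hX with hx | hx
    · have := hi 0
      simp only [Fin.reduceEq, if_false, mul_zero, add_zero] at this
      simpa [h0.ne', hx] using this
    · have := hi 1
      simp only [Fin.reduceEq, if_false, mul_zero, add_zero] at this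
      simpa [h0.ne', hx] using this
  have := hi 2
  rw [hα] at this
  simp [h0.ne', hG.ne'] at this

theorem flowField_sub_euler_eqOn {s : ℝ} (hs1 : s ^ 2 = 1) {c : Fin 3 → ℝ}
    (hc : c ∈ interior (paramJ 0)) (a b q : ℝ → ℝ) :
    EqOn (fun X => flowField a b q X - (eulerV s c X, eulerQ c X))
      (fun X => flowField a b q X - flowField (radialProfile fun x => s * eulerProfile c x)
        (fun t => -(s * eulerProfile c t))
        (pressureProfile 0 (c 2) fun x => s * eulerProfile c x) X) offAxis := by
  intro X hX
  simp only [flowField, eulerV_eqOn s hc hX, eulerQ_eqOn hs1 hc hX]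

/-! ### The families of flows and their inviscid limits -/

theorem sphereBand_upper {ε δ θ₀ : ℝ} (hε : 0 < ε) (hθ₀ : θ₀ ∈ Ioo 0 Real.pi)
    (hδ : ∀ a b : ℝ, 0 ≤ a → b ≤ Real.pi → a + ε ≤ b → Real.cos b + δ ≤ Real.cos a) {X : E3}
    (hX : X ∈ sphereBand ε (θ₀ - ε)) :
    X ∈ sphereZone δ ∧ Real.cos θ₀ + δ ≤ height X ∧ height X ≤ 1 - δ := by
  obtain ⟨h1, h2, h3⟩ := hX
  have e1 := hδ 0 (polarAngle X) le_rfl (Real.arccos_le_pi _) (by linarith)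
  have e2 := hδ (polarAngle X) θ₀ (by linarith) hθ₀.2.le (by linarith)
  rw [Real.cos_zero] at e1
  rw [cos_polarAngle] at e1 e2
  have e3 := Real.neg_one_le_cos θ₀
  exact ⟨⟨mem_sphere_zero_iff_norm.1 h1, by linarith, by linarith⟩, e2, by linarith⟩

theorem sphereBand_lower {ε δ θ₀ : ℝ} (hθ₀ : θ₀ ∈ Ioo 0 Real.pi)
    (hδ : ∀ a b : ℝ, 0 ≤ a → b ≤ Real.pi → a + ε ≤ b → Real.cos b + δ ≤ Real.cos a) {X : E3}
    (hX : X ∈ sphereBand (θ₀ + ε) (Real.pi - ε)) :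
    X ∈ sphereZone δ ∧ -1 + δ ≤ height X ∧ height X ≤ Real.cos θ₀ - δ := by
  obtain ⟨h1, h2, h3⟩ := hX
  have e1 := hδ (polarAngle X) Real.pi (Real.arccos_nonneg _) le_rfl (by linarith)
  have e2 := hδ θ₀ (polarAngle X) hθ₀.1.le (Real.arccos_le_pi _) (by linarith)
  rw [Real.cos_pi] at e1
  rw [cos_polarAngle] at e1 e2
  have e3 := Real.cos_le_one θ₀
  exact ⟨⟨mem_sphere_zero_iff_norm.1 h1, by linarith, by linarith⟩, by linarith, by linarith⟩

/-- The velocity and the pressure of the flow with `u_θ = g(cos θ) sin θ / r`. -/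
def riccatiFlow (a : (Fin 3 → ℝ) × ℝ) (g : ℝ → ℝ) : E3 → E3 × ℝ :=
  flowField (radialProfile g) (fun t => -g t) (pressureProfile a.2 (a.1 2) g)

/-- A continuous family of solutions of the Riccati equation that converges to `± eulerProfile` at
the rate `ν` gives a family of flows that converges to the Euler flow. -/
theorem exists_family_of_tower {s : ℝ} (hs1 : s ^ 2 = 1) {g : (Fin 3 → ℝ) × ℝ → ℝ → ℝ}
    (hg : ∀ a ∈ goodParams, ∀ x ∈ Ioo (-1 : ℝ) 1, HasDerivAt (g a) (riccatiRhs g a x) x)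
    (hgT : ∀ k, Tower (contClass goodParams) k g)
    (hgE : ∀ K : Set (Fin 3 → ℝ), IsCompact K → K ⊆ interior (paramJ 0) → ∀ k,
      Tower (uniformClass K) k (fun a x => a.2⁻¹ * (g a x - s * eulerProfile a.1 x))) :
    ∃ (u : (Fin 3 → ℝ) × ℝ → E3 → E3) (p : (Fin 3 → ℝ) × ℝ → E3 → ℝ),
        (∀ a ∈ paramSet, IsHomSolution a.2 (u a) (p a)) ∧
        (∀ (m : ℕ) (ε : ℝ), 0 < ε →
          ContinuousIntoCm m (sphereAwayFromPoles ε) paramSet (fun a x => (u a x, p a x))) ∧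
        (∀ K : Set (Fin 3 → ℝ), IsCompact K → K ⊆ interior (paramJ 0) →
          ∀ (m : ℕ) (ε : ℝ), 0 < ε → ∃ C : ℝ, ∀ ν : ℝ, 0 < ν → ν ≤ 1 → ∀ c ∈ K,
            sphereCmNorm m (sphereAwayFromPoles ε)
                (fun x => (u (c, ν) x, p (c, ν) x) - (eulerV s c x, eulerQ c x))
              ≤ ENNReal.ofReal (C * ν)) := by
  refine ⟨fun a X => (riccatiFlow a (g a) X).1, fun a X => (riccatiFlow a (g a) X).2,
    fun a ha => ?_, fun m ε hε => ?_, fun K hK hKJ m ε hε => ?_⟩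
  · have ha' := paramSet_subset ha
    exact (Riccati.of_hasDerivAt ha.1 fun x hx => hg a ha' x hx).isHomSolution
      (Tower.contDiffOn_infty hgT ha')
  · have hx := var_mem_contClass goodParams
    exact continuousIntoCm_flowField paramSet_subset (Tower.radialProfile hx hgT)
      (fun k => (hgT k).neg)
      (Tower.pressureProfile hx
        (fun k => Tower.of_param (continuousOn_mem_contClass_param continuous_snd.continuousOn) k)
        (fun k => Tower.of_param (coord_mem_contClass goodParams 2) k) hgT)
      m (by positivity) (sphereAwayFromPoles_subset_sphereZone hε)
  · have hZ := sphereAwayFromPoles_subset_sphereZone hε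
    have hδ : 0 < ε ^ 2 / 2 := by positivity
    obtain ⟨C, -, hC⟩ := exists_sphereCmNorm_sub_le (g := g)
      (G := fun a x => s * eulerProfile a.1 x) (ν := fun a => a.2) (fun a => a.1 2)
      (var_mem_uniformClass K) (fun a ha => ha.2.1) (tower_viscosity K)
      (fun k => (tower_eulerProfile_uniform hK hKJ k).const_mul s) (hgE K hK hKJ) m hδ
      (A := fun _ => sphereAwayFromPoles ε)
      (fun a ha X hX => ⟨hZ hX, ha, (hZ hX).2⟩)
    refine ⟨C, fun ν hν hν1 c hc => ?_⟩
    refine (sphereCmNorm_congr (hZ.trans (sphereZone_subset_offAxis hδ))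
      (flowField_sub_euler_eqOn hs1 (hKJ hc) _ _ _)).trans_le ?_
    exact hC (c, ν) ⟨hc, hν, hν1⟩

theorem exists_family_with_jump :
    ∃ (u : ((Fin 3 → ℝ) × ℝ) × ℝ → E3 → E3) (p : ((Fin 3 → ℝ) × ℝ) × ℝ → E3 → ℝ),
        (∀ a ∈ paramSetAngle, IsHomSolution a.1.2 (u a) (p a)) ∧
        (∀ (m : ℕ) (ε : ℝ), 0 < ε →
          ContinuousIntoCm m (sphereAwayFromPoles ε) paramSetAngle
            (fun a x => (u a x, p a x))) ∧
        (∀ K : Set (Fin 3 → ℝ), IsCompact K → K ⊆ interior (paramJ 0) →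
          ∀ (m : ℕ) (ε : ℝ), 0 < ε → ∃ C : ℝ, ∀ θ₀ ∈ Set.Ioo 0 Real.pi,
            ∀ ν : ℝ, 0 < ν → ν ≤ 1 → ∀ c ∈ K,
              sphereCmNorm m (sphereBand (θ₀ + ε) (Real.pi - ε))
                  (fun x => (u ((c, ν), θ₀) x, p ((c, ν), θ₀) x)
                    - (eulerV (-1) c x, eulerQ c x))
                + sphereCmNorm m (sphereBand ε (θ₀ - ε))
                  (fun x => (u ((c, ν), θ₀) x, p ((c, ν), θ₀) x)
                    - (eulerV 1 c x, eulerQ c x))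
                ≤ ENNReal.ofReal (C * ν)) := by
  have hsub : paramSetAngle ⊆ goodParamsAngle := prod_mono paramSet_subset Subset.rfl
  refine ⟨fun b X => (riccatiFlow b.1 (gMatch b) X).1, fun b X => (riccatiFlow b.1 (gMatch b) X).2,
    fun b hb => ?_, fun m ε hε => ?_, fun K hK hKJ m ε hε => ?_⟩
  · have hb' := hsub hb
    exact (Riccati.of_hasDerivAt hb.1.1 fun x hx => hasDerivAt_gMatch hb' hx).isHomSolution
      (Tower.contDiffOn_infty tower_gMatch hb')
  · have hx := var_mem_contClass goodParamsAngle
    have hν : ∀ k, Tower (contClass goodParamsAngle) k (fun b _ => b.1.2) := fun k =>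
      Tower.of_param (continuousOn_mem_contClass_param (by fun_prop)) k
    have hc : ∀ k, Tower (contClass goodParamsAngle) k (fun b _ => b.1.1 2) := fun k =>
      Tower.of_param (continuousOn_mem_contClass_param (by fun_prop)) k
    have hq := Tower.pressureProfile hx hν hc tower_gMatch
    have ha := Tower.radialProfile hx tower_gMatch
    have hb : ∀ k, Tower (contClass goodParamsAngle) k (fun b x => -gMatch b x) := fun k =>
      (tower_gMatch k).neg
    exact continuousIntoCm_flowField hsub ha hb hq m (by positivity)
      (sphereAwayFromPoles_subset_sphereZone hε)
  -- The same δ serves for all θ₀, so the constants obtained do not depend on θ₀.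
  · obtain ⟨δ, hδ, hcos⟩ := exists_cos_add_le hε
    obtain ⟨C, hC0, hC⟩ := exists_sphereCmNorm_sub_le (g := gMatch)
      (G := fun b x => -1 * eulerProfile b.1.1 x) (ν := fun b => b.1.2) (fun b => b.1.1 2)
      (tower_lower (Tower.var (var_mem_uniformClass K) 0)).mem (fun b hb => hb.1.2.1)
      (fun k => tower_lower (tower_viscosity K k))
      (fun k => tower_lower ((tower_eulerProfile_uniform hK hKJ k).const_mul (-1)))
      (fun k => (tower_gMatch_lower hK hKJ k).congr fun b _ x _ => by ring) m hδ
      (A := fun b => sphereBand (b.2 + ε) (Real.pi - ε))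
      (fun b hb X hX => ⟨(sphereBand_lower hb.2 hcos hX).1, hb,
        (sphereBand_lower hb.2 hcos hX).2⟩)
    obtain ⟨C', hC0', hC'⟩ := exists_sphereCmNorm_sub_le (g := gMatch)
      (G := fun b x => 1 * eulerProfile b.1.1 x) (ν := fun b => b.1.2) (fun b => b.1.1 2)
      (tower_upper (Tower.var (var_mem_uniformClass K) 0)).mem (fun b hb => hb.1.2.1)
      (fun k => tower_upper (tower_viscosity K k))
      (fun k => tower_upper ((tower_eulerProfile_uniform hK hKJ k).const_mul 1))
      (fun k => (tower_gMatch_upper hK hKJ k).congr fun b _ x _ => by ring) m hδ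
      (A := fun b => sphereBand ε (b.2 - ε))
      (fun b hb X hX => ⟨(sphereBand_upper hε hb.2 hcos hX).1, hb,
        (sphereBand_upper hε hb.2 hcos hX).2⟩)
    refine ⟨C + C', fun θ₀ hθ₀ ν hν hν1 c hc => ?_⟩
    have hmem : ((c, ν), θ₀) ∈ inviscidSetAngle K := ⟨⟨hc, hν, hν1⟩, hθ₀⟩
    rw [add_mul, ENNReal.ofReal_add (by positivity) (by positivity)]
    refine add_le_add ?_ ?_
    · refine (sphereCmNorm_congr (fun X hX => sphereZone_subset_offAxis hδ
        (sphereBand_lower hθ₀ hcos hX).1)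
        (flowField_sub_euler_eqOn (by norm_num) (hKJ hc) _ _ _)).trans_le ?_
      exact hC _ hmem
    · refine (sphereCmNorm_congr (fun X hX => sphereZone_subset_offAxis hδ
        (sphereBand_upper hε hθ₀ hcos hX).1)
        (flowField_sub_euler_eqOn (by norm_num) (hKJ hc) _ _ _)).trans_le ?_
      exact hC' _ hmem

end

theorem theorem1p3 :
    (∀ s : ℝ, s = 1 ∨ s = -1 →
      ∃ (u : (Fin 3 → ℝ) × ℝ → E3 → E3) (p : (Fin 3 → ℝ) × ℝ → E3 → ℝ),
        (∀ a ∈ paramSet, IsHomSolution a.2 (u a) (p a)) ∧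
        (∀ (m : ℕ) (ε : ℝ), 0 < ε →
          ContinuousIntoCm m (sphereAwayFromPoles ε) paramSet (fun a x => (u a x, p a x))) ∧
        (∀ K : Set (Fin 3 → ℝ), IsCompact K → K ⊆ interior (paramJ 0) →
          ∀ (m : ℕ) (ε : ℝ), 0 < ε → ∃ C : ℝ, ∀ ν : ℝ, 0 < ν → ν ≤ 1 → ∀ c ∈ K,
            sphereCmNorm m (sphereAwayFromPoles ε)
                (fun x => (u (c, ν) x, p (c, ν) x) - (eulerV s c x, eulerQ c x))
              ≤ ENNReal.ofReal (C * ν))) ∧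
    (∃ (u : ((Fin 3 → ℝ) × ℝ) × ℝ → E3 → E3) (p : ((Fin 3 → ℝ) × ℝ) × ℝ → E3 → ℝ),
        (∀ a ∈ paramSetAngle, IsHomSolution a.1.2 (u a) (p a)) ∧
        (∀ (m : ℕ) (ε : ℝ), 0 < ε →
          ContinuousIntoCm m (sphereAwayFromPoles ε) paramSetAngle
            (fun a x => (u a x, p a x))) ∧
        (∀ K : Set (Fin 3 → ℝ), IsCompact K → K ⊆ interior (paramJ 0) →
          ∀ (m : ℕ) (ε : ℝ), 0 < ε → ∃ C : ℝ, ∀ θ₀ ∈ Set.Ioo 0 Real.pi,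
            ∀ ν : ℝ, 0 < ν → ν ≤ 1 → ∀ c ∈ K,
              sphereCmNorm m (sphereBand (θ₀ + ε) (Real.pi - ε))
                  (fun x => (u ((c, ν), θ₀) x, p ((c, ν), θ₀) x)
                    - (eulerV (-1) c x, eulerQ c x))
                + sphereCmNorm m (sphereBand ε (θ₀ - ε))
                  (fun x => (u ((c, ν), θ₀) x, p ((c, ν), θ₀) x)
                    - (eulerV 1 c x, eulerQ c x))
                ≤ ENNReal.ofReal (C * ν))) ∧
    (∀ c ∈ interior (paramJ 0),
      IsHomSolution 0 (eulerV 1 c) (eulerQ c) ∧ IsHomSolution 0 (eulerV (-1) c) (eulerQ c) ∧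
      ∀ x ∈ sphereBand 0 Real.pi, eulerV 1 c x ≠ eulerV (-1) c x) := by
  refine ⟨fun s hs => ?_, exists_family_with_jump, fun c hc =>
    ⟨isHomSolution_euler (by norm_num) hc, isHomSolution_euler (by norm_num) hc,
      fun X hX => eulerV_ne hc (sphereBand_subset_offAxis hX)⟩⟩
  rcases hs with rfl | rfl
  · exact exists_family_of_tower (by norm_num) (fun a ha x hx => hasDerivAt_gPlus ha hx)
      tower_gPlus fun K hK hKJ k => (tower_gPlusError hK hKJ k).congr fun a _ x _ => by
        rw [gPlusError, one_mul]
  · exact exists_family_of_tower (by norm_num) (fun a ha x hx => hasDerivAt_gMinus ha hx)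
      tower_gMinus fun K hK hKJ k => (tower_gMinusError hK hKJ k).congr fun a _ x _ => by
        rw [gMinusError, neg_one_mul, sub_neg_eq_add]
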